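/- Let $X$ be a compact hyperkähler manifold of complex dimension $2n$ with $n>1$, i.e. a simply connected compact Kähler manifold such that $H^0(X,\Omega_X^2)$ is spanned by a holomorphic symplectic (closed, everywhere non-degenerate) form $\sigma$. Let $f\colon X\to B$ be a Lagrangian fibration, i.e. a surjective holomorphic map with connected fibres onto a normal complex space whose generic fibre is a smooth Lagrangian submanifold. Let $T=f^{-1}(t)$ be a smooth fibre, i.e. $B$ is smooth at $t$ and $f$ is submersive along $T$. For a subset $D\subset X$ let $D_{\rm reg}$ be the set of points of $D$ near which $D$ is a smooth complex hypersurface of $X$. The characteristic foliation of $D$ is the line bundle $\mathcal F=\ker(\sigma|_D\colon\mathcal T_D\to\Omega_D)$ on $D_{\rm reg}$; its leaves are the maximal connected immersed complex submanifolds $L$ of $D_{\rm reg}$ with $\mathcal T_L=\mathcal F|_L$. (1) Every point $x\in T$ determines an identification $T\cong T_xT/\Gamma_x$ as a complex torus, where $\Gamma_x\subset T_xT$ is a lattice, such that $0$ is mapped to $x$ and the projection $T_xT\to T$ has differential $\mathrm{id}$ at $0$. Moreover, $\sigma$ induces an isomorphism $T_xT\cong T_t^*B$, under which $a\in T_xT$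 corresponds to $\alpha\in T_t^*B$ if $\sigma(a,\cdot)=\alpha\circ d_xf$. For a hypersurface $H\subset B$ which contains $t$ and is smooth at $t$, let $D=f^{-1}(H)$, let $N_H\subset T_t^*B$ be the line of covectors vanishing on $T_tH$ and, for $x\in T$, let $\ell_x\subset T_xT$ be the line corresponding to $N_H$. Consider the following property of $H$: $(*)$ One has $T\subset D_{\rm reg}$ and, for every $x\in T$: there is exactly one leaf $L$ of the characteristic foliation of $D$ through $x$; it is the image of $\ell_x$ under $T_xT\to T_xT/\Gamma_x\cong T$; the line $\ell_x$ is irrational with respect to $\Gamma_x$, i.e. it is not contained in any proper real subspace of $T_xT$ that is spanned by elements of $\Gamma_x$; and $L$ is contained and dense in $T$. (2) Then $(*)$ holds for the very general hypersurface $H$ through $t$, in the following two senses (very general means: outside a countable union of proper Zariski closed subsets). (a) For the very general point $q\in\mathbb P(T_t^*B)$, every hypersurface $H\subset B$ that contains $t$, is smooth at $t$ and satisfies $N_H=q$ has property $(*)$. (b) Let $V$ be a finite-dimensional linear system of sections of a holomorphic line bundle on $B$ that separates tangent vectors at $t$, i.e. the differentials at $t$ of the sections in the subspace $V_t\subset V$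 of sections vanishing at $t$ fill $T_t^*B$. (This holds for example for the complete linear system of a very ample line bundle.) Then for the very general $[s]\in\mathbb P(V_t)$ the zero locus $H=\{s=0\}$ is a hypersurface smooth at $t$ and has property $(*)$. -/

import Mathlib

open Set Filter Topology
open scoped Manifold ContDiff LinearAlgebra.Projectivization

namespace CharFol

universe u v w

section ComplexSpaces

/-- A reduced complex analytic space, given by its sheaf of holomorphic functions: `HolAt g b` says
that (the germ at `b` of) the function `g` is holomorphic at `b`. Locally the space is isomorphic to
an analytic subset `{z ∈ Ω | F₁ z = ⋯ = Fₘ z = 0}` of an open subset `Ω` of some `ℂᴺ`, together with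
the functions which are locally restrictions of holomorphic functions of the ambient space. -/
class ComplexSpace (B : Type v) [TopologicalSpace B] where
  HolAt : (B → ℂ) → B → Prop
  local_model : ∀ b : B, ∃ (U : Set B) (N m : ℕ) (i : B → EuclideanSpace ℂ (Fin N))
    (Ω : Set (EuclideanSpace ℂ (Fin N))) (F : Fin m → EuclideanSpace ℂ (Fin N) → ℂ),
    IsOpen U ∧ b ∈ U ∧ IsOpen Ω ∧ (∀ k, AnalyticOnNhd ℂ (F k) Ω) ∧
    IsEmbedding (U.domRestrict i) ∧ i '' U = {z ∈ Ω | ∀ k, F k z = 0} ∧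
    ∀ c ∈ U, ∀ g : B → ℂ,
      HolAt g c ↔ ∃ G : EuclideanSpace ℂ (Fin N) → ℂ, AnalyticAt ℂ G (i c) ∧ g =ᶠ[𝓝 c] G ∘ i

/-- The complex space `B` is smooth of dimension `n` at `t`, as witnessed by a holomorphic chart
around `t`: an isomorphism of a neighbourhood of `t` with an open subset of `ℂⁿ`. Through such a
chart the tangent space `T_t B` is `ℂⁿ` and the cotangent space `T_t^* B` is its dual. -/
structure SmoothChart (B : Type v) [TopologicalSpace B] [ComplexSpace B] (n : ℕ) (t : B) where
  chart : OpenPartialHomeomorph B (EuclideanSpace ℂ (Fin n))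
  mem_source : t ∈ chart.source
  holAt_iff : ∀ c ∈ chart.source, ∀ g : B → ℂ, ComplexSpace.HolAt g c ↔
    ∃ G : EuclideanSpace ℂ (Fin n) → ℂ, AnalyticAt ℂ G (chart c) ∧ g =ᶠ[𝓝 c] G ∘ chart

/-- The cotangent space `T_t^* B` of `B` at a smooth point of dimension `n`, read in a chart. -/
abbrev Cotangent (n : ℕ) : Type := EuclideanSpace ℂ (Fin n) →L[ℂ] ℂ

variable {B : Type v} [TopologicalSpace B] [ComplexSpace B] {n : ℕ} {t : B}

/-- `H ⊆ B` passes through `t`, is near `t` a complex hypersurface that is smooth at `t`, and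
`α ∈ T_t^* B` spans its conormal line there, i.e. `ker α = T_t H`. -/
def HasConormal (e : SmoothChart B n t) (H : Set B) (α : Cotangent n) : Prop :=
  α ≠ 0 ∧ t ∈ H ∧ ∃ h : EuclideanSpace ℂ (Fin n) → ℂ, AnalyticAt ℂ h (e.chart t) ∧
    fderiv ℂ h (e.chart t) = α ∧ ∀ᶠ c in 𝓝 t, c ∈ H ↔ h (e.chart c) = 0

/-- A linear system on `B`: a holomorphic line bundle, given by transition functions
`g i j` with respect to an open cover `U`, and a linear map from a vector space `V` to its
global holomorphic sections; the section attached to `v` is `s v i` in the trivialisation over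
`U i`. -/
structure LinearSystem (B : Type v) [TopologicalSpace B] [ComplexSpace B]
    (ι : Type w) (V : Type u) [AddCommGroup V] [Module ℂ V] where
  U : ι → Set B
  isOpen_U : ∀ i, IsOpen (U i)
  cover : ∀ b, ∃ i, b ∈ U i
  g : ι → ι → B → ℂ
  g_hol : ∀ i j, ∀ b ∈ U i ∩ U j, ComplexSpace.HolAt (g i j) b
  g_ne_zero : ∀ i j, ∀ b ∈ U i ∩ U j, g i j b ≠ 0
  g_cocycle : ∀ i j k, ∀ b ∈ U i ∩ U j ∩ U k, g i j b * g j k b = g i k b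
  s : V →ₗ[ℂ] (ι → B → ℂ)
  s_hol : ∀ v i, ∀ b ∈ U i, ComplexSpace.HolAt (s v i) b
  s_glue : ∀ v i j, ∀ b ∈ U i ∩ U j, s v i b = g i j b * s v j b

namespace LinearSystem

variable {ι : Type w} {V : Type u} [AddCommGroup V] [Module ℂ V]

/-- The zero locus in `B` of the section attached to `v`. -/
def zeroLocus (S : LinearSystem B ι V) (v : V) : Set B :=
  {b | ∃ i, b ∈ S.U i ∧ S.s v i b = 0}

/-- The subspace of those `v` whose section vanishes at `t`. -/
def through (S : LinearSystem B ι V) (t : B) : Submodule ℂ V where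
  carrier := {v | ∀ i, t ∈ S.U i → S.s v i t = 0}
  zero_mem' := by intro i _; simp
  add_mem' := by intro a b ha hb i hi; simp [ha i hi, hb i hi]
  smul_mem' := by intro c a ha i hi; simp [ha i hi]

/-- The linear system separates tangent vectors at `t` (as every very ample complete linear
system does): the differentials at `t` of its sections vanishing at `t` fill `T_t^* B`. -/
def SeparatesTangents (S : LinearSystem B ι V) (e : SmoothChart B n t) : Prop :=
  ∀ i, t ∈ S.U i → ∀ α : Cotangent n, ∃ v ∈ S.through t,
    fderiv ℂ (S.s v i ∘ e.chart.symm) (e.chart t) = α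

end LinearSystem

/-- Zariski closed subsets of the projective space `ℙ(W)`: common zero loci of homogeneous
polynomials in linear coordinates of `W`. -/
def IsZariskiClosed {W : Type u} [AddCommGroup W] [Module ℂ W] [FiniteDimensional ℂ W]
    (Z : Set (ℙ ℂ W)) : Prop :=
  ∃ P : Set (MvPolynomial (Fin (Module.finrank ℂ W)) ℂ),
    (∀ p ∈ P, ∃ d, p.IsHomogeneous d) ∧
    Z = {q | ∀ p ∈ P, MvPolynomial.eval (fun i => (Module.finBasis ℂ W).repr q.rep i) p = 0}

/-- `Q` holds for the very general point of `ℙ(W)`: everywhere outside the union of countably many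
proper Zariski closed subsets. -/
def ForVeryGeneral {W : Type u} [AddCommGroup W] [Module ℂ W] [FiniteDimensional ℂ W]
    (Q : ℙ ℂ W → Prop) : Prop :=
  ∃ Z : ℕ → Set (ℙ ℂ W), (∀ k, IsZariskiClosed (Z k) ∧ Z k ≠ univ) ∧
    ∀ q, (∀ k, q ∉ Z k) → Q q

end ComplexSpaces

section Manifolds

/- Throughout, `X` is a complex manifold modelled on `E`. The tangent space
`TangentSpace 𝓘(ℂ, E) x` is by definition a copy of `E`, so a field of forms on tangent spaces is
written as a function from `X` to forms on `E`. -/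
variable {E : Type u} [NormedAddCommGroup E] [NormedSpace ℂ E]
  {X : Type v} [TopologicalSpace X] [ChartedSpace E X]

/-- The differential at `z` of the inverse of the preferred chart around `x₀`. -/
noncomputable def chartInvDeriv (x₀ : X) (z : E) : E →L[ℂ] E :=
  mfderiv 𝓘(ℂ, E) 𝓘(ℂ, E) (chartAt E x₀).symm z

/-- Coordinate expression of a complex 2-form in the chart around `x₀`. -/
noncomputable def formInChart (σ : X → E [⋀^Fin 2]→L[ℂ] ℂ) (x₀ : X) (z : E) :
    E [⋀^Fin 2]→L[ℂ] ℂ :=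
  (σ ((chartAt E x₀).symm z)).compContinuousLinearMap (chartInvDeriv x₀ z)

/-- Coordinate expression of a real 2-form in the chart around `x₀`. -/
noncomputable def realFormInChart (κ : X → E [⋀^Fin 2]→L[ℝ] ℝ) (x₀ : X) (z : E) :
    E [⋀^Fin 2]→L[ℝ] ℝ :=
  (κ ((chartAt E x₀).symm z)).compContinuousLinearMap
    ((chartInvDeriv x₀ z).restrictScalars ℝ)

/-- Holomorphic 2-forms, i.e. elements of `H⁰(X, Ω²)`. -/
def IsHolomorphicForm (σ : X → E [⋀^Fin 2]→L[ℂ] ℂ) : Prop :=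
  ∀ x₀ : X, AnalyticOnNhd ℂ (formInChart σ x₀) (chartAt E x₀).target

/-- Holomorphic symplectic forms: closed, everywhere non-degenerate holomorphic 2-forms. -/
structure IsHolomorphicSymplectic (σ : X → E [⋀^Fin 2]→L[ℂ] ℂ) : Prop where
  holomorphic : IsHolomorphicForm σ
  closed : ∀ x₀ : X, ∀ z ∈ (chartAt E x₀).target, extDeriv (formInChart σ x₀) z = 0
  nondegenerate : ∀ x, ∀ a : E, (∀ b : E, σ x ![a, b] = 0) → a = 0

/-- Kähler forms: smooth closed positive real forms of type (1,1). -/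
structure IsKahlerForm (κ : X → E [⋀^Fin 2]→L[ℝ] ℝ) : Prop where
  smooth : ∀ x₀ : X, ContDiffOn ℝ ∞ (realFormInChart κ x₀) (chartAt E x₀).target
  closed : ∀ x₀ : X, ∀ z ∈ (chartAt E x₀).target, extDeriv (realFormInChart κ x₀) z = 0
  type_one_one : ∀ x, ∀ a b : E, κ x ![Complex.I • a, Complex.I • b] = κ x ![a, b]
  positive : ∀ x, ∀ a : E, a ≠ 0 → 0 < κ x ![a, Complex.I • a]

/-- `(X, σ)` is a compact hyperkähler manifold: a simply connected compact Kähler manifold such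
that `H⁰(X, Ω²)` is spanned by the holomorphic symplectic form `σ`. -/
structure IsHyperkahler (σ : X → E [⋀^Fin 2]→L[ℂ] ℂ) : Prop where
  hausdorff : T2Space X
  manifold : IsManifold 𝓘(ℂ, E) ω X
  compact : CompactSpace X
  simply_connected : SimplyConnectedSpace X
  kahler : ∃ κ : X → E [⋀^Fin 2]→L[ℝ] ℝ, IsKahlerForm κ
  symplectic : IsHolomorphicSymplectic σ
  spans : ∀ η : X → E [⋀^Fin 2]→L[ℂ] ℂ, IsHolomorphicForm η → ∃ c : ℂ, ∀ x, η x = c • σ x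

section Foliation

variable (E) in
/-- The points of `D ⊆ X` near which `D` is a smooth complex hypersurface. -/
def regularLocus (D : Set X) : Set X :=
  {x | x ∈ D ∧ ∃ h : X → ℂ, ContMDiffAt 𝓘(ℂ, E) 𝓘(ℂ, ℂ) ω h x ∧
    mfderiv 𝓘(ℂ, E) 𝓘(ℂ, ℂ) h x ≠ 0 ∧ ∀ᶠ y in 𝓝 x, y ∈ D ↔ h y = 0}

/-- The tangent space `T_x D`: the vectors killed by the differentials of all holomorphic germs
that vanish on `D`. -/
def tangentOf (D : Set X) (x : X) : Set E :=
  {a | ∀ h : X → ℂ, ContMDiffAt 𝓘(ℂ, E) 𝓘(ℂ, ℂ) ω h x → (∀ᶠ y in 𝓝 x, y ∈ D → h y = 0) →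
    mfderiv 𝓘(ℂ, E) 𝓘(ℂ, ℂ) h x a = 0}

/-- The fibre at `x` of the characteristic foliation `ker (σ|_D : T_D → Ω_D)`. -/
def charFoliation (σ : X → E [⋀^Fin 2]→L[ℂ] ℂ) (D : Set X) (x : X) : Set E :=
  {a | a ∈ tangentOf D x ∧ ∀ b ∈ tangentOf (E := E) D x, σ x ![a, b] = 0}

/-- `L` is a connected immersed complex submanifold of (the smooth locus of) `D`, i.e. the image of
an injective holomorphic immersion `j : N → X` of a connected Riemann surface, whose tangent
spaces are the lines of the characteristic foliation. -/
def IsIntegralSubmanifold (σ : X → E [⋀^Fin 2]→L[ℂ] ℂ) (D L : Set X) : Prop :=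
  ∃ (N : Type) (_ : TopologicalSpace N) (_ : ChartedSpace ℂ N) (j : N → X),
    IsManifold 𝓘(ℂ, ℂ) ω N ∧ T2Space N ∧ ConnectedSpace N ∧
    ContMDiff 𝓘(ℂ, ℂ) 𝓘(ℂ, E) ω j ∧ Function.Injective j ∧ range j = L ∧
    ∀ p : N, j p ∈ regularLocus E D ∧
      Function.Injective (mfderiv 𝓘(ℂ, ℂ) 𝓘(ℂ, E) j p) ∧
      range (mfderiv 𝓘(ℂ, ℂ) 𝓘(ℂ, E) j p) = charFoliation σ D (j p)

/-- The leaves of the characteristic foliation of `D`: the maximal connected immersed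
submanifolds tangent to it. -/
def IsLeaf (σ : X → E [⋀^Fin 2]→L[ℂ] ℂ) (D L : Set X) : Prop :=
  IsIntegralSubmanifold σ D L ∧ ∀ L', IsIntegralSubmanifold σ D L' → L ⊆ L' → L' = L

end Foliation

section Fibration

variable {B : Type w} [TopologicalSpace B] [ComplexSpace B] {n : ℕ} {t : B}

variable (E) in
/-- The differential at `x` of `f : X → B`, read in a chart of `B`. -/
noncomputable def fibDeriv (f : X → B) (e : SmoothChart B n t) (x : X) :
    E →L[ℂ] EuclideanSpace ℂ (Fin n) :=
  mfderiv 𝓘(ℂ, E) 𝓘(ℂ, EuclideanSpace ℂ (Fin n)) (e.chart ∘ f) x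

variable (E) in
/-- The fibre of `f` over the smooth point `t` of `B` is smooth: `f` is submersive along it. -/
def IsSmoothFibre (f : X → B) (e : SmoothChart B n t) : Prop :=
  ∀ x, f x = t → Function.Surjective (fibDeriv E f e x)

variable (E) in
/-- The tangent space at `x` of the fibre of `f` through `x`. -/
noncomputable abbrev fibreTangent (f : X → B) (e : SmoothChart B n t) (x : X) : Submodule ℂ E :=
  (fibDeriv E f e x).ker

/-- Lagrangian fibrations `f : X → B`, where `dim X = 2n`: surjective holomorphic maps with
connected fibres onto a normal complex space `B` whose generic fibre is a (smooth) Lagrangian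
submanifold. For `f` surjective with connected fibres from a compact manifold, `f` is holomorphic
and `B` is normal if and only if `f_* 𝒪_X = 𝒪_B`, which is the condition `pushforward`. -/
structure IsLagrangianFibration (σ : X → E [⋀^Fin 2]→L[ℂ] ℂ) (f : X → B) (n : ℕ) : Prop where
  hausdorff : T2Space B
  continuous : Continuous f
  surjective : Function.Surjective f
  connected_fibres : ∀ b, IsConnected (f ⁻¹' {b})
  pushforward : ∀ (g : B → ℂ) (b : B), ComplexSpace.HolAt g b ↔
    ∀ x, f x = b → ContMDiffAt 𝓘(ℂ, E) 𝓘(ℂ, ℂ) ω (g ∘ f) x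
  lagrangian : ∃ B₀ : Set B, IsOpen B₀ ∧ Dense B₀ ∧ ∀ b ∈ B₀, ∃ e : SmoothChart B n b,
    IsSmoothFibre E f e ∧ ∀ x, f x = b → ∀ a ∈ fibreTangent E f e x,
      ∀ c ∈ fibreTangent E f e x, σ x ![a, c] = 0

/-- The fibre `T = f⁻¹(t)` as a complex torus `T_x T / Γ` with origin `x`, together with the
isomorphism `T_t^* B ≅ T_x T` induced by `σ`. -/
structure TorusFibre (σ : X → E [⋀^Fin 2]→L[ℂ] ℂ) (f : X → B) (e : SmoothChart B n t)
    (x : X) where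
  /-- the isomorphism `T_t^* B ≅ T_x T` -/
  ofCotangent : Cotangent n ≃ₗ[ℂ] fibreTangent E f e x
  ofCotangent_spec : ∀ (α : Cotangent n) (b : E),
    σ x ![(ofCotangent α : E), b] = α (fibDeriv E f e x b)
  /-- the lattice `Γ` -/
  lattice : Submodule ℤ (fibreTangent E f e x)
  discrete : DiscreteTopology lattice
  full : Submodule.span ℝ (lattice : Set (fibreTangent E f e x)) = ⊤
  /-- the projection `T_x T → T_x T / Γ = T` -/
  proj : fibreTangent E f e x → X
  proj_hol : ContMDiff 𝓘(ℂ, fibreTangent E f e x) 𝓘(ℂ, E) ω proj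
  proj_immersion : ∀ a, Function.Injective
    (mfderiv 𝓘(ℂ, fibreTangent E f e x) 𝓘(ℂ, E) proj a)
  proj_range : range proj = f ⁻¹' {t}
  proj_eq_iff : ∀ a b, proj a = proj b ↔ a - b ∈ lattice
  proj_zero : proj 0 = x
  proj_deriv_zero : HasMFDerivAt 𝓘(ℂ, fibreTangent E f e x) 𝓘(ℂ, E) proj 0
    (fibreTangent E f e x).subtypeL

/-- A complex subspace `ℓ` of `K` is irrational with respect to `Γ` if it is contained in no proper
real subspace that is rational, i.e. spanned by elements of `Γ`. -/
def IsIrrational {K : Type*} [AddCommGroup K] [Module ℂ K] [Module ℝ K]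
    (Γ : Submodule ℤ K) (l : Submodule ℂ K) : Prop :=
  ∀ W : Submodule ℝ K, Submodule.span ℝ ((W : Set K) ∩ Γ) = W → (l : Set K) ⊆ W → W = ⊤

/-- For the hypersurface `H` through `t` with conormal vector `α` at `t`, and a point `x` of
`T = f⁻¹(t)`: there is exactly one leaf of the characteristic foliation of `D = f⁻¹(H)` through
`x`, it is the image in `T = T_x T / Γ` of the line in `T_x T ≅ T_t^* B` spanned by `α`, this line
is irrational with respect to `Γ`, and the leaf is a dense subset of `T`. -/
def HasDenseIrrationalLeaf (σ : X → E [⋀^Fin 2]→L[ℂ] ℂ) (f : X → B) (e : SmoothChart B n t)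
    (H : Set B) (α : Cotangent n) (x : X) (T : TorusFibre σ f e x) : Prop :=
  ∃ L : Set X, IsLeaf σ (f ⁻¹' H) L ∧ x ∈ L ∧
    (∀ L', IsLeaf σ (f ⁻¹' H) L' → x ∈ L' → L' = L) ∧
    L = T.proj '' (Submodule.span ℂ {T.ofCotangent α} : Submodule ℂ (fibreTangent E f e x)) ∧
    IsIrrational T.lattice (Submodule.span ℂ {T.ofCotangent α}) ∧
    L ⊆ f ⁻¹' {t} ∧ f ⁻¹' {t} ⊆ closure L

end Fibration

end Manifolds

end CharFol

namespace CharFol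

/-! ### Extension of local homomorphisms of vector groups -/

section LocalHom

variable {W M : Type*} [NormedAddCommGroup W] [NormedSpace ℝ W] [Monoid M]

/-! The whole theorem comes from the action of the vector group `T_t^*B` on the fibre `T` by
Hamiltonian flows. A covector `α` gives at each `y ∈ T` the vector `ham α` with `σ(ham α, ·) = α ∘
d_y f`. Fibres over points near `t` are isotropic: this is assumed only over a dense open set, but
it extends by continuity to all submersive points (`isotropic_of_mem_submersiveLocus`). Hence `ham`
maps `T_t^*B` isomorphically onto `T_yT`.

Closedness of `σ` makes these fields commute. Concretely, in coordinates that straighten `f`, the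
pairing of vertical with horizontal vectors is a closed coframe on the fibre, and a primitive of it
is a chart in which the fields are constant (`exists_lagrangian_chart`). Such charts are flow boxes.
Compactness of `T` gives flows of uniform duration, uniqueness of flows makes them a local
homomorphism into the self-maps of `T`, and `exists_hom_of_local_hom` extends this to an action of
the whole of `T_t^*B` (`nonempty_fibreAction`). Its orbits are open, so it is transitive on the
connected fibre; stabilisers are discrete by the flow boxes and of full rank by compactness.
Transporting the orbit map at `x` along `ham` at `x` gives the torus `T_xT/Γ_x`. The group is
commutative and transitive, so read in `T_t^*B` the lattice is the same for all `x`.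

If `α` is conormal to `H` at `t`, the characteristic foliation of `f⁻¹(H)` along `T` is spanned by
`ham α` (`charFoliation_eq`). Near `T` it is still tangent to the fibres of `f`, so an integral
submanifold meeting `T` stays in `T`, and then in one orbit of `ℂα`. When `ℂα` contains no nonzero
period this orbit is an injectively immersed copy of `ℂ`, hence the unique leaf. If `ℂα` is also
irrational, Kronecker's theorem (`dense_sup_lattice`) makes the orbit dense.

Both conditions on `α` hold outside countably many proper complex subspaces of `T_t^*B`: the complex
parts of the proper rational real subspaces, and the lines spanned by periods. For a linear system,
these subspaces are pulled back along the surjection from `V_t` to `T_t^*B`. -/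

theorem map_nsmul_of_local_hom {r : ℝ} (A : W → M) (h0 : A 0 = 1)
    (hA : ∀ s s', ‖s‖ < r → ‖s'‖ < r → A (s + s') = A s * A s') (s : W) (m : ℕ)
    (hs : ‖m • s‖ < r) : A (m • s) = A s ^ m := by
  have norm_nsmul : ∀ k : ℕ, ‖k • s‖ = k * ‖s‖ := fun k => by
    rw [← Nat.cast_smul_eq_nsmul ℝ, norm_smul]; simp
  have key : ∀ k ≤ m, A (k • s) = A s ^ k := by
    intro k
    induction k with
    | zero => intro _; simp [h0]
    | succ k ih =>
      intro hk
      have hm : (1 : ℝ) ≤ m := by exact_mod_cast (by omega : 1 ≤ m)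
      have hkm : (k : ℝ) ≤ m := by exact_mod_cast (by omega : k ≤ m)
      rw [norm_nsmul] at hs
      have h1 : ‖k • s‖ < r := by
        rw [norm_nsmul]; exact lt_of_le_of_lt (by gcongr) hs
      have h2 : ‖s‖ < r := lt_of_le_of_lt (by nlinarith [norm_nonneg s]) hs
      rw [succ_nsmul, hA _ _ h1 h2, ih (by omega), pow_succ]
  exact key m le_rfl

/-- A homomorphism defined on a ball of a real normed space extends to the whole space. -/
theorem exists_hom_of_local_hom {r : ℝ} (hr : 0 < r) (A : W → M) (h0 : A 0 = 1)
    (hA : ∀ s s', ‖s‖ < r → ‖s'‖ < r → A (s + s') = A s * A s') :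
    ∃ Φ : W → M, Φ 0 = 1 ∧ (∀ s s', Φ (s + s') = Φ s * Φ s') ∧ ∀ s, ‖s‖ < r → Φ s = A s := by
  have hN : ∀ s : W, ∃ N : ℕ, 0 < N ∧ ‖s‖ < N * r := fun s => by
    obtain ⟨N, hN⟩ := exists_nat_gt (‖s‖ / r)
    rw [div_lt_iff₀ hr] at hN
    refine ⟨N, Nat.pos_of_ne_zero ?_, hN⟩
    rintro rfl
    simp only [Nat.cast_zero, zero_mul] at hN
    exact (norm_nonneg s).not_gt hN
  choose N hN0 hN using hN
  have hdiv : ∀ (s : W) (m : ℕ), 0 < m → ‖s‖ < m * r → ‖(m : ℝ)⁻¹ • s‖ < r := by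
    intro s m hm h
    have : (0 : ℝ) < m := by exact_mod_cast hm
    rw [norm_smul, norm_inv, Real.norm_natCast, inv_mul_lt_iff₀ this]
    exact h
  have hmul : ∀ (s : W) (m k : ℕ), 0 < m → 0 < k → ‖s‖ < m * r →
      A ((m : ℝ)⁻¹ • s) ^ m = A (((m * k : ℕ) : ℝ)⁻¹ • s) ^ (m * k) := by
    intro s m k hm hk h
    have hk' : (k : ℝ) ≠ 0 := by positivity
    have e : (m : ℝ)⁻¹ • s = k • (((m * k : ℕ) : ℝ)⁻¹ • s) := by
      rw [← Nat.cast_smul_eq_nsmul ℝ, smul_smul]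
      congr 1
      push_cast
      field_simp
    have := map_nsmul_of_local_hom A h0 hA (((m * k : ℕ) : ℝ)⁻¹ • s) k
      (by rw [← e]; exact hdiv s m hm h)
    rw [e, this, ← pow_mul, mul_comm k m]
  -- Any two admissible denominators have the same common refinement, their product, so `A (s/m)^m`
  -- does not depend on `m`.
  have hindep : ∀ (s : W) (m : ℕ), 0 < m → ‖s‖ < m * r →
      A ((N s : ℝ)⁻¹ • s) ^ N s = A ((m : ℝ)⁻¹ • s) ^ m := by
    intro s m hm h
    rw [hmul s (N s) m (hN0 s) hm (hN s), hmul s m (N s) hm (hN0 s) h, mul_comm]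
  refine ⟨fun s => A ((N s : ℝ)⁻¹ • s) ^ N s, by simp [h0], ?_, ?_⟩
  · intro s s'
    obtain ⟨m, hm⟩ := exists_nat_gt ((‖s‖ + ‖s'‖) / r)
    rw [div_lt_iff₀ hr] at hm
    have hm0 : 0 < m := by
      refine Nat.pos_of_ne_zero ?_
      rintro rfl
      simp only [Nat.cast_zero, zero_mul] at hm
      linarith [norm_nonneg s, norm_nonneg s']
    have hs : ‖s‖ < m * r := by linarith [norm_nonneg s']
    have hs' : ‖s'‖ < m * r := by linarith [norm_nonneg s]
    have hss' : ‖s + s'‖ < m * r := (norm_add_le s s').trans_lt hm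
    simp only
    rw [hindep s m hm0 hs, hindep s' m hm0 hs', hindep _ m hm0 hss', smul_add,
      hA _ _ (hdiv s m hm0 hs) (hdiv s' m hm0 hs'), Commute.mul_pow]
    -- The target monoid need not be commutative; the two values commute because both products equal
    -- `A` of the same sum.
    rw [Commute, SemiconjBy, ← hA _ _ (hdiv s m hm0 hs) (hdiv s' m hm0 hs'),
      ← hA _ _ (hdiv s' m hm0 hs') (hdiv s m hm0 hs), add_comm]
  · intro s hs
    have := hindep s 1 one_pos (by simpa using hs)
    simpa using this

end LocalHom

/-! ### Closed subgroups of real vector spaces and Kronecker's theorem -/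

section Density

variable {V : Type*} [NormedAddCommGroup V] [NormedSpace ℝ V] [FiniteDimensional ℝ V]

/-- The largest linear subspace contained in an additive subgroup of a real vector space. -/
def maxSubspace {V : Type*} [AddCommGroup V] [Module ℝ V] (C : AddSubgroup V) :
    Submodule ℝ V where
  carrier := {v | ∀ c : ℝ, c • v ∈ C}
  zero_mem' := by intro c; simp
  add_mem' := by intro a b ha hb c; rw [smul_add]; exact C.add_mem (ha c) (hb c)
  smul_mem' := by intro d a ha c; rw [smul_smul]; exact ha _

/-- If `C` accumulates at `x`, the normalised differences `d - x` have a limit direction `v` of norm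
one. Large integer multiples of the small elements `d - x` approximate every point of the line `ℝv`,
which therefore lies in the closed group `C`. An ultrafilter does the work of a convergent
subsequence. -/
theorem discreteTopology_of_closed_of_no_line (C : AddSubgroup V) (hC : IsClosed (C : Set V))
    (h : ∀ v : V, (∀ c : ℝ, c • v ∈ C) → v = 0) : DiscreteTopology C := by
  by_contra hnd
  replace hnd : ¬ DiscreteTopology (C : Set V) := hnd
  rw [discreteTopology_subtype_iff] at hnd
  push Not at hnd
  obtain ⟨x, hx, hne⟩ := hnd
  set F := Ultrafilter.of (𝓝[≠] x ⊓ 𝓟 (C : Set V)) with hFdef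
  have hF : (F : Filter V) ≤ 𝓝[≠] x ⊓ 𝓟 (C : Set V) := Ultrafilter.of_le _
  have hFx : Tendsto (fun d => ‖d - x‖) F (𝓝 0) := by
    have : Tendsto (fun d => ‖d - x‖) (𝓝 x) (𝓝 0) := by
      have : Continuous fun d : V => ‖d - x‖ := by fun_prop
      simpa using this.tendsto x
    exact this.mono_left (hF.trans (inf_le_left.trans nhdsWithin_le_nhds))
  have hFne : ∀ᶠ d in (F : Filter V), d - x ≠ 0 := by
    have : ∀ᶠ d in 𝓝[≠] x, d - x ≠ 0 := by
      filter_upwards [self_mem_nhdsWithin] with d hd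
      exact sub_ne_zero.2 hd
    exact this.filter_mono (hF.trans inf_le_left)
  have hFC : ∀ᶠ d in (F : Filter V), d - x ∈ C := by
    have : ∀ᶠ d in 𝓟 (C : Set V), d - x ∈ C := by
      rw [eventually_principal]
      exact fun d hd => C.sub_mem hd hx
    exact this.filter_mono (hF.trans inf_le_right)
  obtain ⟨v, hv, hlim⟩ := (isCompact_sphere (0 : V) 1).ultrafilter_le_nhds
    (F.map fun d => ‖d - x‖⁻¹ • (d - x)) (by
      rw [le_principal_iff]
      change ∀ᶠ d in (F : Filter V), ‖d - x‖⁻¹ • (d - x) ∈ Metric.sphere (0 : V) 1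
      filter_upwards [hFne] with d hd
      simp [norm_smul, norm_ne_zero_iff.2 hd])
  have hlim' : Tendsto (fun d => ‖d - x‖⁻¹ • (d - x)) F (𝓝 v) := hlim
  have hv0 : v = 0 := by
    refine h v fun c => ?_
    -- Rounding `c / ‖d - x‖` down to an integer moves the vector by less than `‖d - x‖`, which
    -- tends to zero.
    have h1 : Tendsto (fun d => (⌊c / ‖d - x‖⌋ : ℝ) • (d - x)) F (𝓝 (c • v)) := by
      have h2 : Tendsto (fun d => c • (‖d - x‖⁻¹ • (d - x)) -
          Int.fract (c / ‖d - x‖) • (d - x)) F (𝓝 (c • v - 0)) := by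
        refine (hlim'.const_smul c).sub ?_
        refine squeeze_zero_norm (fun d => ?_) hFx
        rw [norm_smul, Real.norm_eq_abs, abs_of_nonneg (Int.fract_nonneg _)]
        exact mul_le_of_le_one_left (norm_nonneg _) (Int.fract_lt_one _).le
      rw [sub_zero] at h2
      refine h2.congr fun d => ?_
      rw [smul_smul, ← div_eq_mul_inv, ← sub_smul, Int.self_sub_fract]
    refine hC.mem_of_tendsto h1 ?_
    filter_upwards [hFC] with d hd
    rw [Int.cast_smul_eq_zsmul]
    exact C.zsmul_mem hd _
  rw [hv0] at hv
  simp at hv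

/-- Kronecker's theorem: if a subspace `l` lies in no proper subspace that is rational with respect
to the full lattice `Γ`, then `l + Γ` is dense. -/
theorem dense_sup_lattice (Γ : Submodule ℤ V) [DiscreteTopology Γ]
    (hΓ : Submodule.span ℝ (Γ : Set V) = ⊤) (l : Submodule ℝ V)
    (hl : ∀ U : Submodule ℝ V, Submodule.span ℝ ((U : Set V) ∩ Γ) = U → l ≤ U → U = ⊤) :
    Dense {v : V | ∃ a ∈ l, ∃ g ∈ Γ, v = a + g} := by
  set C : AddSubgroup V := (l.toAddSubgroup ⊔ Γ.toAddSubgroup).topologicalClosure with hCdef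
  have hset : ((l.toAddSubgroup ⊔ Γ.toAddSubgroup : AddSubgroup V) : Set V) =
      {v : V | ∃ a ∈ l, ∃ g ∈ Γ, v = a + g} := by
    ext v
    simp only [SetLike.mem_coe, AddSubgroup.mem_sup, mem_ofPred_eq, Submodule.mem_toAddSubgroup,
      eq_comm]
  have hCc : IsClosed (C : Set V) := AddSubgroup.isClosed_topologicalClosure _
  have hle : l.toAddSubgroup ⊔ Γ.toAddSubgroup ≤ C := AddSubgroup.le_topologicalClosure _
  have hlC : ∀ a ∈ l, a ∈ C := fun a ha => hle (AddSubgroup.mem_sup_left ha)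
  have hΓC : ∀ g ∈ Γ, g ∈ C := fun g hg => hle (AddSubgroup.mem_sup_right hg)
  set V0 := maxSubspace C with hV0
  have hV0C : ∀ v ∈ V0, v ∈ C := fun v hv => by simpa using hv 1
  have hlV0 : l ≤ V0 := fun a ha c => hlC _ (l.smul_mem c ha)
  obtain ⟨V1, hV1⟩ := V0.exists_isCompl
  set π : V →ₗ[ℝ] V := V1.projection V0 hV1.symm with hπ
  have hπker : ∀ v, π v = 0 ↔ v ∈ V0 := fun v => by
    exact Submodule.projection_apply_eq_zero_iff _
  have hπ1 : ∀ v, π v ∈ V1 := fun v => Submodule.projection_apply_mem _ v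
  have hπsub : ∀ v, v - π v ∈ V0 := fun v => Submodule.sub_projection_mem _ v
  -- Any line in `C` lies in `V0`, so the slice of `C` by a complement of `V0` contains no line and
  -- is discrete. Because `V0 ⊆ C`, the projection `π` maps `Γ` into this slice.
  set D : AddSubgroup V := C ⊓ V1.toAddSubgroup with hD
  have hDd : DiscreteTopology D := by
    refine discreteTopology_of_closed_of_no_line D
      (hCc.inter V1.closed_of_finiteDimensional) fun v hv => ?_
    have h1 : v ∈ V1 := by simpa using (hv 1).2
    have h0 : v ∈ V0 := fun c => (hv c).1
    exact (Submodule.disjoint_def.1 hV1.disjoint) v h0 h1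
  set g : Γ →ₗ[ℤ] V := (π.restrictScalars ℤ) ∘ₗ Γ.subtype with hg
  have hgD : ∀ y ∈ LinearMap.range g, y ∈ D := by
    rintro _ ⟨y, rfl⟩
    refine ⟨?_, hπ1 _⟩
    have := C.sub_mem (hΓC y y.2) (hV0C _ (hπsub y))
    simpa [hg] using this
  have hrd : DiscreteTopology (LinearMap.range g) :=
    DiscreteTopology.of_subset (s := (D : Set V)) hDd hgD
  have hrspan : Submodule.span ℝ (LinearMap.range g : Set V) = V1 := by
    have : (LinearMap.range g : Set V) = π '' Γ := by
      ext y; simp [hg]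
    rw [this, ← Submodule.map_span, hΓ, Submodule.map_top]
    ext y
    constructor
    · rintro ⟨z, rfl⟩; exact hπ1 z
    · intro hy
      refine ⟨y, ?_⟩
      exact Submodule.projection_apply_of_mem_left _ hy
  set Γ0 : Submodule ℤ V := Γ ⊓ V0.restrictScalars ℤ with hΓ0
  have hΓ0d : DiscreteTopology Γ0 :=
    DiscreteTopology.of_subset (s := (Γ : Set V)) inferInstance inf_le_left
  have finrank_span : ∀ (Λ : Submodule ℤ V), DiscreteTopology Λ →
      Module.finrank ℝ (Submodule.span ℝ (Λ : Set V)) = Module.finrank ℤ Λ := fun Λ hΛ => by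
    have := Real.finrank_eq_int_finrank_of_discrete (s := (Λ : Set V))
      (by rwa [Submodule.span_eq])
    rw [Set.finrank, Set.finrank, Submodule.span_eq] at this
    exact this
  have hker : Module.finrank ℤ (LinearMap.ker g) = Module.finrank ℤ Γ0 := by
    let φ : LinearMap.ker g ≃ₗ[ℤ] Γ0 :=
      { toFun := fun y => ⟨y.1, y.1.2, (hπker _).1 y.2⟩
        invFun := fun y => ⟨⟨y.1, y.2.1⟩, (hπker _).2 y.2.2⟩
        map_add' := fun _ _ => rfl
        map_smul' := fun _ _ => rfl
        left_inv := fun _ => rfl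
        right_inv := fun _ => rfl }
    exact φ.finrank_eq
  have hrn : Module.finrank ℤ (LinearMap.range g) + Module.finrank ℤ (LinearMap.ker g) =
      Module.finrank ℤ Γ := by
    rw [← g.quotKerEquivRange.finrank_eq]
    exact Submodule.finrank_quotient_add_finrank _
  -- The rank of `Γ` is the sum of the ranks of `π(Γ)` and `Γ ∩ V0`. Each rank is the real dimension
  -- of the span, so `Γ ∩ V0` spans a space of dimension `dim V - dim V1 = dim V0`: the subspace
  -- `V0` is rational.
  rw [← finrank_span _ hrd, hrspan, hker, ← finrank_span _ hΓ0d,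
    ← finrank_span Γ inferInstance, hΓ, finrank_top,
    ← Submodule.finrank_add_eq_of_isCompl hV1, add_comm] at hrn
  have hle0 : Submodule.span ℝ (Γ0 : Set V) ≤ V0 := Submodule.span_le.2 fun y hy => hy.2
  have hspan0 : Submodule.span ℝ (Γ0 : Set V) = V0 :=
    Submodule.eq_of_le_of_finrank_eq hle0 (Nat.add_right_cancel hrn)
  have htop : V0 = ⊤ := by
    refine hl V0 ?_ hlV0
    rw [inter_comm]
    exact hspan0
  rw [← hset]
  intro v
  have : v ∈ C := hV0C v (by rw [htop]; trivial)
  exact this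

/-- A rational subspace is spanned by a finite subset of the countable set `Γ`. -/
theorem countable_rational_subspaces (Γ : Submodule ℤ V) [DiscreteTopology Γ] :
    {U : Submodule ℝ V | Submodule.span ℝ ((U : Set V) ∩ Γ) = U}.Countable := by
  have : ProperSpace V := FiniteDimensional.proper ℝ V
  have hc : (Γ : Set V).Countable := countable_coe_iff.1 (countable_of_Lindelof_of_discrete (X := Γ))
  refine ((countable_ofPred_finite_subset hc).image (Submodule.span ℝ)).mono ?_
  intro U hU
  obtain ⟨s, hs, hsU⟩ := (Submodule.fg_span_iff_fg_span_finset_subset (R := ℝ) ((U : Set V) ∩ Γ)).1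
    (IsNoetherian.noetherian _)
  exact ⟨s, ⟨s.finite_toSet, hs.trans inter_subset_right⟩, hsU.symm.trans hU⟩

end Density

/-! ### Very general points and countable families of subspaces -/

section VeryGeneral

variable {W : Type*} [AddCommGroup W] [Module ℂ W] [FiniteDimensional ℂ W]

/-- The equations are the linear forms that vanish on `K`; a vector outside `K` is detected by one
of them. -/
theorem isZariskiClosed_submodule (K : Submodule ℂ W) :
    IsZariskiClosed {q : ℙ ℂ W | q.rep ∈ K} := by
  set b := Module.finBasis ℂ W
  refine ⟨{p | ∃ g : Module.Dual ℂ W, (∀ w ∈ K, g w = 0) ∧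
    p = ∑ i, MvPolynomial.C (g (b i)) * MvPolynomial.X i}, ?_, ?_⟩
  · rintro _ ⟨g, -, rfl⟩
    refine ⟨1, MvPolynomial.IsHomogeneous.sum _ _ _ fun i _ => ?_⟩
    simpa using (MvPolynomial.isHomogeneous_C _ (g (b i))).mul (MvPolynomial.isHomogeneous_X ℂ i)
  · have heval : ∀ (g : Module.Dual ℂ W) (w : W), MvPolynomial.eval (fun i => b.repr w i)
        (∑ i, MvPolynomial.C (g (b i)) * MvPolynomial.X i) = g w := by
      intro g w
      conv_rhs => rw [← b.sum_repr w, map_sum]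
      simp [mul_comm]
    ext q
    constructor
    · rintro hq _ ⟨g, hg, rfl⟩
      rw [heval]
      exact hg _ hq
    · intro h
      by_contra hq
      obtain ⟨g, hg, hgK⟩ := Submodule.exists_le_ker_of_notMem hq
      have := h _ ⟨g, fun w hw => hgK hw, rfl⟩
      rw [heval] at this
      exact hg this

/-- Linear subspaces are the only Zariski closed sets needed in the sequel. Membership of `q.rep` in
a subspace is independent of the representative, so a vector outside `K` gives a point outside the
closed set. -/
theorem ForVeryGeneral.of_countable_submodules {𝒦 : Set (Submodule ℂ W)} (hc : 𝒦.Countable)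
    (hne : 𝒦.Nonempty) (hproper : ∀ K ∈ 𝒦, K ≠ ⊤) {Q : ℙ ℂ W → Prop}
    (hQ : ∀ q : ℙ ℂ W, (∀ K ∈ 𝒦, q.rep ∉ K) → Q q) : ForVeryGeneral Q := by
  obtain ⟨κ, hκ⟩ := hc.exists_eq_range hne
  refine ⟨fun k => {q | q.rep ∈ κ k}, fun k => ⟨isZariskiClosed_submodule _, ?_⟩, fun q hq => ?_⟩
  · intro huniv
    obtain ⟨w, hw⟩ : ∃ w, w ∉ κ k := by
      by_contra! h
      exact hproper (κ k) (hκ ▸ mem_range_self k) (eq_top_iff.2 fun w _ => h w)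
    have hw0 : w ≠ 0 := by rintro rfl; exact hw (zero_mem _)
    have hmem : Projectivization.mk ℂ w hw0 ∈ {q : ℙ ℂ W | q.rep ∈ κ k} := by
      rw [show {q : ℙ ℂ W | q.rep ∈ κ k} = univ from huniv]; trivial
    obtain ⟨a, ha⟩ := Projectivization.exists_smul_eq_mk_rep ℂ w hw0
    have hmem' : (Projectivization.mk ℂ w hw0).rep ∈ κ k := hmem
    rw [← ha] at hmem'
    exact hw (((κ k).smul_mem_iff_of_isUnit a.isUnit).1 hmem')
  · refine hQ q fun K hK => ?_
    rw [hκ] at hK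
    obtain ⟨k, rfl⟩ := hK
    exact hq k

end VeryGeneral

/-! ### The covectors to be avoided -/

section Exceptional

/-- The largest complex subspace contained in a real subspace. -/
def complexPart {W : Type*} [AddCommGroup W] [Module ℂ W] (U : Submodule ℝ W) :
    Submodule ℂ W where
  carrier := {w | ∀ c : ℂ, c • w ∈ U}
  zero_mem' := by intro c; simp
  add_mem' := by intro a b ha hb c; rw [smul_add]; exact U.add_mem (ha c) (hb c)
  smul_mem' := by intro d a ha c; rw [smul_smul]; exact ha _

variable {W : Type*} [NormedAddCommGroup W] [NormedSpace ℂ W]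

/-- The complex subspaces which a line has to avoid in order to be irrational with respect to `Γ`
and to meet it trivially. -/
def exceptionalSubspaces (Γ : Submodule ℤ W) : Set (Submodule ℂ W) :=
  complexPart '' {U : Submodule ℝ W | Submodule.span ℝ ((U : Set W) ∩ Γ) = U ∧ U ≠ ⊤} ∪
    (fun γ => Submodule.span ℂ {γ}) '' (Γ : Set W)

theorem countable_exceptionalSubspaces [FiniteDimensional ℂ W] (Γ : Submodule ℤ W) [DiscreteTopology Γ] :
    (exceptionalSubspaces Γ).Countable := by
  have : FiniteDimensional ℝ W := FiniteDimensional.complexToReal W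
  have : ProperSpace W := FiniteDimensional.proper ℝ W
  have hc : (Γ : Set W).Countable := countable_coe_iff.1 (countable_of_Lindelof_of_discrete (X := Γ))
  exact (((countable_rational_subspaces Γ).mono fun U hU => hU.1).image _).union (hc.image _)

theorem exceptionalSubspaces_nonempty (Γ : Submodule ℤ W) : (exceptionalSubspaces Γ).Nonempty :=
  ⟨_, Or.inr ⟨0, Γ.zero_mem, rfl⟩⟩

/-- This is where `n > 1` enters: in dimension one a nonzero period would span everything. -/
theorem exceptionalSubspaces_ne_top (Γ : Submodule ℤ W) (hW : 1 < Module.finrank ℂ W) :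
    ∀ K ∈ exceptionalSubspaces Γ, K ≠ ⊤ := by
  rintro _ (⟨U, ⟨-, hU⟩, rfl⟩ | ⟨γ, -, rfl⟩) h
  · refine hU (eq_top_iff.2 fun w _ => ?_)
    have hw : w ∈ complexPart U := by rw [h]; trivial
    simpa using hw 1
  · have h1 : Module.finrank ℂ (Submodule.span ℂ {γ}) ≤ 1 := by
      simpa using finrank_span_le_card (R := ℂ) ({γ} : Set W)
    rw [show Submodule.span ℂ {γ} = ⊤ from h, finrank_top] at h1
    omega

/-- A complex line contained in a real subspace `U` is contained in the largest complex subspace of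
`U`. -/
theorem isIrrational_of_forall_notMem (Γ : Submodule ℤ W) {α : W}
    (hα : ∀ K ∈ exceptionalSubspaces Γ, α ∉ K) : IsIrrational Γ (Submodule.span ℂ {α}) := by
  intro U hU hle
  by_contra hne
  refine hα _ (Or.inl ⟨U, ⟨hU, hne⟩, rfl⟩) fun c => ?_
  exact hle (Submodule.smul_mem _ c (Submodule.mem_span_singleton_self α))

/-- An irrational complex line may still contain a period, and then its orbit is not parametrised
injectively by `ℂ`. The lines `ℂγ` were put among the exceptional subspaces to exclude this. -/
theorem smul_notMem_of_forall_notMem (Γ : Submodule ℤ W) {α : W}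
    (hα : ∀ K ∈ exceptionalSubspaces Γ, α ∉ K) {c : ℂ} (hc : c • α ∈ Γ) : c = 0 := by
  by_contra h
  refine hα _ (Or.inr ⟨_, hc, rfl⟩) ?_
  rw [Submodule.mem_span_singleton]
  exact ⟨c⁻¹, by rw [smul_smul, inv_mul_cancel₀ h, one_smul]⟩

theorem ne_zero_of_forall_notMem (Γ : Submodule ℤ W) {α : W}
    (hα : ∀ K ∈ exceptionalSubspaces Γ, α ∉ K) : α ≠ 0 := by
  rintro rfl
  obtain ⟨K, hK⟩ := exceptionalSubspaces_nonempty Γ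
  exact hα K hK K.zero_mem

theorem dense_line_add_lattice [FiniteDimensional ℂ W] (Γ : Submodule ℤ W) [DiscreteTopology Γ]
    (hΓ : Submodule.span ℝ (Γ : Set W) = ⊤) {α : W}
    (hα : IsIrrational Γ (Submodule.span ℂ {α})) :
    Dense {v : W | ∃ c : ℂ, ∃ g ∈ Γ, v = c • α + g} := by
  have : FiniteDimensional ℝ W := FiniteDimensional.complexToReal W
  have := dense_sup_lattice Γ hΓ ((Submodule.span ℂ {α}).restrictScalars ℝ)
    fun U hU hle => hα U hU hle
  refine this.mono ?_
  rintro _ ⟨a, ha, g, hg, rfl⟩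
  obtain ⟨c, rfl⟩ := Submodule.mem_span_singleton.1 ha
  exact ⟨c, g, hg, rfl⟩

end Exceptional

/-! ### Analyticity of primitives -/

section Primitive

variable {E F : Type*} [NormedAddCommGroup E] [NormedSpace ℂ E]
  [NormedAddCommGroup F] [NormedSpace ℂ F] [CompleteSpace F]

/-- A primitive of an analytic 1-form is analytic. -/
theorem analyticAt_of_hasFDerivAt {u : E → F} {θ : E → E →L[ℂ] F} {z : E}
    (hθ : AnalyticAt ℂ θ z) (hu : ∀ᶠ y in 𝓝 z, HasFDerivAt u (θ y) y) : AnalyticAt ℂ u z := by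
  obtain ⟨p, r₀, hp⟩ := hθ
  obtain ⟨ε, hε, hεu⟩ := Metric.eventually_nhds_iff_ball.1 hu
  have hr₀ := hp.r_pos
  obtain ⟨r, hr0, hrr⟩ : ∃ r : NNReal, 0 < r ∧ (r : ENNReal) < min r₀ (ENNReal.ofReal ε) := by
    obtain ⟨r, hr, hr'⟩ := ENNReal.lt_iff_exists_nnreal_btwn.1
      (show (0 : ENNReal) < min r₀ (ENNReal.ofReal ε) by simp [hr₀, hε])
    exact ⟨r, by exact_mod_cast hr, hr'⟩
  have hr_rad : (r : ENNReal) < p.radius := (hrr.trans_le (min_le_left _ _)).trans_le hp.r_le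
  have hrε : (r : ℝ) < ε := by
    have := hrr.trans_le (min_le_right _ _)
    rwa [← ENNReal.ofReal_coe_nnreal, ENNReal.ofReal_lt_ofReal_iff hε] at this
  -- Integrating along rays, `u (z + y) - u z = ∫₀¹ θ (z + s y) y ds`. The degree `k` term of `θ`
  -- acquires the factor `∫₀¹ s^k ds = 1 / (k + 1)`.
  set q : FormalMultilinearSeries ℂ E (E →L[ℂ] F) := fun k => ((k : ℂ) + 1)⁻¹ • p k with hq
  have hqrad : p.radius ≤ q.radius := by
    refine FormalMultilinearSeries.radius_le_of_le fun k => ?_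
    rw [hq]
    simp only
    rw [norm_smul]
    refine mul_le_of_le_one_left (norm_nonneg _) ?_
    rw [norm_inv, show ((k : ℂ) + 1) = ((k + 1 : ℕ) : ℂ) by push_cast; rfl, Complex.norm_natCast]
    exact inv_le_one_of_one_le₀ (by push_cast; linarith [Nat.cast_nonneg (α := ℝ) k])
  have hq0 : 0 < q.radius := (by simpa using hr0 : (0 : ENNReal) < r).trans (hr_rad.trans_le hqrad)
  have hqs := q.hasFPowerSeriesOnBall hq0
  have hsum : ∀ y ∈ Metric.ball (0 : E) r, u (z + y) - u z = q.sum y y := by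
    intro y hy
    rw [mem_ball_zero_iff] at hy
    have hnorm : ∀ s ∈ Icc (0 : ℝ) 1, ‖s • y‖ < r := fun s hs => by
      rw [norm_smul, Real.norm_eq_abs, abs_of_nonneg hs.1]
      exact (mul_le_of_le_one_left (norm_nonneg _) hs.2).trans_lt hy
    have hyr : ∀ w : E, ‖w‖ < r → w ∈ Metric.eball (0 : E) r := fun w hw => by
      rw [Metric.eball_coe]; simpa using hw
    have hderiv : ∀ s ∈ uIcc (0 : ℝ) 1,
        HasDerivAt (fun s : ℝ => u (z + s • y)) (θ (z + s • y) y) s := by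
      intro s hs
      rw [uIcc_of_le zero_le_one] at hs
      have h1 : HasFDerivAt u (θ (z + s • y)) (z + s • y) := hεu _ (by
        simpa using (hnorm s hs).trans hrε)
      have h2 : HasDerivAt (fun s : ℝ => z + s • y) y s := by
        simpa using ((hasDerivAt_id s).smul_const y).const_add z
      exact (h1.restrictScalars ℝ).comp_hasDerivAt s h2
    have hcont : ContinuousOn (fun s : ℝ => θ (z + s • y) y) (uIcc 0 1) := by
      rw [uIcc_of_le zero_le_one]
      have h1 : ContinuousOn θ (Metric.eball z r₀) := hp.analyticOnNhd.continuousOn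
      have h2 : ContinuousOn (fun s : ℝ => θ (z + s • y)) (Icc 0 1) := by
        refine h1.comp (by fun_prop) fun s hs => ?_
        have := hyr _ (hnorm s hs)
        rw [Metric.mem_eball, edist_zero_right] at this
        rw [Metric.mem_eball, edist_eq_enorm_sub, add_sub_cancel_left]
        exact this.trans (hrr.trans_le (min_le_left _ _))
      exact h2.clm_apply continuousOn_const
    have hint := intervalIntegral.integral_eq_sub_of_hasDerivAt hderiv hcont.intervalIntegrable
    have hserie : HasSum (fun k : ℕ => ∫ s in (0 : ℝ)..1, ((s : ℂ) ^ k) • (p k fun _ => y) y)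
        (∫ s in (0 : ℝ)..1, θ (z + s • y) y) := by
      have hy' : ((‖y‖₊ : NNReal) : ENNReal) < p.radius :=
        lt_trans (by exact_mod_cast hy) hr_rad
      have hsm : Summable fun k => ‖p k‖ * ‖y‖ ^ k * ‖y‖ :=
        (p.summable_norm_mul_pow hy').mul_right _
      refine intervalIntegral.hasSum_integral_of_dominated_convergence
        (fun k _ => ‖p k‖ * ‖y‖ ^ k * ‖y‖) (fun k => ?_) (fun k => ?_) ?_ ?_ ?_
      · exact (by fun_prop : Continuous fun s : ℝ =>
          ((s : ℂ) ^ k) • (p k fun _ => y) y).aestronglyMeasurable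
      · refine .of_forall fun s hs => ?_
        rw [uIoc_of_le zero_le_one] at hs
        rw [norm_smul, norm_pow, Complex.norm_real, Real.norm_eq_abs, abs_of_pos hs.1]
        refine (mul_le_of_le_one_left (norm_nonneg _) (pow_le_one₀ hs.1.le hs.2)).trans ?_
        refine ((p k fun _ => y).le_opNorm y).trans ?_
        gcongr
        simpa using (p k).le_opNorm fun _ => y
      · exact .of_forall fun _ _ => hsm
      · exact intervalIntegrable_const
      · refine .of_forall fun s hs => ?_
        rw [uIoc_of_le zero_le_one] at hs
        have hmem : s • y ∈ Metric.eball (0 : E) r₀ :=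
          Metric.eball_subset_eball (hrr.le.trans (min_le_left _ _)) (hyr _ (hnorm s ⟨hs.1.le, hs.2⟩))
        have h1 := (hp.hasSum hmem).mapL (ContinuousLinearMap.apply ℂ F y)
        simp only [ContinuousLinearMap.apply_apply] at h1
        convert h1 using 2 with k
        have h2 : (fun _ : Fin k => s • y) = fun i => (fun _ : Fin k => (s : ℂ)) i • y := by
          ext; simp
        rw [h2, (p k).map_smul_univ]
        simp
    rw [hint] at hserie
    have hq_sum : HasSum (fun k : ℕ => ((k : ℂ) + 1)⁻¹ • (p k fun _ => y) y) (q.sum y y) := by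
      have h1 := (hqs.hasSum (y := y) (Metric.eball_subset_eball (hr_rad.le.trans hqrad)
        (hyr y hy))).mapL (ContinuousLinearMap.apply ℂ F y)
      rw [zero_add] at h1
      simpa [hq] using h1
    have hterm : ∀ k : ℕ, ∫ s in (0 : ℝ)..1, ((s : ℂ) ^ k) • (p k fun _ => y) y =
        ((k : ℂ) + 1)⁻¹ • (p k fun _ => y) y := by
      intro k
      rw [intervalIntegral.integral_smul_const]
      congr 1
      have := integral_pow (a := 0) (b := 1) k
      have h2 : ∫ s in (0 : ℝ)..1, ((s : ℂ) ^ k) = ((∫ s in (0 : ℝ)..1, s ^ k : ℝ) : ℂ) := by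
        rw [← intervalIntegral.integral_ofReal]
        simp
      rw [h2, this]
      simp
    simp only [hterm] at hserie
    have := hserie.unique hq_sum
    simpa using this
  have hq_an : AnalyticAt ℂ (fun y => u z + q.sum (y - z) (y - z)) z := by
    have h1 : AnalyticAt ℂ q.sum (z - z) := by rw [sub_self]; exact hqs.analyticAt
    have hid : AnalyticAt ℂ (fun y : E => y - z) z := analyticAt_id.sub analyticAt_const
    have h2 : AnalyticAt ℂ (fun y => q.sum (y - z)) z := AnalyticAt.comp (f := fun y => y - z) h1 hid
    exact analyticAt_const.add (h2.contDiffAt.clm_apply (contDiff_id.sub contDiff_const).contDiffAt).analyticAt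
  refine hq_an.congr ?_
  filter_upwards [Metric.ball_mem_nhds z (show (0 : ℝ) < r by exact_mod_cast hr0)] with y hy
  rw [← hsum (y - z) (by simpa [dist_eq_norm] using hy)]
  simp

end Primitive

/-! ### The inverse function theorem -/

section InverseFunction

variable {E F : Type*} [NormedAddCommGroup E] [NormedSpace ℂ E] [CompleteSpace E]
  [NormedAddCommGroup F] [NormedSpace ℂ F] [CompleteSpace F]

/-- The holomorphic inverse function theorem. -/
theorem exists_openPartialHomeomorph {f : E → F} {a : E} (hf : ContDiffAt ℂ ω f a)
    (hbij : Function.Bijective (fderiv ℂ f a)) {U : Set E} (hU : U ∈ 𝓝 a) :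
    ∃ Ψ : OpenPartialHomeomorph E F, a ∈ Ψ.source ∧ Ψ.source ⊆ U ∧ (Ψ : E → F) = f ∧
      (∀ x ∈ Ψ.source, ContDiffAt ℂ ω Ψ x) ∧ ∀ y ∈ Ψ.target, ContDiffAt ℂ ω Ψ.symm y := by
  set f' := ContinuousLinearEquiv.ofBijective (fderiv ℂ f a) (LinearMap.ker_eq_bot.2 hbij.1)
    (LinearMap.range_eq_top.2 hbij.2) with hf'
  have hd : HasFDerivAt f (f' : E →L[ℂ] F) a := by
    rw [hf', ContinuousLinearEquiv.coe_ofBijective]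
    exact (hf.differentiableAt (by simp)).hasFDerivAt
  set Ψ₀ := hf.toOpenPartialHomeomorph f hd (by simp) with hΨ₀
  have ha : a ∈ Ψ₀.source := hf.mem_toOpenPartialHomeomorph_source hd (by simp)
  have hsymm : ContDiffAt ℂ ω Ψ₀.symm (Ψ₀ a) := by
    refine Ψ₀.contDiffAt_symm (f₀' := f') (Ψ₀.map_source ha) ?_ ?_
    · rw [Ψ₀.left_inv ha]; exact hd
    · rw [Ψ₀.left_inv ha]; exact hf
  -- The source is shrunk so that the map and its inverse are analytic at every point, not only at
  -- the centre.
  set Ψ₁ := OpenPartialHomeomorph.restrContDiff ℂ Ψ₀ ω (by simp) with hΨ₁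
  set Ψ₂ := Ψ₁.restr (interior U) with hΨ₂
  have hsrc : Ψ₂.source = Ψ₁.source ∩ interior U := by
    rw [hΨ₂, OpenPartialHomeomorph.restr_source, interior_interior]
  have hsrc1 : Ψ₁.source = Ψ₀.source ∩
      {x | ContDiffAt ℂ ω Ψ₀ x ∧ ContDiffAt ℂ ω Ψ₀.symm (Ψ₀ x)} :=
    OpenPartialHomeomorph.restrContDiff_source ..
  have hco : (Ψ₂ : E → F) = f := rfl
  have hcos : (Ψ₂.symm : F → E) = Ψ₀.symm := rfl
  refine ⟨Ψ₂, ?_, ?_, hco, ?_, ?_⟩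
  · rw [hsrc, hsrc1]
    exact ⟨⟨ha, hf, hsymm⟩, mem_interior_iff_mem_nhds.2 hU⟩
  · rw [hsrc]; exact inter_subset_right.trans interior_subset
  · intro x hx
    rw [hsrc, hsrc1] at hx
    exact hx.1.2.1
  · intro y hy
    have hx := Ψ₂.map_target hy
    rw [hsrc, hsrc1] at hx
    have h2 : ContDiffAt ℂ ω Ψ₀.symm (Ψ₂ (Ψ₂.symm y)) := hx.1.2.2
    rwa [Ψ₂.right_inv hy] at h2

end InverseFunction

/-! ### Two-forms as bilinear maps -/

section Bilin

variable {E : Type*} [NormedAddCommGroup E] [NormedSpace ℂ E]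

variable (E) in
/-- A 2-form as a bilinear form. -/
noncomputable def toBilin : (E [⋀^Fin 2]→L[ℂ] ℂ) →L[ℂ] E →L[ℂ] E →L[ℂ] ℂ :=
  let c₁ : (E [⋀^Fin 2]→L[ℂ] ℂ) →L[ℂ] ContinuousMultilinearMap ℂ (fun _ : Fin 2 => E) ℂ :=
    ContinuousAlternatingMap.toContinuousMultilinearMapCLM ℂ
  let c₂ : ContinuousMultilinearMap ℂ (fun _ : Fin 2 => E) ℂ →L[ℂ] E →L[ℂ] (E [×1]→L[ℂ] ℂ) :=
    ((continuousMultilinearCurryLeftEquiv ℂ (fun _ : Fin 2 => E) ℂ).toContinuousLinearEquiv :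
      _ →L[ℂ] _)
  let c₃ : (E [×1]→L[ℂ] ℂ) →L[ℂ] E →L[ℂ] ℂ :=
    ((continuousMultilinearCurryFin1 ℂ E ℂ).toContinuousLinearEquiv : _ →L[ℂ] _)
  (ContinuousLinearMap.compL ℂ E (E [×1]→L[ℂ] ℂ) (E →L[ℂ] ℂ) c₃) ∘L c₂ ∘L c₁

theorem toBilin_apply (η : E [⋀^Fin 2]→L[ℂ] ℂ) (a b : E) : toBilin E η a b = η ![a, b] := by
  have : toBilin E η a b = η (Fin.cons a (Fin.snoc 0 b)) := rfl
  rw [this]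
  congr 1
  ext i
  fin_cases i <;> rfl

end Bilin

/-! ### Normal form of a Lagrangian submersion -/

section NormalForm

/-- A closed holomorphic coframe integrates to a holomorphic chart. -/
theorem exists_chart_of_closed_coframe {K W : Type*} [NormedAddCommGroup K] [NormedSpace ℂ K]
    [CompleteSpace K] [NormedAddCommGroup W] [NormedSpace ℂ W] [CompleteSpace W]
    {θ : K → K →L[ℂ] W} {k₀ : K} {U : Set K} (hU : U ∈ 𝓝 k₀)
    (hθ : ∀ k ∈ U, ContDiffAt ℂ ω θ k)
    (hsymm : ∀ k ∈ U, ∀ a b, fderiv ℂ θ k a b = fderiv ℂ θ k b a)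
    (hbij : Function.Bijective (θ k₀)) :
    ∃ Ψ : OpenPartialHomeomorph K W, k₀ ∈ Ψ.source ∧ Ψ.source ⊆ U ∧ Ψ k₀ = 0 ∧
      (∀ k ∈ Ψ.source, ContDiffAt ℂ ω Ψ k ∧ HasFDerivAt Ψ (θ k) k) ∧
      ∀ y ∈ Ψ.target, ContDiffAt ℂ ω Ψ.symm y := by
  obtain ⟨ε, hε, hεU⟩ := Metric.mem_nhds_iff.1 hU
  have hθd : DifferentiableOn ℝ θ (Metric.ball k₀ ε) := fun k hk =>
    (((hθ k (hεU hk)).differentiableAt (by simp)).restrictScalars ℝ).differentiableWithinAt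
  -- Poincaré's lemma on a ball: symmetry of the derivative says that the form `θ` is closed.
  obtain ⟨u₀, hu₀⟩ := (convex_ball k₀ ε).exists_forall_hasFDerivAt_of_fderiv_symmetric
    Metric.isOpen_ball hθd
    (fun k hk a b => by
      rw [((hθ k (hεU hk)).differentiableAt (by simp)).fderiv_restrictScalars ℝ]
      exact hsymm k (hεU hk) a b)
  set u : K → W := fun k => u₀ k - u₀ k₀ with hu_def
  have hu : ∀ k ∈ Metric.ball k₀ ε, HasFDerivAt u (θ k) k := fun k hk => (hu₀ k hk).sub_const _
  have hua : ∀ k ∈ Metric.ball k₀ ε, ContDiffAt ℂ ω u k := fun k hk =>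
    (analyticAt_of_hasFDerivAt (hθ k (hεU hk)).analyticAt (by
      filter_upwards [Metric.isOpen_ball.mem_nhds hk] with y hy using hu y hy)).contDiffAt
  have hk₀ := Metric.mem_ball_self (x := k₀) hε
  obtain ⟨Ψ, h1, h2, h3, h4, h5⟩ := exists_openPartialHomeomorph (hua k₀ hk₀)
    (by rw [(hu k₀ hk₀).fderiv]; exact hbij) (Metric.ball_mem_nhds k₀ hε)
  refine ⟨Ψ, h1, h2.trans hεU, by simp [h3, hu_def], fun k hk => ⟨h4 k hk, ?_⟩, h5⟩
  rw [h3]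
  exact hu k (h2 hk)

variable {E F : Type*} [NormedAddCommGroup E] [NormedSpace ℂ E] [FiniteDimensional ℂ E]
  [NormedAddCommGroup F] [NormedSpace ℂ F] [FiniteDimensional ℂ F]

/-- A holomorphic submersion is a projection in suitable holomorphic coordinates. -/
theorem exists_straightening {G : E → F} {z₀ : E} (hG : ContDiffAt ℂ ω G z₀)
    (hsurj : Function.Surjective (fderiv ℂ G z₀)) {U : Set E} (hU : U ∈ 𝓝 z₀) :
    ∃ Ψ : OpenPartialHomeomorph E ((fderiv ℂ G z₀).ker × F), z₀ ∈ Ψ.source ∧ Ψ.source ⊆ U ∧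
      (∀ z, (Ψ z).2 = G z) ∧ (∀ z ∈ Ψ.source, ContDiffAt ℂ ω Ψ z) ∧
      ∀ y ∈ Ψ.target, ContDiffAt ℂ ω Ψ.symm y := by
  have : CompleteSpace E := FiniteDimensional.complete ℂ E
  have : CompleteSpace F := FiniteDimensional.complete ℂ F
  set K := (fderiv ℂ G z₀).ker with hK
  obtain ⟨P₀, hP₀⟩ := LinearMap.exists_leftInverse_of_injective K.subtype (Submodule.ker_subtype K)
  set P : E →L[ℂ] K := LinearMap.toContinuousLinearMap P₀ with hP
  have hPK : ∀ k : K, P k = k := fun k => LinearMap.congr_fun hP₀ k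
  -- The chart is `G` completed by a linear projection to the kernel of its differential.
  have hg : ContDiffAt ℂ ω (fun z => (P z, G z)) z₀ := P.contDiff.contDiffAt.prodMk hG
  have hd : HasFDerivAt (fun z => (P z, G z)) (P.prod (fderiv ℂ G z₀)) z₀ :=
    P.hasFDerivAt.prodMk (hG.differentiableAt (by simp)).hasFDerivAt
  obtain ⟨Ψ, h1, h2, h3, h4, h5⟩ := exists_openPartialHomeomorph hg (by
    rw [hd.fderiv]
    constructor
    · rw [injective_iff_map_eq_zero]
      intro b hb
      obtain ⟨hb1, hb2⟩ := Prod.mk.inj hb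
      have := hPK ⟨b, hb2⟩
      rw [show P ((⟨b, hb2⟩ : K) : E) = 0 from hb1] at this
      exact congrArg Subtype.val this.symm
    · rintro ⟨k, w⟩
      obtain ⟨b, hb⟩ := hsurj w
      refine ⟨b + (k - P b : K), Prod.ext ?_ ?_⟩
      · change P (b + (k - P b : K)) = k
        rw [map_add, hPK]; abel
      · change fderiv ℂ G z₀ (b + (k - P b : K)) = w
        rw [map_add, hb, show fderiv ℂ G z₀ ((k - P b : K) : E) = 0 from (k - P b).2, add_zero]) hU
  exact ⟨Ψ, h1, h2, fun z => by rw [h3], h4, h5⟩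

omit [FiniteDimensional ℂ E] in
theorem contDiff_toBilin : ContDiff ℂ ω fun ν : E [⋀^Fin 2]→L[ℂ] ℂ => toBilin E ν := by
  fun_prop

omit [FiniteDimensional ℂ E] in
theorem contDiffAt_toBilin {D : Type*} [NormedAddCommGroup D] [NormedSpace ℂ D]
    {η : D → E [⋀^Fin 2]→L[ℂ] ℂ} {x : D} (h : ContDiffAt ℂ ω η x) :
    ContDiffAt ℂ ω (fun y => toBilin E (η y)) x :=
  ContDiffAt.comp (g := fun ν => toBilin E ν) (f := η) x contDiff_toBilin.contDiffAt h

omit [FiniteDimensional ℂ E] in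
theorem differentiableAt_form_apply {D : Type*} [NormedAddCommGroup D] [NormedSpace ℂ D]
    {η : D → E [⋀^Fin 2]→L[ℂ] ℂ} {x : D} (hη : DifferentiableAt ℂ η x) (a b : E) :
    DifferentiableAt ℂ (fun y => η y ![a, b]) x := by
  have h : DifferentiableAt ℂ (fun y => toBilin E (η y)) x :=
    DifferentiableAt.comp (g := fun ν => toBilin E ν) (f := η) x
      (contDiff_toBilin.differentiable (by simp)).differentiableAt hη
  have h2 := (h.clm_apply (differentiableAt_const a)).clm_apply (differentiableAt_const b)
  simpa only [toBilin_apply] using h2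

omit [FiniteDimensional ℂ E] in
theorem extDeriv_two_apply {η : E → E [⋀^Fin 2]→L[ℂ] ℂ} {x : E} (hη : DifferentiableAt ℂ η x)
    (a b c : E) : extDeriv η x ![a, b, c] =
      fderiv ℂ (fun y => η y ![b, c]) x a - fderiv ℂ (fun y => η y ![a, c]) x b +
        fderiv ℂ (fun y => η y ![a, b]) x c := by
  have e0 : (0 : Fin 3).removeNth ![a, b, c] = ![b, c] := by
    ext i; fin_cases i <;> rfl
  have e1 : (1 : Fin 3).removeNth ![a, b, c] = ![a, c] := by
    ext i; fin_cases i <;> rfl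
  have e2 : (2 : Fin 3).removeNth ![a, b, c] = ![a, b] := by
    ext i; fin_cases i <;> rfl
  rw [extDeriv_apply hη, Fin.sum_univ_three, e0, e1, e2]
  simp
  ring

omit [FiniteDimensional ℂ F] in
/-- Fibre coordinates of a straightened holomorphic Lagrangian submersion in which the Hamiltonian
vector fields of the functions pulled back from the base are constant along a fibre. -/
theorem exists_lagrangian_chart_of_straightening [CompleteSpace F]
    {K : Type*} [NormedAddCommGroup K] [NormedSpace ℂ K] [FiniteDimensional ℂ K]
    [FiniteDimensional ℂ F] (hdim : Module.finrank ℂ K = Module.finrank ℂ F)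
    {η : E → E [⋀^Fin 2]→L[ℂ] ℂ} {G : E → F} {z₀ : E} {Ω : Set E}
    (hη : ∀ z ∈ Ω, ContDiffAt ℂ ω η z) (hclosed : ∀ z ∈ Ω, extDeriv η z = 0)
    (hnd : ∀ a, (∀ b, η z₀ ![a, b] = 0) → a = 0) (hG : ∀ z ∈ Ω, ContDiffAt ℂ ω G z)
    (hiso : ∀ z ∈ Ω, ∀ a c, fderiv ℂ G z a = 0 → fderiv ℂ G z c = 0 → η z ![a, c] = 0)
    (Ψ₁ : OpenPartialHomeomorph E (K × F)) (hz₁ : z₀ ∈ Ψ₁.source) (hsub₁ : Ψ₁.source ⊆ Ω)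
    (hsnd₁ : ∀ z, (Ψ₁ z).2 = G z) (hsm₁ : ∀ z ∈ Ψ₁.source, ContDiffAt ℂ ω Ψ₁ z)
    (hsm₁' : ∀ y ∈ Ψ₁.target, ContDiffAt ℂ ω Ψ₁.symm y) :
    ∃ Ψ : OpenPartialHomeomorph E ((F →L[ℂ] ℂ) × F), z₀ ∈ Ψ.source ∧ Ψ.source ⊆ Ω ∧
      Ψ z₀ = (0, G z₀) ∧ (∀ z ∈ Ψ.source, (Ψ z).2 = G z) ∧
      (∀ z ∈ Ψ.source, ContDiffAt ℂ ω Ψ z) ∧ (∀ p ∈ Ψ.target, ContDiffAt ℂ ω Ψ.symm p) ∧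
      ∀ s, (s, G z₀) ∈ Ψ.target → ∀ α b, η (Ψ.symm (s, G z₀))
        ![fderiv ℂ Ψ.symm (s, G z₀) (α, 0), b] = α (fderiv ℂ G (Ψ.symm (s, G z₀)) b) := by
  have : CompleteSpace E := FiniteDimensional.complete ℂ E
  have : CompleteSpace K := FiniteDimensional.complete ℂ K
  set w₀ := G z₀ with hw₀
  set k₀ := (Ψ₁ z₀).1 with hk₀
  have hp₀ : Ψ₁ z₀ = (k₀, w₀) := Prod.ext rfl (hsnd₁ z₀)
  have hp₀t : (k₀, w₀) ∈ Ψ₁.target := hp₀ ▸ Ψ₁.map_source hz₁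
  have hsymm₀ : Ψ₁.symm (k₀, w₀) = z₀ := by rw [← hp₀, Ψ₁.left_inv hz₁]
  have hmem : ∀ p ∈ Ψ₁.target, Ψ₁.symm p ∈ Ω := fun p hp => hsub₁ (Ψ₁.map_target hp)
  set η' : K × F → (K × F) [⋀^Fin 2]→L[ℂ] ℂ :=
    fun p => (η (Ψ₁.symm p)).compContinuousLinearMap (fderiv ℂ Ψ₁.symm p) with hη'
  have hη'_apply : ∀ p a b, η' p ![a, b] =
      η (Ψ₁.symm p) ![fderiv ℂ Ψ₁.symm p a, fderiv ℂ Ψ₁.symm p b] := fun p a b => by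
    rw [hη']
    simp only [ContinuousAlternatingMap.compContinuousLinearMap_apply]
    congr 1
    ext i; fin_cases i <;> rfl
  have hη'_d : ∀ p ∈ Ψ₁.target, DifferentiableAt ℂ η' p := by
    intro p hp
    have h1 := ((hη _ (hmem p hp)).differentiableAt (by simp)).hasFDerivAt.comp p
      ((hsm₁' p hp).differentiableAt (by simp)).hasFDerivAt
    have h2 : DifferentiableAt ℂ (fderiv ℂ Ψ₁.symm) p :=
      ((hsm₁' p hp).fderiv_right (m := ω) (by simp)).differentiableAt (by simp)
    exact (h1.continuousAlternatingMapCompContinuousLinearMap h2.hasFDerivAt).differentiableAt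
  have hη'_closed : ∀ p ∈ Ψ₁.target, extDeriv η' p = 0 := by
    intro p hp
    rw [hη', extDeriv_pullback ((hη _ (hmem p hp)).differentiableAt (by simp)) (hsm₁' p hp)
      (r := ω) (by simp), hclosed _ (hmem p hp)]
    rfl
  -- the differential of the projection
  have hGd : ∀ p ∈ Ψ₁.target, ∀ v, fderiv ℂ G (Ψ₁.symm p) (fderiv ℂ Ψ₁.symm p v) = v.2 := by
    intro p hp v
    have h1 : HasFDerivAt (G ∘ Ψ₁.symm)
        ((fderiv ℂ G (Ψ₁.symm p)) ∘L (fderiv ℂ Ψ₁.symm p)) p :=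
      ((hG _ (hmem p hp)).differentiableAt (by simp)).hasFDerivAt.comp p
        ((hsm₁' p hp).differentiableAt (by simp)).hasFDerivAt
    have h2 : G ∘ Ψ₁.symm =ᶠ[𝓝 p] Prod.snd := by
      filter_upwards [Ψ₁.open_target.mem_nhds hp] with q hq
      rw [Function.comp_apply, ← hsnd₁, Ψ₁.right_inv hq]
    have h3 := h1.congr_of_eventuallyEq h2.symm
    have h4 := h3.unique (hasFDerivAt_snd (𝕜 := ℂ) (p := p))
    exact DFunLike.congr_fun h4 v
  -- Isotropy is needed on an open set and not only on the fibre over `w₀`, because this identity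
  -- will be differentiated in a base direction.
  have hvert : ∀ p ∈ Ψ₁.target, ∀ a a' : K, η' p ![(a, 0), (a', 0)] = 0 := fun p hp a a' => by
    rw [hη'_apply]
    exact hiso _ (hmem p hp) _ _ (hGd p hp _) (hGd p hp _)
  -- The candidate coframe on the fibre over `w₀`: `θ k a` is the covector on the base obtained by
  -- contracting `η'` with the vertical vector `a`.
  set θ : K → K →L[ℂ] F →L[ℂ] ℂ := fun k =>
    ((ContinuousLinearMap.compL ℂ F E ℂ).flip
      (fderiv ℂ Ψ₁.symm (k, w₀) ∘L ContinuousLinearMap.inr ℂ K F)) ∘L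
    (toBilin E (η (Ψ₁.symm (k, w₀))) ∘L
      (fderiv ℂ Ψ₁.symm (k, w₀) ∘L ContinuousLinearMap.inl ℂ K F)) with hθ
  have hθ_apply : ∀ k a b, θ k a b = η' (k, w₀) ![(a, 0), (0, b)] := fun k a b => by
    rw [hη'_apply]
    exact toBilin_apply _ _ _
  set U : Set K := {k | (k, w₀) ∈ Ψ₁.target} with hU
  have hUo : IsOpen U := Ψ₁.open_target.preimage (by fun_prop)
  have hθ_sm : ∀ k ∈ U, ContDiffAt ℂ ω θ k := by
    intro k hk
    have hι : ContDiffAt ℂ ω (fun k : K => (k, w₀)) k := contDiffAt_id.prodMk contDiffAt_const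
    have hI : ContDiffAt ℂ ω (fun k : K => Ψ₁.symm (k, w₀)) k := (hsm₁' _ hk).comp k hι
    have hD : ContDiffAt ℂ ω (fun k : K => fderiv ℂ Ψ₁.symm (k, w₀)) k :=
      ((hsm₁' _ hk).fderiv_right (m := ω) (by simp)).comp k hι
    have hηI : ContDiffAt ℂ ω (fun k : K => η (Ψ₁.symm (k, w₀))) k :=
      ContDiffAt.comp (f := fun k : K => Ψ₁.symm (k, w₀)) (g := η) k (hη _ (hmem _ hk)) hI
    have hB : ContDiffAt ℂ ω (fun k : K => toBilin E (η (Ψ₁.symm (k, w₀)))) k :=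
      contDiffAt_toBilin hηI
    have hl : ContDiffAt ℂ ω
        (fun k : K => fderiv ℂ Ψ₁.symm (k, w₀) ∘L ContinuousLinearMap.inl ℂ K F) k :=
      hD.clm_comp contDiffAt_const
    have hr : ContDiffAt ℂ ω (fun k : K => (ContinuousLinearMap.compL ℂ F E ℂ).flip
        (fderiv ℂ Ψ₁.symm (k, w₀) ∘L ContinuousLinearMap.inr ℂ K F)) k :=
      (ContinuousLinearMap.contDiff _).contDiffAt.comp k (hD.clm_comp contDiffAt_const)
    exact hr.clm_comp (hB.clm_comp hl)
  have hθ_d : ∀ k ∈ U, ∀ a a' b, fderiv ℂ θ k a a' b =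
      fderiv ℂ (fun p => η' p ![(a', 0), (0, b)]) (k, w₀) (a, 0) := by
    intro k hk a a' b
    have h1 : HasFDerivAt (fun k : K => (k, w₀)) (ContinuousLinearMap.inl ℂ K F) k :=
      hasFDerivAt_prodMk_left k w₀
    have h2 : HasFDerivAt (fun k : K => η' (k, w₀) ![(a', 0), (0, b)])
        (fderiv ℂ (fun p => η' p ![(a', 0), (0, b)]) (k, w₀) ∘L ContinuousLinearMap.inl ℂ K F) k :=
      HasFDerivAt.comp (f := fun k : K => (k, w₀)) (g := fun p => η' p ![(a', 0), (0, b)]) k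
        (differentiableAt_form_apply (hη'_d _ hk) _ _).hasFDerivAt h1
    have h3 : HasFDerivAt θ (fderiv ℂ θ k) k :=
      ((hθ_sm k hk).differentiableAt (by simp)).hasFDerivAt
    have h4 := (h3.clm_apply (hasFDerivAt_const a' k)).clm_apply (hasFDerivAt_const b k)
    simp only [hθ_apply] at h4
    have h5 := DFunLike.congr_fun (h4.unique h2) a
    simpa using h5
  have hθ_symm : ∀ k ∈ U, ∀ a a', fderiv ℂ θ k a a' = fderiv ℂ θ k a' a := by
    intro k hk a a'
    ext b
    rw [hθ_d k hk, hθ_d k hk, ← sub_eq_zero]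
    -- Closedness of `η'` is evaluated on two vertical vectors and one horizontal vector. The base
    -- derivative of `η'(a, a')` vanishes by isotropy, and what remains is the symmetry of the
    -- derivative of `θ`.
    have h1 := extDeriv_two_apply (hη'_d _ hk) (a, 0) (a', 0) (0, b)
    have h2 : (fun p => η' p ![(a, 0), (a', 0)]) =ᶠ[𝓝 (k, w₀)] fun _ => 0 := by
      filter_upwards [Ψ₁.open_target.mem_nhds hk] with p hp using hvert p hp a a'
    rw [hη'_closed _ hk, h2.fderiv_eq] at h1
    simpa using h1.symm
  have hη'_vert : ∀ p ∈ Ψ₁.target, ∀ (a : K) (v : K × F),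
      η' p ![(a, 0), v] = η' p ![(a, 0), (0, v.2)] := by
    rintro p hp a ⟨a', b⟩
    have e : ((a', b) : K × F) = (a', 0) + (0, b) := by simp
    rw [← toBilin_apply, e, map_add, toBilin_apply, toBilin_apply, hvert _ hp]
    simp
  have hId : ∀ z ∈ Ψ₁.source, ∀ b, fderiv ℂ Ψ₁.symm (Ψ₁ z) (fderiv ℂ Ψ₁ z b) = b := by
    intro z hz b
    have h1 : HasFDerivAt (Ψ₁.symm ∘ Ψ₁) ((fderiv ℂ Ψ₁.symm (Ψ₁ z)) ∘L (fderiv ℂ Ψ₁ z)) z :=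
      ((hsm₁' _ (Ψ₁.map_source hz)).differentiableAt (by simp)).hasFDerivAt.comp z
        ((hsm₁ z hz).differentiableAt (by simp)).hasFDerivAt
    have h2 : Ψ₁.symm ∘ Ψ₁ =ᶠ[𝓝 z] id := by
      filter_upwards [Ψ₁.open_source.mem_nhds hz] with q hq using Ψ₁.left_inv hq
    exact DFunLike.congr_fun ((h1.congr_of_eventuallyEq h2.symm).unique (hasFDerivAt_id z)) b
  have hηθ : ∀ k ∈ U, ∀ (a : K) (b : E), η (Ψ₁.symm (k, w₀))
      ![fderiv ℂ Ψ₁.symm (k, w₀) (a, 0), b] = θ k a (fderiv ℂ G (Ψ₁.symm (k, w₀)) b) := by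
    intro k hk a b
    have hb := hId _ (Ψ₁.map_target hk) b
    rw [Ψ₁.right_inv hk] at hb
    conv_lhs => rw [← hb]
    rw [← hη'_apply, hη'_vert _ hk, ← hθ_apply, ← hGd _ hk, hb]
  have hθ_inj : Function.Injective (θ k₀) := by
    rw [injective_iff_map_eq_zero]
    intro a ha
    have h1 : fderiv ℂ Ψ₁.symm (k₀, w₀) (a, 0) = 0 := by
      refine hnd _ fun b => ?_
      have := hηθ k₀ hp₀t a b
      rw [ha, hsymm₀] at this
      exact this
    have h2 : HasFDerivAt (Ψ₁ ∘ Ψ₁.symm)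
        ((fderiv ℂ Ψ₁ (Ψ₁.symm (k₀, w₀))) ∘L (fderiv ℂ Ψ₁.symm (k₀, w₀))) (k₀, w₀) :=
      ((hsm₁ _ (Ψ₁.map_target hp₀t)).differentiableAt (by simp)).hasFDerivAt.comp _
        ((hsm₁' _ hp₀t).differentiableAt (by simp)).hasFDerivAt
    have h3 : Ψ₁ ∘ Ψ₁.symm =ᶠ[𝓝 (k₀, w₀)] id := by
      filter_upwards [Ψ₁.open_target.mem_nhds hp₀t] with q hq using Ψ₁.right_inv hq
    have h4 := DFunLike.congr_fun ((h2.congr_of_eventuallyEq h3.symm).unique (hasFDerivAt_id _))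
      ((a, 0) : K × F)
    rw [ContinuousLinearMap.comp_apply, h1, map_zero] at h4
    exact (Prod.mk.inj h4).1.symm
  have hfin : Module.finrank ℂ K = Module.finrank ℂ (F →L[ℂ] ℂ) := by
    rw [hdim, ← Subspace.dual_finrank_eq (K := ℂ) (V := F)]
    exact (LinearMap.toContinuousLinearMap (𝕜 := ℂ) (E := F) (F' := ℂ)).finrank_eq
  have hθ_bij : Function.Bijective (θ k₀) :=
    ⟨hθ_inj, (LinearMap.injective_iff_surjective_of_finrank_eq_finrank hfin
      (f := (θ k₀ : K →ₗ[ℂ] F →L[ℂ] ℂ))).1 hθ_inj⟩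
  obtain ⟨Ψ₂, hk₂, hsub₂, h0₂, hsm₂, hsm₂'⟩ :=
    exists_chart_of_closed_coframe (hUo.mem_nhds hp₀t) hθ_sm hθ_symm hθ_bij
  -- Only the fibre coordinates are changed, by the chart `Ψ₂` with differential `θ`. The change
  -- does not depend on the base coordinate, so the normal form holds on the single fibre over `w₀`,
  -- which suffices.
  set Ψ := Ψ₁.trans (Ψ₂.prod (OpenPartialHomeomorph.refl F)) with hΨ
  have hsrc : ∀ z, z ∈ Ψ.source ↔ z ∈ Ψ₁.source ∧ (Ψ₁ z).1 ∈ Ψ₂.source := by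
    intro z; simp [hΨ]
  have htgt : ∀ p, p ∈ Ψ.target ↔ p.1 ∈ Ψ₂.target ∧ (Ψ₂.symm p.1, p.2) ∈ Ψ₁.target := by
    intro p; simp [hΨ]
  have happ : ∀ z, Ψ z = (Ψ₂ (Ψ₁ z).1, (Ψ₁ z).2) := fun z => rfl
  have hsymm : ∀ p, Ψ.symm p = Ψ₁.symm (Ψ₂.symm p.1, p.2) := fun p => rfl
  have hsmΨ' : ∀ p ∈ Ψ.target, ContDiffAt ℂ ω (fun p : (F →L[ℂ] ℂ) × F => (Ψ₂.symm p.1, p.2)) p :=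
    fun p hp => ((hsm₂' _ ((htgt p).1 hp).1).comp p contDiffAt_fst).prodMk contDiffAt_snd
  refine ⟨Ψ, (hsrc _).2 ⟨hz₁, hk₂⟩, fun z hz => hsub₁ ((hsrc z).1 hz).1, ?_, fun z _ => ?_,
    fun z hz => ?_, fun p hp => ?_, fun s hs α b => ?_⟩
  · rw [happ, hp₀, h0₂]
  · rw [happ]; exact hsnd₁ z
  · obtain ⟨h1, h2⟩ := (hsrc z).1 hz
    have h3 := hsm₁ z h1
    exact ((hsm₂ _ h2).1.comp z h3.fst).prodMk h3.snd
  · exact ContDiffAt.comp (f := fun p : (F →L[ℂ] ℂ) × F => (Ψ₂.symm p.1, p.2)) p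
      (hsm₁' _ ((htgt p).1 hp).2) (hsmΨ' p hp)
  · obtain ⟨hs1, hs2⟩ := (htgt _).1 hs
    set k := Ψ₂.symm s with hk
    have hkU : k ∈ U := hs2
    have hd2 : HasFDerivAt (Ψ₂ ∘ Ψ₂.symm) (θ k ∘L fderiv ℂ Ψ₂.symm s) s :=
      (hsm₂ _ (Ψ₂.map_target hs1)).2.comp s ((hsm₂' s hs1).differentiableAt (by simp)).hasFDerivAt
    have h3 : Ψ₂ ∘ Ψ₂.symm =ᶠ[𝓝 s] id := by
      filter_upwards [Ψ₂.open_target.mem_nhds hs1] with q hq using Ψ₂.right_inv hq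
    have h4 : θ k (fderiv ℂ Ψ₂.symm s α) = α :=
      DFunLike.congr_fun ((hd2.congr_of_eventuallyEq h3.symm).unique (hasFDerivAt_id _)) α
    have hj : HasFDerivAt (fun p : (F →L[ℂ] ℂ) × F => (Ψ₂.symm p.1, p.2))
        (((fderiv ℂ Ψ₂.symm s) ∘L (ContinuousLinearMap.fst ℂ _ F)).prod
          (ContinuousLinearMap.snd ℂ _ F)) (s, w₀) := by
      have h5 : HasFDerivAt Ψ₂.symm (fderiv ℂ Ψ₂.symm s) ((s, w₀) : (F →L[ℂ] ℂ) × F).1 :=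
        ((hsm₂' s hs1).differentiableAt (by simp)).hasFDerivAt
      exact (h5.comp _ hasFDerivAt_fst).prodMk hasFDerivAt_snd
    have h6 : HasFDerivAt Ψ.symm ((fderiv ℂ Ψ₁.symm (k, w₀)) ∘L
        (((fderiv ℂ Ψ₂.symm s) ∘L (ContinuousLinearMap.fst ℂ _ F)).prod
          (ContinuousLinearMap.snd ℂ _ F))) (s, w₀) := by
      have h7 : HasFDerivAt Ψ₁.symm (fderiv ℂ Ψ₁.symm (k, w₀)) (Ψ₂.symm s, w₀) :=
        ((hsm₁' _ hs2).differentiableAt (by simp)).hasFDerivAt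
      exact HasFDerivAt.comp (f := fun p : (F →L[ℂ] ℂ) × F => (Ψ₂.symm p.1, p.2)) (s, w₀) h7 hj
    rw [h6.fderiv, hsymm]
    change η (Ψ₁.symm (k, w₀)) ![fderiv ℂ Ψ₁.symm (k, w₀) (fderiv ℂ Ψ₂.symm s α, 0), b] = _
    rw [hηθ k hkU, h4]

/-- Fibre coordinates of a holomorphic Lagrangian submersion in which the Hamiltonian vector fields
of the functions pulled back from the base are constant along a fibre. -/
theorem exists_lagrangian_chart (hdim : Module.finrank ℂ E = 2 * Module.finrank ℂ F)
    {η : E → E [⋀^Fin 2]→L[ℂ] ℂ} {G : E → F} {z₀ : E} {Ω : Set E} (hΩ : IsOpen Ω) (hz₀ : z₀ ∈ Ω)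
    (hη : ∀ z ∈ Ω, ContDiffAt ℂ ω η z) (hclosed : ∀ z ∈ Ω, extDeriv η z = 0)
    (hnd : ∀ a, (∀ b, η z₀ ![a, b] = 0) → a = 0) (hG : ∀ z ∈ Ω, ContDiffAt ℂ ω G z)
    (hsurj : Function.Surjective (fderiv ℂ G z₀))
    (hiso : ∀ z ∈ Ω, ∀ a c, fderiv ℂ G z a = 0 → fderiv ℂ G z c = 0 → η z ![a, c] = 0) :
    ∃ Ψ : OpenPartialHomeomorph E ((F →L[ℂ] ℂ) × F), z₀ ∈ Ψ.source ∧ Ψ.source ⊆ Ω ∧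
      Ψ z₀ = (0, G z₀) ∧ (∀ z ∈ Ψ.source, (Ψ z).2 = G z) ∧
      (∀ z ∈ Ψ.source, ContDiffAt ℂ ω Ψ z) ∧ (∀ p ∈ Ψ.target, ContDiffAt ℂ ω Ψ.symm p) ∧
      ∀ s, (s, G z₀) ∈ Ψ.target → ∀ α b, η (Ψ.symm (s, G z₀))
        ![fderiv ℂ Ψ.symm (s, G z₀) (α, 0), b] = α (fderiv ℂ G (Ψ.symm (s, G z₀)) b) := by
  have : CompleteSpace F := FiniteDimensional.complete ℂ F
  obtain ⟨Ψ₁, hz₁, hsub₁, hsnd₁, hsm₁, hsm₁'⟩ :=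
    exists_straightening (hG z₀ hz₀) hsurj (hΩ.mem_nhds hz₀)
  refine exists_lagrangian_chart_of_straightening ?_ hη hclosed hnd hG hiso Ψ₁ hz₁ hsub₁ hsnd₁
    hsm₁ hsm₁'
  have h1 := LinearMap.finrank_range_add_finrank_ker (fderiv ℂ G z₀ : E →ₗ[ℂ] F)
  rw [LinearMap.range_eq_top.2 hsurj, finrank_top] at h1
  omega

end NormalForm

/-! ### The fibration in local coordinates -/

section Coordinates

variable {E : Type*} [NormedAddCommGroup E] [NormedSpace ℂ E]
  {X : Type*} [TopologicalSpace X] [ChartedSpace E X]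
  {B : Type*} [TopologicalSpace B] [ComplexSpace B] {n : ℕ} {t : B}
  {σ : X → E [⋀^Fin 2]→L[ℂ] ℂ} {f : X → B}

/-- Holomorphy on `B` is a condition on scalar functions, so the argument goes through the
coordinate functions of the chart, whose pullbacks to `X` are holomorphic. -/
theorem contMDiffAt_chart_comp (hf : IsLagrangianFibration σ f n) (e : SmoothChart B n t) {x : X}
    (hx : f x ∈ e.chart.source) :
    ContMDiffAt 𝓘(ℂ, E) 𝓘(ℂ, EuclideanSpace ℂ (Fin n)) ω (e.chart ∘ f) x := by
  have h : ContMDiffAt 𝓘(ℂ, E) 𝓘(ℂ, Fin n → ℂ) ω (fun y i => e.chart (f y) i) x := by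
    rw [contMDiffAt_pi_space]
    intro i
    refine (hf.pushforward (fun b => e.chart b i) (f x)).1 ?_ x rfl
    refine (e.holAt_iff (f x) hx _).2 ⟨fun z => z i, ?_, .rfl⟩
    exact (EuclideanSpace.proj i : EuclideanSpace ℂ (Fin n) →L[ℂ] ℂ).analyticAt _
  exact ((EuclideanSpace.equiv (Fin n) ℂ).symm.contDiff.contMDiff.contMDiffAt).comp x h

/-- The map `f` read in the chart of `X` around `x₀` and the chart `e` of `B`. -/
noncomputable def coordMap (f : X → B) (e : SmoothChart B n t) (x₀ : X) :
    E → EuclideanSpace ℂ (Fin n) :=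
  (e.chart ∘ f) ∘ (chartAt E x₀).symm

theorem contDiffAt_coordMap [IsManifold 𝓘(ℂ, E) ω X] (hf : IsLagrangianFibration σ f n)
    (e : SmoothChart B n t) (x₀ : X) {z : E} (hz : z ∈ (chartAt E x₀).target)
    (hfz : f ((chartAt E x₀).symm z) ∈ e.chart.source) : ContDiffAt ℂ ω (coordMap f e x₀) z := by
  rw [← contMDiffAt_iff_contDiffAt]
  exact (contMDiffAt_chart_comp hf e hfz).comp z
    (contMDiffOn_chart_symm.contMDiffAt ((chartAt E x₀).open_target.mem_nhds hz))

theorem mdifferentiableAt_chart_symm [IsManifold 𝓘(ℂ, E) ω X] (x₀ : X) {z : E}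
    (hz : z ∈ (chartAt E x₀).target) :
    MDifferentiableAt 𝓘(ℂ, E) 𝓘(ℂ, E) (chartAt E x₀).symm z :=
  (contMDiffOn_chart_symm (n := ω).contMDiffAt
    ((chartAt E x₀).open_target.mem_nhds hz)).mdifferentiableAt (by simp)

theorem fderiv_coordMap [IsManifold 𝓘(ℂ, E) ω X] (hf : IsLagrangianFibration σ f n)
    (e : SmoothChart B n t) (x₀ : X) {z : E} (hz : z ∈ (chartAt E x₀).target)
    (hfz : f ((chartAt E x₀).symm z) ∈ e.chart.source) (a : E) :
    fderiv ℂ (coordMap f e x₀) z a =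
      fibDeriv E f e ((chartAt E x₀).symm z) (chartInvDeriv x₀ z a) := by
  have h := mfderiv_comp (I := 𝓘(ℂ, E)) (I' := 𝓘(ℂ, E))
    (I'' := 𝓘(ℂ, EuclideanSpace ℂ (Fin n))) z
    ((contMDiffAt_chart_comp hf e hfz).mdifferentiableAt (by simp))
    (mdifferentiableAt_chart_symm x₀ hz)
  rw [← mfderiv_eq_fderiv]
  exact DFunLike.congr_fun h a

theorem chartInvDeriv_bijective [IsManifold 𝓘(ℂ, E) ω X] (x₀ : X) {z : E}
    (hz : z ∈ (chartAt E x₀).target) : Function.Bijective (chartInvDeriv x₀ z) := by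
  have : IsManifold 𝓘(ℂ, E) 1 X := IsManifold.of_le (n := ω) (by simp)
  have hm := mdifferentiable_chart (I := 𝓘(ℂ, E)) x₀
  have h1 := hm.comp_symm_deriv hz
  have h2 := hm.symm_comp_deriv ((chartAt E x₀).map_target hz)
  rw [(chartAt E x₀).right_inv hz] at h2
  exact ⟨Function.LeftInverse.injective fun a => DFunLike.congr_fun h1 a,
    Function.RightInverse.surjective fun a => DFunLike.congr_fun h2 a⟩

theorem formInChart_apply (x₀ : X) (z a b : E) : formInChart σ x₀ z ![a, b] =
    σ ((chartAt E x₀).symm z) ![chartInvDeriv x₀ z a, chartInvDeriv x₀ z b] := by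
  rw [formInChart, ContinuousAlternatingMap.compContinuousLinearMap_apply]
  congr 1
  ext i; fin_cases i <;> rfl

/-- Two charts of `B` at a point give the same fibre tangent spaces. -/
theorem fibDeriv_eq_zero_of_fibDeriv_eq_zero (hf : IsLagrangianFibration σ f n)
    (e : SmoothChart B n t) {x : X} (hx : f x ∈ e.chart.source) (e' : SmoothChart B n (f x))
    {a : E} (ha : fibDeriv E f e x a = 0) : fibDeriv E f e' x a = 0 := by
  have hx' : f x ∈ e'.chart.source := e'.mem_source
  ext i
  have hhol : ComplexSpace.HolAt (fun b => e'.chart b i) (f x) :=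
    (e'.holAt_iff (f x) hx' _).2 ⟨fun z => z i,
      (EuclideanSpace.proj i : EuclideanSpace ℂ (Fin n) →L[ℂ] ℂ).analyticAt _, .rfl⟩
  obtain ⟨G, hG, hGe⟩ := (e.holAt_iff (f x) hx _).1 hhol
  have hm := (contMDiffAt_chart_comp hf e hx).mdifferentiableAt (by simp)
  have hm' := (contMDiffAt_chart_comp hf e' hx').mdifferentiableAt (by simp)
  have h1 : mfderiv 𝓘(ℂ, E) 𝓘(ℂ, ℂ)
      ((EuclideanSpace.proj i : EuclideanSpace ℂ (Fin n) →L[ℂ] ℂ) ∘ (e'.chart ∘ f)) x a =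
      (fibDeriv E f e' x a) i := by
    rw [mfderiv_comp x (I' := 𝓘(ℂ, EuclideanSpace ℂ (Fin n)))
      ((EuclideanSpace.proj i : EuclideanSpace ℂ (Fin n) →L[ℂ] ℂ).differentiableAt.mdifferentiableAt)
      hm', mfderiv_eq_fderiv, ContinuousLinearMap.fderiv]
    rfl
  have h2 : mfderiv 𝓘(ℂ, E) 𝓘(ℂ, ℂ) (G ∘ (e.chart ∘ f)) x a =
      fderiv ℂ G (e.chart (f x)) (fibDeriv E f e x a) := by
    rw [mfderiv_comp x (I' := 𝓘(ℂ, EuclideanSpace ℂ (Fin n)))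
      hG.differentiableAt.mdifferentiableAt hm, mfderiv_eq_fderiv]
    rfl
  have h3 : ((EuclideanSpace.proj i : EuclideanSpace ℂ (Fin n) →L[ℂ] ℂ) ∘ (e'.chart ∘ f)) =ᶠ[𝓝 x]
      G ∘ (e.chart ∘ f) :=
    hf.continuous.continuousAt.eventually hGe
  have h4 := DFunLike.congr_fun (h3.mfderiv_eq (I := 𝓘(ℂ, E)) (I' := 𝓘(ℂ, ℂ))) a
  refine h1.symm.trans (h4.trans (h2.trans ?_))
  rw [ha, map_zero]
  rfl

variable [FiniteDimensional ℂ E]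

/-- The submersive locus of `f` over a chart of `B`. -/
def submersiveLocus (f : X → B) (e : SmoothChart B n t) : Set X :=
  {x | f x ∈ e.chart.source ∧ Function.Surjective (fibDeriv E f e x)}

/-- The fibres are known to be Lagrangian only over a dense open set `B₀`. In straightened
coordinates two vertical vectors extend to constant vertical fields; their pairing under `σ` is
continuous and vanishes at points over `B₀`, hence everywhere. -/
theorem isotropic_of_mem_submersiveLocus (hX : IsHyperkahler σ)
    (hf : IsLagrangianFibration σ f n) (e : SmoothChart B n t) {x : X}
    (hx : x ∈ submersiveLocus (E := E) f e) {a c : E} (ha : fibDeriv E f e x a = 0)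
    (hc : fibDeriv E f e x c = 0) : σ x ![a, c] = 0 := by
  have := hX.manifold
  have : CompleteSpace E := FiniteDimensional.complete ℂ E
  obtain ⟨B₀, hB₀o, hB₀d, hB₀⟩ := hf.lagrangian
  set ψ := chartAt E x with hψ
  set z₀ := ψ x with hz₀
  have hxs : x ∈ ψ.source := mem_chart_source E x
  have hz₀t : z₀ ∈ ψ.target := ψ.map_source hxs
  have hz₀x : ψ.symm z₀ = x := ψ.left_inv hxs
  set Ω : Set E := ψ.target ∩ ψ.symm ⁻¹' (f ⁻¹' e.chart.source) with hΩ
  have hΩo : IsOpen Ω :=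
    ψ.isOpen_inter_preimage_symm (e.chart.open_source.preimage hf.continuous)
  have hz₀Ω : z₀ ∈ Ω := ⟨hz₀t, by rw [mem_preimage, hz₀x]; exact hx.1⟩
  set G := coordMap (E := E) f e x with hG
  have hGd : ∀ z ∈ Ω, ∀ v, fderiv ℂ G z v = fibDeriv E f e (ψ.symm z) (chartInvDeriv x z v) :=
    fun z hz v => fderiv_coordMap hf e x hz.1 hz.2 v
  have hsurj : Function.Surjective (fderiv ℂ G z₀) := by
    intro w
    obtain ⟨v, hv⟩ := hx.2 w
    obtain ⟨v', hv'⟩ := (chartInvDeriv_bijective x hz₀t).2 v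
    refine ⟨v', ?_⟩
    rw [hGd z₀ hz₀Ω, hv', hz₀x, hv]
  have hGc : ContDiffAt ℂ ω G z₀ := contDiffAt_coordMap hf e x hz₀t hz₀Ω.2
  obtain ⟨Ψ, h1, h2, h3, h4, h5⟩ := exists_straightening hGc hsurj (hΩo.mem_nhds hz₀Ω)
  have hΨd : ∀ p ∈ Ψ.target, ∀ v, fderiv ℂ G (Ψ.symm p) (fderiv ℂ Ψ.symm p v) = v.2 := by
    intro p hp v
    have hd1 : HasFDerivAt (G ∘ Ψ.symm)
        ((fderiv ℂ G (Ψ.symm p)) ∘L (fderiv ℂ Ψ.symm p)) p :=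
      ((contDiffAt_coordMap hf e x (h2 (Ψ.map_target hp)).1
        (h2 (Ψ.map_target hp)).2).differentiableAt (by simp)).hasFDerivAt.comp p
        ((h5 p hp).differentiableAt (by simp)).hasFDerivAt
    have hd2 : G ∘ Ψ.symm =ᶠ[𝓝 p] Prod.snd := by
      filter_upwards [Ψ.open_target.mem_nhds hp] with q hq
      rw [Function.comp_apply, ← h3, Ψ.right_inv hq]
    exact DFunLike.congr_fun ((hd1.congr_of_eventuallyEq hd2.symm).unique
      (hasFDerivAt_snd (𝕜 := ℂ) (p := p))) v
  set p₀ := Ψ z₀ with hp₀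
  have hp₀t : p₀ ∈ Ψ.target := Ψ.map_source h1
  have hsymm₀ : Ψ.symm p₀ = z₀ := Ψ.left_inv h1
  -- vertical vectors
  have hvert : ∀ a : E, fibDeriv E f e x a = 0 →
      ∃ k, chartInvDeriv x z₀ (fderiv ℂ Ψ.symm p₀ (k, 0)) = a := by
    intro a ha
    obtain ⟨a', ha'⟩ := (chartInvDeriv_bijective x hz₀t).2 a
    have hd : HasFDerivAt (Ψ.symm ∘ Ψ) ((fderiv ℂ Ψ.symm p₀) ∘L (fderiv ℂ Ψ z₀)) z₀ :=
      ((h5 p₀ hp₀t).differentiableAt (by simp)).hasFDerivAt.comp z₀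
        ((h4 z₀ h1).differentiableAt (by simp)).hasFDerivAt
    have hd2 : Ψ.symm ∘ Ψ =ᶠ[𝓝 z₀] id := by
      filter_upwards [Ψ.open_source.mem_nhds h1] with q hq using Ψ.left_inv hq
    have hd3 : fderiv ℂ Ψ.symm p₀ (fderiv ℂ Ψ z₀ a') = a' :=
      DFunLike.congr_fun ((hd.congr_of_eventuallyEq hd2.symm).unique (hasFDerivAt_id z₀)) a'
    have hsnd : (fderiv ℂ Ψ z₀ a').2 = 0 := by
      rw [← hΨd p₀ hp₀t, hd3, hsymm₀, hGd z₀ hz₀Ω, ha', hz₀x, ha]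
    refine ⟨(fderiv ℂ Ψ z₀ a').1, ?_⟩
    rw [show ((fderiv ℂ Ψ z₀ a').1, (0 : EuclideanSpace ℂ (Fin n))) = fderiv ℂ Ψ z₀ a' from
      Prod.ext rfl hsnd.symm, hd3, ha']
  obtain ⟨k, hk⟩ := hvert a ha
  obtain ⟨l, hl⟩ := hvert c hc
  set φ : _ → ℂ := fun p => toBilin E (formInChart σ x (Ψ.symm p)) (fderiv ℂ Ψ.symm p (k, 0))
    (fderiv ℂ Ψ.symm p (l, 0)) with hφ
  have hφ0 : φ p₀ = σ x ![a, c] := by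
    simp only [hφ, toBilin_apply, formInChart_apply, hsymm₀, hk, hl]
    rw [hz₀x]
  have hφc : ContinuousAt φ p₀ := by
    have hD : ContinuousAt (fderiv ℂ Ψ.symm) p₀ :=
      ((h5 p₀ hp₀t).fderiv_right (m := ω) (by simp)).continuousAt
    have hη : ContinuousAt (fun p => toBilin E (formInChart σ x (Ψ.symm p))) p₀ := by
      have hI : ContDiffAt ℂ ω (fun p => formInChart σ x (Ψ.symm p)) p₀ :=
        ContDiffAt.comp (g := formInChart σ x) (f := Ψ.symm) p₀
          (by rw [hsymm₀]; exact (hX.symplectic.holomorphic x z₀ hz₀t).contDiffAt) (h5 p₀ hp₀t)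
      exact (contDiffAt_toBilin hI).continuousAt
    exact (hη.clm_apply (hD.clm_apply continuousAt_const)).clm_apply
      (hD.clm_apply continuousAt_const)
  rw [← hφ0]
  by_contra hne
  -- a nearby point over the dense open set where the fibres are Lagrangian
  obtain ⟨p, hpφ, hpt, hpB⟩ : ∃ p, φ p ≠ 0 ∧ p ∈ Ψ.target ∧ e.chart.symm p.2 ∈ B₀ := by
    have hev : ∀ᶠ p in 𝓝 p₀, φ p ≠ 0 ∧ p ∈ Ψ.target :=
      (hφc.eventually_ne hne).and (Ψ.open_target.mem_nhds hp₀t)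
    have hι : ContinuousAt (fun w => (p₀.1, w)) p₀.2 := by fun_prop
    have hev2 : ∀ᶠ w in 𝓝 p₀.2, φ (p₀.1, w) ≠ 0 ∧ (p₀.1, w) ∈ Ψ.target := hι.eventually hev
    have hp2 : p₀.2 = e.chart (f x) := by
      rw [hp₀, h3]; exact congrArg (fun y => e.chart (f y)) hz₀x
    rw [hp2] at hev2
    have hev3 := (e.chart.continuousAt hx.1).eventually hev2
    obtain ⟨V, hV, hVo, hxV⟩ := eventually_nhds_iff.1
      (hev3.and (e.chart.open_source.mem_nhds hx.1))
    obtain ⟨b, hbV, hbB⟩ := hB₀d.inter_open_nonempty V hVo ⟨_, hxV⟩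
    obtain ⟨⟨hb1, hb2⟩, hb3⟩ := hV b hbV
    exact ⟨_, hb1, hb2, by rw [e.chart.left_inv hb3]; exact hbB⟩
  apply hpφ
  set z := Ψ.symm p with hz
  have hzΩ : z ∈ Ω := h2 (Ψ.map_target hpt)
  set y := ψ.symm z with hy
  have hfy : f y = e.chart.symm p.2 := by
    have : G z = p.2 := by rw [← h3, Ψ.right_inv hpt]
    rw [← this, hG, coordMap]
    exact (e.chart.left_inv hzΩ.2).symm
  have hyB : f y ∈ B₀ := hfy ▸ hpB
  obtain ⟨e', -, hiso⟩ := hB₀ (f y) hyB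
  have hker : ∀ m, fibDeriv E f e' y (chartInvDeriv x z (fderiv ℂ Ψ.symm p (m, 0))) = 0 := by
    intro m
    refine fibDeriv_eq_zero_of_fibDeriv_eq_zero hf e hzΩ.2 e' ?_
    rw [← hGd z hzΩ, hΨd p hpt]
  simp only [hφ, toBilin_apply, formInChart_apply]
  exact hiso y rfl _ (hker k) _ (hker l)

end Coordinates

theorem finrank_cotangent (n : ℕ) : Module.finrank ℂ (Cotangent n) = n := by
  rw [← (LinearMap.toContinuousLinearMap (𝕜 := ℂ) (E := EuclideanSpace ℂ (Fin n))
    (F' := ℂ)).finrank_eq]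
  exact Subspace.dual_finrank_eq.trans finrank_euclideanSpace_fin

/-! ### Hamiltonian vectors and the isomorphism with fibre tangents -/

section Hamiltonian

variable {E : Type*} [NormedAddCommGroup E] [NormedSpace ℂ E] [FiniteDimensional ℂ E]
  {X : Type*} [TopologicalSpace X] [ChartedSpace E X]
  {B : Type*} [TopologicalSpace B] [ComplexSpace B] {n : ℕ} {t : B}
  {σ : X → E [⋀^Fin 2]→L[ℂ] ℂ} {f : X → B}

/-- The isomorphism `T_y X ≅ T_y^* X` given by a symplectic form. -/
noncomputable def flat (hσ : IsHolomorphicSymplectic σ) (y : X) : E ≃ₗ[ℂ] (E →L[ℂ] ℂ) :=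
  LinearEquiv.ofBijective (toBilin E (σ y) : E →ₗ[ℂ] E →L[ℂ] ℂ) <| by
    have hinj : Function.Injective (toBilin E (σ y) : E →ₗ[ℂ] E →L[ℂ] ℂ) := by
      rw [injective_iff_map_eq_zero]
      intro a ha
      refine hσ.nondegenerate y a fun b => ?_
      rw [← toBilin_apply]
      exact DFunLike.congr_fun ha b
    refine ⟨hinj, (LinearMap.injective_iff_surjective_of_finrank_eq_finrank ?_).1 hinj⟩
    rw [← Subspace.dual_finrank_eq (K := ℂ) (V := E)]
    exact (LinearMap.toContinuousLinearMap (𝕜 := ℂ) (E := E) (F' := ℂ)).finrank_eq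

theorem flat_apply (hσ : IsHolomorphicSymplectic σ) (y : X) (a b : E) :
    flat hσ y a b = σ y ![a, b] := toBilin_apply _ _ _

/-- The value at `y` of the Hamiltonian vector fields of functions pulled back along `f`, as a
function of the differential downstairs. -/
noncomputable def ham (hσ : IsHolomorphicSymplectic σ) (f : X → B) (e : SmoothChart B n t)
    (y : X) : Cotangent n →L[ℂ] E :=
  LinearMap.toContinuousLinearMap ((flat hσ y).symm.toLinearMap ∘ₗ
    ((ContinuousLinearMap.compL ℂ E (EuclideanSpace ℂ (Fin n)) ℂ).flip (fibDeriv E f e y) :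
      Cotangent n →ₗ[ℂ] E →L[ℂ] ℂ))

variable (hσ : IsHolomorphicSymplectic σ) (e : SmoothChart B n t)

theorem form_ham (y : X) (α : Cotangent n) (b : E) :
    σ y ![ham hσ f e y α, b] = α (fibDeriv E f e y b) := by
  rw [← flat_apply hσ]
  have : flat hσ y (ham hσ f e y α) = α ∘L fibDeriv E f e y :=
    (flat hσ y).apply_symm_apply _
  rw [this]
  rfl

theorem eq_ham {y : X} {α : Cotangent n} {a : E}
    (h : ∀ b, σ y ![a, b] = α (fibDeriv E f e y b)) : a = ham hσ f e y α := by
  apply (flat hσ y).injective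
  ext b
  rw [flat_apply, flat_apply, h, form_ham]

theorem ham_injective {y : X} (hy : Function.Surjective (fibDeriv E f e y)) :
    Function.Injective (ham hσ f e y) := by
  rw [injective_iff_map_eq_zero]
  intro α hα
  ext w
  obtain ⟨b, rfl⟩ := hy w
  rw [← form_ham hσ, hα, ← toBilin_apply]
  simp

/-- The Hamiltonian vector fields span the tangent spaces of the Lagrangian fibres. -/
theorem range_ham (hX : IsHyperkahler σ) (hf : IsLagrangianFibration σ f n)
    (hdim : Module.finrank ℂ E = 2 * n) {y : X} (hy : y ∈ submersiveLocus (E := E) f e) :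
    LinearMap.range (ham hσ f e y : Cotangent n →ₗ[ℂ] E) = fibreTangent E f e y := by
  have hle : fibreTangent E f e y ≤ LinearMap.range (ham hσ f e y : Cotangent n →ₗ[ℂ] E) := by
    intro a ha
    obtain ⟨s, hs⟩ := LinearMap.exists_rightInverse_of_surjective
      (fibDeriv E f e y : E →ₗ[ℂ] EuclideanSpace ℂ (Fin n)) (LinearMap.range_eq_top.2 hy.2)
    -- For vertical `a` the covector `σ(a, ·)` kills vertical vectors, so it factors through `df`;
    -- composing with a linear section `s` of `df` gives the covector downstairs.
    refine ⟨toBilin E (σ y) a ∘L LinearMap.toContinuousLinearMap s, (eq_ham hσ e fun b => ?_).symm⟩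
    set b' := s (fibDeriv E f e y b) with hb'
    have h1 : fibDeriv E f e y (b - b') = 0 := by
      rw [map_sub, sub_eq_zero]
      exact (LinearMap.congr_fun hs (fibDeriv E f e y b)).symm
    have h2 := isotropic_of_mem_submersiveLocus hX hf e hy ha h1
    rw [← toBilin_apply, map_sub, sub_eq_zero] at h2
    rw [← toBilin_apply, h2]
    rfl
  refine (Submodule.eq_of_le_of_finrank_eq hle ?_).symm
  have h1 := LinearMap.finrank_range_add_finrank_ker
    (fibDeriv E f e y : E →ₗ[ℂ] EuclideanSpace ℂ (Fin n))
  rw [LinearMap.range_eq_top.2 hy.2, finrank_top, finrank_euclideanSpace_fin, hdim] at h1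
  rw [LinearMap.finrank_range_of_inj (f := (ham hσ f e y : Cotangent n →ₗ[ℂ] E))
    (ham_injective hσ e hy.2)]
  rw [finrank_cotangent]
  have h3 : Module.finrank ℂ (fibreTangent E f e y) = n := by
    change Module.finrank ℂ (LinearMap.ker (fibDeriv E f e y : E →ₗ[ℂ] EuclideanSpace ℂ (Fin n))) = n
    omega
  exact h3

theorem fibDeriv_ham (hX : IsHyperkahler σ) (hf : IsLagrangianFibration σ f n)
    (hdim : Module.finrank ℂ E = 2 * n) {y : X} (hy : y ∈ submersiveLocus (E := E) f e)
    (α : Cotangent n) : fibDeriv E f e y (ham hσ f e y α) = 0 := by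
  have : ham hσ f e y α ∈ fibreTangent E f e y := by
    rw [← range_ham hσ e hX hf hdim hy]
    exact ⟨α, rfl⟩
  exact this

end Hamiltonian

/-! ### Flow boxes along the fibre -/

section FlowBox

variable {E : Type*} [NormedAddCommGroup E] [NormedSpace ℂ E] [FiniteDimensional ℂ E]
  {X : Type*} [TopologicalSpace X] [ChartedSpace E X]
  {B : Type*} [TopologicalSpace B] [ComplexSpace B] {n : ℕ} {t : B}
  {σ : X → E [⋀^Fin 2]→L[ℂ] ℂ} {f : X → B}

omit [FiniteDimensional ℂ E] in
-- If `S` is a right inverse of the differential at `x`, the composite of nearby differentials with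
-- `S` stays invertible, because units are open.
theorem submersiveLocus_mem_nhds [IsManifold 𝓘(ℂ, E) ω X] (hf : IsLagrangianFibration σ f n)
    (e : SmoothChart B n t) {x : X} (hx : x ∈ submersiveLocus (E := E) f e) :
    submersiveLocus (E := E) f e ∈ 𝓝 x := by
  set ψ := chartAt E x with hψ
  have hxs : x ∈ ψ.source := mem_chart_source E x
  have hxt : ψ x ∈ ψ.target := ψ.map_source hxs
  have hxx : ψ.symm (ψ x) = x := ψ.left_inv hxs
  have hGc : ContDiffAt ℂ ω (coordMap (E := E) f e x) (ψ x) :=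
    contDiffAt_coordMap hf e x hxt (by rw [← hψ, hxx]; exact hx.1)
  have hGd : ∀ y ∈ ψ.source, f y ∈ e.chart.source → ∀ v, fderiv ℂ (coordMap (E := E) f e x) (ψ y) v =
      fibDeriv E f e y (chartInvDeriv x (ψ y) v) := by
    intro y hy hfy v
    have := fderiv_coordMap hf e x (ψ.map_source hy) (by rwa [← hψ, ψ.left_inv hy]) v
    rwa [← hψ, ψ.left_inv hy] at this
  have hsurj : Function.Surjective (fderiv ℂ (coordMap (E := E) f e x) (ψ x)) := by
    intro w
    obtain ⟨v, hv⟩ := hx.2 w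
    obtain ⟨v', hv'⟩ := (chartInvDeriv_bijective x hxt).2 v
    exact ⟨v', by rw [hGd x hxs hx.1, hv', hv]⟩
  obtain ⟨s, hs⟩ := LinearMap.exists_rightInverse_of_surjective
      (fderiv ℂ (coordMap (E := E) f e x) (ψ x) : E →ₗ[ℂ] EuclideanSpace ℂ (Fin n))
      (LinearMap.range_eq_top.2 hsurj)
  set S : EuclideanSpace ℂ (Fin n) →L[ℂ] E := LinearMap.toContinuousLinearMap s
  have hS : fderiv ℂ (coordMap (E := E) f e x) (ψ x) ∘L S = ContinuousLinearMap.id ℂ _ := by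
    ext1 w; exact LinearMap.congr_fun hs w
  have hcont : ContinuousAt (fun y => fderiv ℂ (coordMap (E := E) f e x) (ψ y) ∘L S) x := by
    have h1 : ContinuousAt (fderiv ℂ (coordMap (E := E) f e x)) (ψ x) :=
      (hGc.fderiv_right (m := ω) (by simp)).continuousAt
    exact (h1.comp (ψ.continuousAt hxs)).clm_comp continuousAt_const
  have hunit : ∀ᶠ y in 𝓝 x, IsUnit (fderiv ℂ (coordMap (E := E) f e x) (ψ y) ∘L S) := by
    have h1 : IsUnit (fderiv ℂ (coordMap (E := E) f e x) (ψ x) ∘L S) := by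
      rw [hS]; exact isUnit_one
    exact hcont.eventually (Units.isOpen.mem_nhds h1)
  filter_upwards [hunit, ψ.open_source.mem_nhds hxs,
    (e.chart.open_source.preimage hf.continuous).mem_nhds hx.1] with y hy hys hfy
  refine ⟨hfy, fun w => ?_⟩
  obtain ⟨u, hu⟩ := hy
  refine ⟨chartInvDeriv x (ψ y) (S ((↑u⁻¹ : EuclideanSpace ℂ (Fin n) →L[ℂ] _) w)), ?_⟩
  rw [← hGd y hys hfy]
  change (fderiv ℂ (coordMap (E := E) f e x) (ψ y) ∘L S) _ = w
  rw [← hu]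
  exact DFunLike.congr_fun u.mul_inv w

/-- Flow boxes of the Hamiltonian action along the fibre over `t`: a neighbourhood `U` of `y₀`, the
time function `u` and its inverse `φ` on the fibre. -/
structure FlowBox (hσ : IsHolomorphicSymplectic σ) (f : X → B) (e : SmoothChart B n t)
    (y₀ : X) where
  U : Set X
  r : ℝ
  u : X → Cotangent n
  φ : Cotangent n → X
  isOpen_U : IsOpen U
  mem_U : y₀ ∈ U
  r_pos : 0 < r
  u_zero : u y₀ = 0
  u_smooth : ∀ y ∈ U, ContMDiffAt 𝓘(ℂ, E) 𝓘(ℂ, Cotangent n) ω u y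
  u_mem : ∀ y ∈ U, u y ∈ Metric.ball 0 r
  φ_u : ∀ y ∈ U, f y = t → φ (u y) = y
  φ_mem : ∀ s ∈ Metric.ball 0 r, φ s ∈ U
  φ_fibre : ∀ s ∈ Metric.ball 0 r, f (φ s) = t
  u_φ : ∀ s ∈ Metric.ball 0 r, u (φ s) = s
  φ_smooth : ∀ s ∈ Metric.ball 0 r, ContMDiffAt 𝓘(ℂ, Cotangent n) 𝓘(ℂ, E) ω φ s
  φ_deriv : ∀ s ∈ Metric.ball 0 r,
    HasMFDerivAt 𝓘(ℂ, Cotangent n) 𝓘(ℂ, E) φ s (ham (E := E) hσ f e (φ s))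

/-- The Lagrangian normal form provides the box: its first coordinate is the time `u`, and freezing
the second at `e.chart t` in the inverse chart gives `φ`. -/
theorem nonempty_flowBox (hX : IsHyperkahler σ) (hf : IsLagrangianFibration σ f n)
    (hdim : Module.finrank ℂ E = 2 * n) (e : SmoothChart B n t) {y₀ : X} (hy₀ : f y₀ = t)
    (hsub : y₀ ∈ submersiveLocus (E := E) f e) :
    Nonempty (FlowBox (E := E) hX.symplectic f e y₀) := by
  have := hX.manifold
  have : CompleteSpace E := FiniteDimensional.complete ℂ E
  set ψ := chartAt E y₀ with hψ
  set z₀ := ψ y₀ with hz₀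
  have hys : y₀ ∈ ψ.source := mem_chart_source E y₀
  have hz₀t : z₀ ∈ ψ.target := ψ.map_source hys
  have hz₀y : ψ.symm z₀ = y₀ := ψ.left_inv hys
  obtain ⟨V, hVsub, hVo, hyV⟩ := mem_nhds_iff.1 (submersiveLocus_mem_nhds hf e hsub)
  set Ω : Set E := ψ.target ∩ ψ.symm ⁻¹' V with hΩ
  have hΩo : IsOpen Ω := ψ.isOpen_inter_preimage_symm hVo
  have hz₀Ω : z₀ ∈ Ω := ⟨hz₀t, by rw [mem_preimage, hz₀y]; exact hyV⟩
  set G := coordMap (E := E) f e y₀ with hG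
  have hG_apply : ∀ z, G z = e.chart (f (ψ.symm z)) := fun z => rfl
  have hGd : ∀ z ∈ Ω, ∀ v, fderiv ℂ G z v = fibDeriv E f e (ψ.symm z) (chartInvDeriv y₀ z v) :=
    fun z hz v => fderiv_coordMap hf e y₀ hz.1 (hVsub hz.2).1 v
  have hGz₀ : G z₀ = e.chart t := by rw [hG_apply, hz₀y, hy₀]
  have hdim' : Module.finrank ℂ E = 2 * Module.finrank ℂ (EuclideanSpace ℂ (Fin n)) := by
    rw [finrank_euclideanSpace_fin, hdim]
  obtain ⟨Ψ, h1, h2, h3, h4, h5, h6, h7⟩ := exists_lagrangian_chart hdim' hΩo hz₀Ω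
    (η := formInChart σ y₀) (G := G)
    (fun z hz => (hX.symplectic.holomorphic y₀ z hz.1).contDiffAt)
    (fun z hz => hX.symplectic.closed y₀ z hz.1)
    (fun a ha => by
      have h := hX.symplectic.nondegenerate y₀ (chartInvDeriv y₀ z₀ a) fun b => by
        obtain ⟨b', rfl⟩ := (chartInvDeriv_bijective y₀ hz₀t).2 b
        have := ha b'
        rwa [formInChart_apply, ← hψ, hz₀y] at this
      exact (chartInvDeriv_bijective y₀ hz₀t).1 (h.trans (map_zero _).symm))
    (fun z hz => contDiffAt_coordMap hf e y₀ hz.1 (hVsub hz.2).1)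
    (fun w => by
      obtain ⟨v, hv⟩ := hsub.2 w
      obtain ⟨v', hv'⟩ := (chartInvDeriv_bijective y₀ hz₀t).2 v
      exact ⟨v', by rw [hGd z₀ hz₀Ω, hv', hz₀y, hv]⟩)
    (fun z hz a c ha hc => by
      rw [formInChart_apply]
      refine isotropic_of_mem_submersiveLocus hX hf e (hVsub hz.2) ?_ ?_
      · rw [← hGd z hz, ha]
      · rw [← hGd z hz, hc])
  rw [hGz₀] at h3 h7
  set S : Set (Cotangent n) := {s | (s, e.chart t) ∈ Ψ.target} with hS
  have hSo : IsOpen S := Ψ.open_target.preimage (by fun_prop)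
  have h0S : (0 : Cotangent n) ∈ S := by
    change (0, e.chart t) ∈ Ψ.target
    rw [← h3]; exact Ψ.map_source h1
  obtain ⟨r, hr, hrS⟩ := Metric.isOpen_iff.1 hSo 0 h0S
  set Θ := ψ.trans Ψ with hΘ
  have hΘs : ∀ y, y ∈ Θ.source ↔ y ∈ ψ.source ∧ ψ y ∈ Ψ.source := fun y => by simp [hΘ]
  set u : X → Cotangent n := fun y => (Ψ (ψ y)).1 with hu
  set φ : Cotangent n → X := fun s => ψ.symm (Ψ.symm (s, e.chart t)) with hφ
  have hu_smooth : ∀ y ∈ Θ.source, ContMDiffAt 𝓘(ℂ, E) 𝓘(ℂ, Cotangent n) ω u y := by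
    intro y hy
    obtain ⟨hy1, hy2⟩ := (hΘs y).1 hy
    have k1 : ContMDiffAt 𝓘(ℂ, E) 𝓘(ℂ, E) ω ψ y :=
      contMDiffOn_chart.contMDiffAt (ψ.open_source.mem_nhds hy1)
    have k2 : ContDiffAt ℂ ω (fun z => (Ψ z).1) (ψ y) := (h5 _ hy2).fst
    exact ContMDiffAt.comp (g := fun z => (Ψ z).1) y k2.contMDiffAt k1
  have hφΩ : ∀ s ∈ Metric.ball 0 r, Ψ.symm (s, e.chart t) ∈ Ω := fun s hs =>
    h2 (Ψ.map_target (hrS hs))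
  have hφs : ∀ s ∈ Metric.ball 0 r, φ s ∈ ψ.source := fun s hs => ψ.map_target (hφΩ s hs).1
  have hψφ : ∀ s ∈ Metric.ball 0 r, ψ (φ s) = Ψ.symm (s, e.chart t) := fun s hs =>
    ψ.right_inv (hφΩ s hs).1
  have hφΘ : ∀ s ∈ Metric.ball 0 r, φ s ∈ Θ.source := fun s hs =>
    (hΘs _).2 ⟨hφs s hs, by rw [hψφ s hs]; exact Ψ.map_target (hrS hs)⟩
  have huφ : ∀ s ∈ Metric.ball 0 r, u (φ s) = s := fun s hs => by
    simp only [hu]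
    rw [hψφ s hs, Ψ.right_inv (hrS hs)]
  have hι : ∀ s : Cotangent n, ContDiffAt ℂ ω (fun s : Cotangent n => (s, e.chart t)) s :=
    fun s => contDiffAt_id.prodMk contDiffAt_const
  refine ⟨{
    U := Θ.source ∩ u ⁻¹' Metric.ball 0 r
    r := r, u := u, φ := φ
    isOpen_U := ?_
    mem_U := ⟨(hΘs y₀).2 ⟨hys, h1⟩, ?_⟩
    r_pos := hr
    u_zero := congrArg Prod.fst h3
    u_smooth := fun y hy => hu_smooth y hy.1
    u_mem := fun y hy => hy.2
    φ_u := fun y hy hyt => ?_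
    φ_mem := fun s hs => ⟨hφΘ s hs, by rw [mem_preimage, huφ s hs]; exact hs⟩
    φ_fibre := fun s hs => ?_
    u_φ := huφ
    φ_smooth := fun s hs => ?_
    φ_deriv := fun s hs => ?_ }⟩
  · have : ContinuousOn u Θ.source := fun y hy => (hu_smooth y hy).continuousAt.continuousWithinAt
    exact this.isOpen_inter_preimage Θ.open_source Metric.isOpen_ball
  · rw [mem_preimage, show u y₀ = 0 from congrArg Prod.fst h3]
    exact Metric.mem_ball_self hr
  · obtain ⟨hy1, hy2⟩ := (hΘs y).1 hy.1
    have k1 : (u y, e.chart t) = Ψ (ψ y) :=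
      Prod.ext rfl (by rw [h4 _ hy2, hG_apply, ψ.left_inv hy1, hyt])
    simp only [hφ]
    rw [k1, Ψ.left_inv hy2, ψ.left_inv hy1]
  · have k1 : e.chart (f (φ s)) = e.chart t := by
      have := h4 _ (Ψ.map_target (hrS hs))
      rw [Ψ.right_inv (hrS hs)] at this
      exact this.symm
    exact e.chart.injOn (hVsub (hφΩ s hs).2).1 e.mem_source k1
  · have k1 : ContDiffAt ℂ ω (fun s : Cotangent n => Ψ.symm (s, e.chart t)) s :=
      ContDiffAt.comp (g := Ψ.symm) s (h6 _ (hrS hs)) (hι s)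
    exact (contMDiffOn_chart_symm.contMDiffAt (ψ.open_target.mem_nhds (hφΩ s hs).1)).comp s
      k1.contMDiffAt
  · set z := Ψ.symm (s, e.chart t) with hz
    have hzΩ : z ∈ Ω := hφΩ s hs
    have k1 : HasFDerivAt (fun s : Cotangent n => Ψ.symm (s, e.chart t))
        (fderiv ℂ Ψ.symm (s, e.chart t) ∘L ContinuousLinearMap.inl ℂ _ _) s :=
      HasFDerivAt.comp (g := Ψ.symm) s ((h6 _ (hrS hs)).differentiableAt (by simp)).hasFDerivAt
        (hasFDerivAt_prodMk_left s (e.chart t))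
    have k2 : HasMFDerivAt 𝓘(ℂ, E) 𝓘(ℂ, E) ψ.symm z (chartInvDeriv (E := E) y₀ z) :=
      (mdifferentiableAt_chart_symm y₀ hzΩ.1).hasMFDerivAt
    have k3 := k2.comp s k1.hasMFDerivAt
    have k5 : ham (E := E) hX.symplectic f e (φ s) = chartInvDeriv (E := E) y₀ z ∘L
        (fderiv ℂ Ψ.symm (s, e.chart t) ∘L ContinuousLinearMap.inl ℂ _ _) := by
      ext1 α
      refine (eq_ham hX.symplectic e fun b => ?_).symm
      obtain ⟨b', rfl⟩ := (chartInvDeriv_bijective y₀ hzΩ.1).2 b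
      have k4 := h7 s (hrS hs) α b'
      rw [formInChart_apply, hGd _ hzΩ] at k4
      exact k4
    rw [k5]
    exact k3

end FlowBox

/-! ### The action of the cotangent space on the fibre -/

section Action

variable {E : Type*} [NormedAddCommGroup E] [NormedSpace ℂ E] [FiniteDimensional ℂ E]
  {X : Type*} [TopologicalSpace X] [ChartedSpace E X]
  {B : Type*} [TopologicalSpace B] [ComplexSpace B] {n : ℕ} {t : B}
  {σ : X → E [⋀^Fin 2]→L[ℂ] ℂ} {hσ : IsHolomorphicSymplectic σ} {f : X → B}
  {e : SmoothChart B n t}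

theorem FlowBox.mfderiv_u_ham {y₀ : X} (b : FlowBox (E := E) hσ f e y₀) {y : X} (hy : y ∈ b.U)
    (hyt : f y = t) (α : Cotangent n) :
    mfderiv 𝓘(ℂ, E) 𝓘(ℂ, Cotangent n) b.u y (ham hσ f e y α) = α := by
  have hs := b.u_mem y hy
  have h1 := b.φ_deriv _ hs
  set D : X → E →L[ℂ] Cotangent n := fun y => mfderiv 𝓘(ℂ, E) 𝓘(ℂ, Cotangent n) b.u y with hD
  have h2 : HasMFDerivAt 𝓘(ℂ, E) 𝓘(ℂ, Cotangent n) b.u (b.φ (b.u y)) (D (b.φ (b.u y))) :=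
    ((b.u_smooth _ (b.φ_mem _ hs)).mdifferentiableAt (by simp)).hasMFDerivAt
  have h3 : HasFDerivAt (b.u ∘ b.φ) (D (b.φ (b.u y)) ∘L ham (E := E) hσ f e (b.φ (b.u y))) (b.u y) :=
    (h2.comp _ h1).hasFDerivAt
  have h4 : HasFDerivAt (b.u ∘ b.φ) (ContinuousLinearMap.id ℂ (Cotangent n)) (b.u y) := by
    refine (hasFDerivAt_id _).congr_of_eventuallyEq ?_
    filter_upwards [Metric.isOpen_ball.mem_nhds hs] with s hs
    exact b.u_φ s hs
  have h5 := DFunLike.congr_fun (h3.unique h4) α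
  rw [b.φ_u y hy hyt] at h5
  exact h5

variable (hσ f e) in
/-- `φ` is an integral map of the Hamiltonian vector fields at `s`, in the fibre over `t`. -/
def IsFlowAt (φ : Cotangent n → X) (s : Cotangent n) : Prop :=
  f (φ s) = t ∧ HasMFDerivAt 𝓘(ℂ, Cotangent n) 𝓘(ℂ, E) φ s (ham (E := E) hσ f e (φ s))

theorem IsFlowAt.comp_add_right {φ : Cotangent n → X} {s a : Cotangent n}
    (h : IsFlowAt (E := E) hσ f e φ (s + a)) : IsFlowAt (E := E) hσ f e (fun s => φ (s + a)) s := by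
  refine ⟨h.1, ?_⟩
  have h1 : HasMFDerivAt 𝓘(ℂ, Cotangent n) 𝓘(ℂ, Cotangent n) (fun s => s + a) s
      (ContinuousLinearMap.id ℂ (Cotangent n)) :=
    ((hasFDerivAt_id s).add_const a).hasMFDerivAt
  exact HasMFDerivAt.comp (g := φ) s h.2 h1

theorem IsFlowAt.congr {φ φ' : Cotangent n → X} {s : Cotangent n}
    (h : IsFlowAt (E := E) hσ f e φ s) (hφ : φ' =ᶠ[𝓝 s] φ) : IsFlowAt (E := E) hσ f e φ' s := by
  refine ⟨hφ.eq_of_nhds ▸ h.1, ?_⟩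
  have := h.2.congr_of_eventuallyEq hφ
  rw [← hφ.eq_of_nhds] at this
  exact this

/-- In the time coordinate every integral map has derivative the identity, so it is a translation.
-/
theorem FlowBox.eventually_eq {y₀ : X} (b : FlowBox (E := E) hσ f e y₀) {φ : Cotangent n → X}
    {s : Cotangent n} (hφ : ∀ᶠ s' in 𝓝 s, IsFlowAt (E := E) hσ f e φ s') (hs : φ s ∈ b.U) :
    ∀ᶠ s' in 𝓝 s, φ s' = b.φ (b.u (φ s) + (s' - s)) := by
  have hc : ContinuousAt φ s := hφ.self_of_nhds.2.continuousAt
  obtain ⟨ε, hε, hball⟩ := Metric.eventually_nhds_iff_ball.1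
    (hφ.and (hc.eventually (b.isOpen_U.mem_nhds hs)))
  have hd : ∀ s' ∈ Metric.ball s ε,
      HasFDerivAt (b.u ∘ φ) (ContinuousLinearMap.id ℂ (Cotangent n)) s' := by
    intro s' hs'
    obtain ⟨⟨h1, h2⟩, h3⟩ := hball s' hs'
    set D : E →L[ℂ] Cotangent n := mfderiv 𝓘(ℂ, E) 𝓘(ℂ, Cotangent n) b.u (φ s') with hD
    have h4 : HasFDerivAt (b.u ∘ φ) (D ∘L ham (E := E) hσ f e (φ s')) s' :=
      (((b.u_smooth _ h3).mdifferentiableAt (by simp)).hasMFDerivAt.comp s' h2).hasFDerivAt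
    have h5 : D ∘L ham (E := E) hσ f e (φ s') = ContinuousLinearMap.id ℂ (Cotangent n) := by
      ext1 α
      exact b.mfderiv_u_ham h3 h1 α
    exact h5 ▸ h4
  have hd' : ∀ s' ∈ Metric.ball s ε, HasFDerivAt (fun s' => (b.u ∘ φ) s' - s')
      (0 : Cotangent n →L[ℂ] Cotangent n) s' := by
    intro s' hs'
    have := (hd s' hs').sub (hasFDerivAt_id s')
    rwa [sub_self] at this
  filter_upwards [Metric.ball_mem_nhds s hε] with s' hs'
  have h1 : (b.u ∘ φ) s' - s' = (b.u ∘ φ) s - s :=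
    (convex_ball s ε).is_const_of_fderivWithin_eq_zero (𝕜 := ℂ) (f := fun s' => (b.u ∘ φ) s' - s')
      (fun z hz => (hd' z hz).differentiableAt.differentiableWithinAt)
      (fun z hz => by
        rw [fderivWithin_of_isOpen Metric.isOpen_ball hz, (hd' z hz).fderiv])
      hs' (Metric.mem_ball_self hε)
  have h2 : b.u (φ s) + (s' - s) = b.u (φ s') := by
    have : b.u (φ s') - s' = b.u (φ s) - s := h1
    rw [← add_sub_assoc, add_sub_right_comm, ← this, sub_add_cancel]
  rw [h2, b.φ_u _ (hball s' hs').2 (hball s' hs').1.1]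

/-- Integral maps are determined by their value at one point. -/
theorem eqOn_of_isFlowAt [T2Space X]
    (hbox : ∀ y, f y = t → Nonempty (FlowBox (E := E) hσ f e y))
    {φ₁ φ₂ : Cotangent n → X} {O : Set (Cotangent n)} (hO : IsOpen O) (hOc : IsPreconnected O)
    (h₁ : ∀ s ∈ O, IsFlowAt (E := E) hσ f e φ₁ s) (h₂ : ∀ s ∈ O, IsFlowAt (E := E) hσ f e φ₂ s)
    {s₀ : Cotangent n} (hs₀ : s₀ ∈ O) (h : φ₁ s₀ = φ₂ s₀) : ∀ s ∈ O, φ₁ s = φ₂ s := by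
  have key : ∀ s ∈ O, φ₁ s = φ₂ s → ∀ᶠ s' in 𝓝 s, φ₁ s' = φ₂ s' := by
    intro s hs heq
    obtain ⟨b⟩ := hbox (φ₁ s) (h₁ s hs).1
    have k1 := b.eventually_eq (eventually_of_mem (hO.mem_nhds hs) h₁) b.mem_U
    have k2 := b.eventually_eq (eventually_of_mem (hO.mem_nhds hs) h₂) (heq ▸ b.mem_U)
    filter_upwards [k1, k2] with s' e1 e2
    rw [e1, e2]
    exact congrArg (fun y => b.φ (b.u y + (s' - s))) heq
  have hV : IsOpen {s | s ∈ O ∧ φ₁ s ≠ φ₂ s} := by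
    rw [isOpen_iff_mem_nhds]
    rintro s ⟨hs, hne⟩
    filter_upwards [hO.mem_nhds hs, ((h₁ s hs).2.continuousAt.ne_iff_eventually_ne
      (h₂ s hs).2.continuousAt).1 hne] with s' h1 h2 using ⟨h1, h2⟩
  have := hOc.subset_left_of_subset_union (u := {s | ∀ᶠ s' in 𝓝 s, φ₁ s' = φ₂ s'})
    isOpen_setOfPred_eventually_nhds hV
    (Set.disjoint_left.2 fun s h1 h2 => h2.2 h1.self_of_nhds)
    (fun s hs => by
      by_cases heq : φ₁ s = φ₂ s
      · exact Or.inl (key s hs heq)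
      · exact Or.inr ⟨hs, heq⟩)
    ⟨s₀, hs₀, key s₀ hs₀ h⟩
  exact fun s hs => (this hs).self_of_nhds

variable (hσ f e) in
/-- The action of `T_t^* B` on the fibre over `t` by Hamiltonian flows. -/
structure FibreAction where
  Φ : Cotangent n → X → X
  zero : ∀ y, Φ 0 y = y
  add : ∀ s s' y, f y = t → Φ (s + s') y = Φ s (Φ s' y)
  smooth : ∀ y, f y = t → ContMDiff 𝓘(ℂ, Cotangent n) 𝓘(ℂ, E) ω (fun s => Φ s y)
  isFlowAt : ∀ y, f y = t → ∀ s, IsFlowAt (E := E) hσ f e (fun s => Φ s y) s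

/-- Each point has a neighbourhood with a common flow time, and finitely many of these cover the
compact fibre. -/
theorem exists_uniform_flow (hT : IsCompact (f ⁻¹' {t}))
    (hbox : ∀ y, f y = t → Nonempty (FlowBox (E := E) hσ f e y)) :
    ∃ r > 0, ∀ y, f y = t → ∃ φ : Cotangent n → X, φ 0 = y ∧
      ∀ s ∈ Metric.ball 0 r, IsFlowAt (E := E) hσ f e φ s ∧
        ContMDiffAt 𝓘(ℂ, Cotangent n) 𝓘(ℂ, E) ω φ s := by
  suffices h : ∃ r > 0, ∀ y ∈ f ⁻¹' {t}, f y = t → ∃ φ : Cotangent n → X, φ 0 = y ∧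
      ∀ s ∈ Metric.ball 0 r, IsFlowAt (E := E) hσ f e φ s ∧
        ContMDiffAt 𝓘(ℂ, Cotangent n) 𝓘(ℂ, E) ω φ s by
    obtain ⟨r, hr, h⟩ := h
    exact ⟨r, hr, fun y hy => h y hy hy⟩
  refine hT.induction_on (p := fun S => ∃ r > 0, ∀ y ∈ S, f y = t → ∃ φ : Cotangent n → X, φ 0 = y ∧
      ∀ s ∈ Metric.ball 0 r, IsFlowAt (E := E) hσ f e φ s ∧
        ContMDiffAt 𝓘(ℂ, Cotangent n) 𝓘(ℂ, E) ω φ s) ⟨1, one_pos, by simp⟩ ?_ ?_ ?_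
  · rintro S S' hS ⟨r, hr, h⟩
    exact ⟨r, hr, fun y hy => h y (hS hy)⟩
  · rintro S S' ⟨r, hr, h⟩ ⟨r', hr', h'⟩
    refine ⟨min r r', lt_min hr hr', ?_⟩
    rintro y (hy | hy) hyt
    · obtain ⟨φ, h0, hφ⟩ := h y hy hyt
      exact ⟨φ, h0, fun s hs => hφ s (Metric.ball_subset_ball (min_le_left _ _) hs)⟩
    · obtain ⟨φ, h0, hφ⟩ := h' y hy hyt
      exact ⟨φ, h0, fun s hs => hφ s (Metric.ball_subset_ball (min_le_right _ _) hs)⟩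
  · intro y₀ hy₀
    obtain ⟨b⟩ := hbox y₀ hy₀
    have hc : ContinuousAt b.u y₀ := (b.u_smooth y₀ b.mem_U).continuousAt
    have hr2 : 0 < b.r / 2 := half_pos b.r_pos
    have hnh : b.u ⁻¹' Metric.ball 0 (b.r / 2) ∩ b.U ∈ 𝓝 y₀ :=
      inter_mem (hc.preimage_mem_nhds (by rw [b.u_zero]; exact Metric.ball_mem_nhds 0 hr2))
        (b.isOpen_U.mem_nhds b.mem_U)
    -- Half the radius is used so that starting at time `u y` and flowing by `s` stays inside the
    -- box.
    refine ⟨_, mem_nhdsWithin_of_mem_nhds hnh, b.r / 2, hr2, ?_⟩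
    rintro y ⟨hyu, hyU⟩ hyt
    refine ⟨fun s => b.φ (s + b.u y), ?_, fun s hs => ?_⟩
    · simp only [zero_add, b.φ_u y hyU hyt]
    · have hs' : s + b.u y ∈ Metric.ball 0 b.r := by
        rw [mem_preimage, mem_ball_zero_iff] at hyu
        rw [mem_ball_zero_iff] at hs ⊢
        linarith [norm_add_le s (b.u y)]
      refine ⟨IsFlowAt.comp_add_right ⟨b.φ_fibre _ hs', b.φ_deriv _ hs'⟩, ?_⟩
      have h1 : ContMDiffAt 𝓘(ℂ, Cotangent n) 𝓘(ℂ, Cotangent n) ω (fun s => s + b.u y) s :=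
        (contDiffAt_id.add contDiffAt_const).contMDiffAt
      exact ContMDiffAt.comp (g := b.φ) s (b.φ_smooth _ hs') h1

/-- Uniqueness of integral maps turns the uniform local flows into a local homomorphism from
`T_t^*B` to the monoid of self-maps of the fibre, which extends to the whole vector space. -/
theorem nonempty_fibreAction [T2Space X] (hT : IsCompact (f ⁻¹' {t}))
    (hbox : ∀ y, f y = t → Nonempty (FlowBox (E := E) hσ f e y)) :
    Nonempty (FibreAction (E := E) hσ f e) := by
  classical
  obtain ⟨r, hr, hex⟩ := exists_uniform_flow hT hbox
  choose φ hφ0 hφ using fun y : f ⁻¹' {t} => hex y y.2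
  have hr2 : 0 < r / 2 := half_pos hr
  -- Outside the ball the value is an arbitrary default, here the identity; only times in the ball
  -- are ever used.
  set A : Cotangent n → Function.End (f ⁻¹' {t}) := fun s y =>
    if hs : s ∈ Metric.ball (0 : Cotangent n) r then ⟨φ y s, (hφ y s hs).1.1⟩ else y with hA
  have hA_apply : ∀ s ∈ Metric.ball (0 : Cotangent n) r, ∀ y, (A s y : X) = φ y s := by
    intro s hs y
    simp only [hA, dif_pos hs]
  have h0 : A 0 = 1 := by
    funext y
    exact Subtype.ext ((hA_apply 0 (Metric.mem_ball_self hr) y).trans (hφ0 y))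
  have hadd : ∀ s s', ‖s‖ < r / 2 → ‖s'‖ < r / 2 → A (s + s') = A s * A s' := by
    intro s s' hs hs'
    funext y
    have hball : ∀ s'' ∈ Metric.ball (0 : Cotangent n) (r / 2),
        s'' + s' ∈ Metric.ball (0 : Cotangent n) r := by
      intro s'' h
      rw [mem_ball_zero_iff] at h ⊢
      linarith [norm_add_le s'' s']
    have hsub : Metric.ball (0 : Cotangent n) (r / 2) ⊆ Metric.ball 0 r :=
      Metric.ball_subset_ball (by linarith)
    have hsb : s ∈ Metric.ball (0 : Cotangent n) (r / 2) := by rwa [mem_ball_zero_iff]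
    have hsb' : s' ∈ Metric.ball (0 : Cotangent n) (r / 2) := by rwa [mem_ball_zero_iff]
    have := eqOn_of_isFlowAt hbox Metric.isOpen_ball (convex_ball (0 : Cotangent n) (r / 2)).isPreconnected
      (φ₁ := fun s'' => φ y (s'' + s')) (φ₂ := φ (A s' y))
      (fun s'' h => (hφ y _ (hball s'' h)).1.comp_add_right)
      (fun s'' h => (hφ _ _ (hsub h)).1) (Metric.mem_ball_self hr2)
      (by simp only [zero_add]; rw [hφ0, hA_apply s' (hsub hsb')]) s hsb
    apply Subtype.ext
    rw [hA_apply _ (hball s hsb)]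
    exact this.trans (hA_apply s (hsub hsb) (A s' y)).symm
  obtain ⟨Φ, hΦ0, hΦadd, hΦA⟩ := exists_hom_of_local_hom hr2 A h0 hadd
  -- Near any `s₀` the global orbit map is a translated local flow from the point reached at time
  -- `s₀`. Smoothness and the flow equation are therefore inherited.
  have hloc : ∀ (y : f ⁻¹' {t}) (s₀ : Cotangent n),
      (fun s => (Φ s y : X)) =ᶠ[𝓝 s₀] fun s => φ (Φ s₀ y) (s + -s₀) := by
    intro y s₀
    filter_upwards [Metric.ball_mem_nhds s₀ hr2] with s hs
    have h1 : ‖s + -s₀‖ < r / 2 := by rwa [← sub_eq_add_neg, ← dist_eq_norm]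
    have h2 : Φ s = Φ (s + -s₀) * Φ s₀ := by rw [← hΦadd]; congr 1; abel
    rw [h2]
    change ((Φ (s + -s₀) (Φ s₀ y) : f ⁻¹' {t}) : X) = _
    rw [hΦA _ h1, hA_apply _ (by rw [mem_ball_zero_iff]; linarith)]
  have hmem : ∀ s₀ : Cotangent n, s₀ + -s₀ ∈ Metric.ball (0 : Cotangent n) r := fun s₀ => by
    rw [add_neg_cancel]; exact Metric.mem_ball_self hr
  refine ⟨{
    Φ := fun s y => if hy : f y = t then (Φ s ⟨y, hy⟩ : X) else y
    zero := fun y => ?_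
    add := fun s s' y hy => ?_
    smooth := fun y hy => ?_
    isFlowAt := fun y hy s => ?_ }⟩
  · by_cases hy : f y = t
    · simp only [dif_pos hy, hΦ0]; rfl
    · simp only [dif_neg hy]
  · have h1 : f (Φ s' ⟨y, hy⟩ : X) = t := (Φ s' ⟨y, hy⟩).2
    simp only [dif_pos hy, dif_pos h1, hΦadd]
    rfl
  · simp only [dif_pos hy]
    intro s₀
    refine ContMDiffAt.congr_of_eventuallyEq ?_ (hloc ⟨y, hy⟩ s₀)
    have h1 : ContMDiffAt 𝓘(ℂ, Cotangent n) 𝓘(ℂ, Cotangent n) ω (fun s => s + -s₀) s₀ :=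
      (contDiffAt_id.add contDiffAt_const).contMDiffAt
    exact ContMDiffAt.comp (g := φ (Φ s₀ ⟨y, hy⟩)) s₀ (hφ _ _ (hmem s₀)).2 h1
  · simp only [dif_pos hy]
    exact ((hφ (Φ s ⟨y, hy⟩) _ (hmem s)).1.comp_add_right).congr (hloc ⟨y, hy⟩ s)

namespace FibreAction

variable (a : FibreAction (E := E) hσ f e)

theorem fibre {y : X} (hy : f y = t) (s : Cotangent n) : f (a.Φ s y) = t := (a.isFlowAt y hy s).1

theorem neg_add_cancel {y : X} (hy : f y = t) (s : Cotangent n) : a.Φ (-s) (a.Φ s y) = y := by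
  rw [← a.add _ _ _ hy, _root_.neg_add_cancel, a.zero]

theorem comm {y : X} (hy : f y = t) (s s' : Cotangent n) :
    a.Φ s (a.Φ s' y) = a.Φ s' (a.Φ s y) := by
  rw [← a.add _ _ _ hy, ← a.add _ _ _ hy, add_comm]

theorem eq_flowBox [T2Space X]
    (hbox : ∀ y, f y = t → Nonempty (FlowBox (E := E) hσ f e y)) {y : X} (hy : f y = t)
    (b : FlowBox (E := E) hσ f e y) {s : Cotangent n} (hs : s ∈ Metric.ball 0 b.r) :
    a.Φ s y = b.φ s := by
  refine eqOn_of_isFlowAt hbox Metric.isOpen_ball (convex_ball _ _).isPreconnected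
    (φ₁ := fun s => a.Φ s y) (fun s _ => a.isFlowAt y hy s)
    (fun s hs => ⟨b.φ_fibre s hs, b.φ_deriv s hs⟩) (Metric.mem_ball_self b.r_pos) ?_ s hs
  have := b.φ_u y b.mem_U hy
  rw [b.u_zero] at this
  exact (a.zero y).trans this.symm

theorem exists_eq_of_mem_box [T2Space X]
    (hbox : ∀ y, f y = t → Nonempty (FlowBox (E := E) hσ f e y)) {y : X} (hy : f y = t)
    (b : FlowBox (E := E) hσ f e y) {y' : X} (hy' : y' ∈ b.U) (hyt' : f y' = t) :
    ‖b.u y'‖ < b.r ∧ a.Φ (b.u y') y = y' := by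
  have h := b.u_mem y' hy'
  exact ⟨by rwa [mem_ball_zero_iff] at h, by rw [a.eq_flowBox hbox hy b h, b.φ_u y' hy' hyt']⟩

/-- Points in one flow box lie in one orbit, so orbits and their complements are open in the
connected fibre. -/
theorem transitive [T2Space X] (hbox : ∀ y, f y = t → Nonempty (FlowBox (E := E) hσ f e y))
    (hconn : IsPreconnected (f ⁻¹' {t})) {x y : X} (hx : f x = t) (hy : f y = t) :
    ∃ s, a.Φ s x = y := by
  have : PreconnectedSpace (f ⁻¹' {t}) := isPreconnected_iff_preconnectedSpace.1 hconn
  set O : Set (f ⁻¹' {t}) := {y | ∃ s, a.Φ s x = y} with hO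
  have key : ∀ y : f ⁻¹' {t}, ∀ᶠ y' : f ⁻¹' {t} in 𝓝 y, ∃ s, a.Φ s (y : X) = y' := by
    intro y
    obtain ⟨b⟩ := hbox y y.2
    have := continuous_subtype_val.continuousAt.preimage_mem_nhds (b.isOpen_U.mem_nhds b.mem_U)
    filter_upwards [this] with y' hy'
    exact ⟨_, (a.exists_eq_of_mem_box hbox y.2 b hy' y'.2).2⟩
  have hopen : IsOpen O := by
    rw [isOpen_iff_mem_nhds]
    rintro y ⟨s, hs⟩
    filter_upwards [key y] with y' hy'
    obtain ⟨s', hs'⟩ := hy'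
    exact ⟨s' + s, by rw [a.add _ _ _ hx, hs, hs']⟩
  have hclosed : IsClosed O := by
    rw [← isOpen_compl_iff, isOpen_iff_mem_nhds]
    intro y hy
    filter_upwards [key y] with y' hy'
    rintro ⟨s, hs⟩
    obtain ⟨s', hs'⟩ := hy'
    refine hy ⟨-s' + s, ?_⟩
    rw [a.add _ _ _ hx, hs, ← hs', a.neg_add_cancel y.2]
  have := IsClopen.eq_univ ⟨hclosed, hopen⟩ ⟨⟨x, hx⟩, 0, a.zero x⟩
  exact (this ▸ mem_univ (⟨y, hy⟩ : f ⁻¹' {t}) : (⟨y, hy⟩ : f ⁻¹' {t}) ∈ O)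

/-- The periods of the action, i.e. the stabiliser of a point `x` of the fibre. -/
noncomputable def periods {x : X} (hx : f x = t) : Submodule ℤ (Cotangent n) :=
  AddSubgroup.toIntSubmodule
    { carrier := {s | a.Φ s x = x}
      zero_mem' := a.zero x
      add_mem' := fun {s s'} hs hs' => by
        simp only [Set.mem_ofPred_eq] at hs hs' ⊢
        rw [a.add _ _ _ hx, hs', hs]
      neg_mem' := fun {s} hs => by
        simp only [Set.mem_ofPred_eq] at hs ⊢
        conv_lhs => rw [← hs]
        exact a.neg_add_cancel hx s }

theorem mem_periods {x : X} (hx : f x = t) {s : Cotangent n} :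
    s ∈ a.periods hx ↔ a.Φ s x = x := Iff.rfl

theorem sub_mem_periods {x : X} (hx : f x = t) {s s' : Cotangent n} :
    s - s' ∈ a.periods hx ↔ a.Φ s x = a.Φ s' x := by
  rw [mem_periods, sub_eq_add_neg, add_comm, a.add _ _ _ hx]
  constructor
  · intro h
    have h1 := congrArg (a.Φ s') h
    rwa [← a.add _ _ _ (a.fibre hx s), add_neg_cancel, a.zero] at h1
  · intro h
    rw [h, a.neg_add_cancel hx]

/-- The acting group is commutative, so stabilisers are constant along an orbit. -/
theorem periods_eq {x y : X} (hx : f x = t) (hy : f y = t) (h : ∃ s, a.Φ s x = y) :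
    a.periods hx = a.periods hy := by
  obtain ⟨s, rfl⟩ := h
  ext s'
  rw [mem_periods, mem_periods, a.comm hx s' s]
  constructor
  · intro h; rw [h]
  · intro h
    have := congrArg (a.Φ (-s)) h
    rwa [a.neg_add_cancel hx, a.neg_add_cancel (a.fibre hx s')] at this

/-- The flow is injective on the ball of a flow box, so this ball contains no nonzero period. -/
theorem discreteTopology_periods [T2Space X]
    (hbox : ∀ y, f y = t → Nonempty (FlowBox (E := E) hσ f e y)) {x : X} (hx : f x = t) :
    DiscreteTopology (a.periods hx) := by
  obtain ⟨b⟩ := hbox x hx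
  refine discreteTopology_of_isOpen_singleton_zero ?_
  have h : ({0} : Set (a.periods hx)) = Subtype.val ⁻¹' Metric.ball (0 : Cotangent n) b.r := by
    ext s
    simp only [mem_singleton_iff, mem_preimage]
    constructor
    · rintro rfl
      exact Metric.mem_ball_self b.r_pos
    · intro hs
      have h1 : a.Φ s x = x := s.2
      rw [a.eq_flowBox hbox hx b hs] at h1
      have h2 := b.u_φ _ hs
      rw [h1, b.u_zero] at h2
      exact Subtype.ext h2.symm
  rw [h]
  exact Metric.isOpen_ball.preimage continuous_subtype_val

/-- By compactness every point of the fibre is reached from `x` in time at most `K`, so every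
covector is a bounded one modulo periods. A nonzero real functional killing all periods would then
be bounded above, which is impossible. -/
theorem span_periods [T2Space X] (hT : IsCompact (f ⁻¹' {t}))
    (hbox : ∀ y, f y = t → Nonempty (FlowBox (E := E) hσ f e y))
    (hconn : IsPreconnected (f ⁻¹' {t})) {x : X} (hx : f x = t) :
    Submodule.span ℝ (a.periods hx : Set (Cotangent n)) = ⊤ := by
  obtain ⟨K, hK⟩ : ∃ K : ℝ, ∀ y ∈ f ⁻¹' {t}, f y = t → ∃ s, ‖s‖ ≤ K ∧ a.Φ s x = y := by
    refine hT.induction_on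
      (p := fun S => ∃ K : ℝ, ∀ y ∈ S, f y = t → ∃ s, ‖s‖ ≤ K ∧ a.Φ s x = y) ⟨0, by simp⟩ ?_ ?_ ?_
    · rintro S S' hS ⟨K, hK⟩
      exact ⟨K, fun y hy => hK y (hS hy)⟩
    · rintro S S' ⟨K, hK⟩ ⟨K', hK'⟩
      refine ⟨max K K', ?_⟩
      rintro y (hy | hy) hyt
      · obtain ⟨s, h1, h2⟩ := hK y hy hyt
        exact ⟨s, h1.trans (le_max_left _ _), h2⟩
      · obtain ⟨s, h1, h2⟩ := hK' y hy hyt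
        exact ⟨s, h1.trans (le_max_right _ _), h2⟩
    · intro y hy
      obtain ⟨b⟩ := hbox y hy
      obtain ⟨s, hs⟩ := a.transitive hbox hconn hx hy
      refine ⟨b.U, mem_nhdsWithin_of_mem_nhds (b.isOpen_U.mem_nhds b.mem_U), b.r + ‖s‖, ?_⟩
      intro y' hy' hyt'
      obtain ⟨h1, h2⟩ := a.exists_eq_of_mem_box hbox hy b hy' hyt'
      refine ⟨b.u y' + s, (norm_add_le _ _).trans (by linarith), ?_⟩
      rw [a.add _ _ _ hx, hs, h2]
  by_contra hne
  obtain ⟨g, hg, hle⟩ := Submodule.exists_le_ker_of_lt_top _ (lt_top_iff_ne_top.2 hne)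
  set G : Cotangent n →L[ℝ] ℝ := LinearMap.toContinuousLinearMap g with hG
  have hbound : ∀ s, G s ≤ ‖G‖ * K := by
    intro s
    obtain ⟨s', h1, h2⟩ := hK (a.Φ s x) (a.fibre hx s) (a.fibre hx s)
    have h3 : G (s - s') = 0 := hle (Submodule.subset_span ((a.sub_mem_periods hx).2 h2.symm))
    rw [map_sub, sub_eq_zero] at h3
    rw [h3]
    exact (le_abs_self _).trans ((G.le_opNorm s').trans (by gcongr))
  refine hg (LinearMap.ext fun s => ?_)
  by_contra h0
  have h1 := hbound (((‖G‖ * K + 1) / G s) • s)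
  have h2 : G s ≠ 0 := h0
  rw [map_smul, smul_eq_mul, div_mul_cancel₀ _ h2] at h1
  linarith

end FibreAction

end Action

/-! ### Functions vanishing on a smooth hypersurface -/

section LevelSets

variable {E : Type*} [NormedAddCommGroup E] [NormedSpace ℂ E] [FiniteDimensional ℂ E]
  {X : Type*} [TopologicalSpace X] [ChartedSpace E X]

/-- A germ vanishing on a smooth hypersurface has derivative zero along the hypersurface. -/
theorem fderiv_apply_eq_zero_of_vanishing {G K : E → ℂ} {z₀ : E} (hG : ContDiffAt ℂ ω G z₀)
    (hK : DifferentiableAt ℂ K z₀) (hne : fderiv ℂ G z₀ ≠ 0) (h0 : G z₀ = 0)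
    (hv : ∀ᶠ z in 𝓝 z₀, G z = 0 → K z = 0) {b : E} (hb : fderiv ℂ G z₀ b = 0) :
    fderiv ℂ K z₀ b = 0 := by
  have : CompleteSpace E := FiniteDimensional.complete ℂ E
  obtain ⟨v, hv1⟩ : ∃ v, fderiv ℂ G z₀ v = 1 := by
    obtain ⟨w, hw⟩ := DFunLike.ne_iff.1 hne
    exact ⟨(fderiv ℂ G z₀ w)⁻¹ • w, by rw [map_smul, smul_eq_mul, inv_mul_cancel₀ hw]⟩
  set A := fderiv ℂ G z₀ with hA
  -- Since `A v = 1`, this map satisfies `A ∘ Θ = G` and has identity derivative at `z₀`. It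
  -- straightens `{G = 0}` to a hyperplane, so a line in direction `b` pulls back to a curve in `{G
  -- = 0}` with velocity `b`.
  set Θ : E → E := fun z => z + (G z - A z) • v with hΘ
  have hΘd : HasFDerivAt Θ (ContinuousLinearMap.id ℂ E) z₀ := by
    have h1 : HasFDerivAt (fun z => G z - A z) (A - A) z₀ :=
      (hG.differentiableAt (by simp)).hasFDerivAt.sub A.hasFDerivAt
    have h2 := (hasFDerivAt_id z₀).add (h1.smul_const v)
    have h3 : ContinuousLinearMap.id ℂ E + (A - A).smulRight v = ContinuousLinearMap.id ℂ E := by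
      ext w; simp
    exact h3 ▸ h2
  have hΘc : ContDiffAt ℂ ω Θ z₀ :=
    contDiffAt_id.add ((hG.sub A.contDiff.contDiffAt).smul contDiffAt_const)
  obtain ⟨Ψ, h1, -, h3, -, h5⟩ := exists_openPartialHomeomorph hΘc
    (by rw [hΘd.fderiv]; exact Function.bijective_id) univ_mem
  have hAΨ : ∀ z, A (Ψ z) = G z := by
    intro z
    rw [h3]
    simp [hΘ, hv1]
  have hz₀ : Ψ z₀ ∈ Ψ.target := Ψ.map_source h1
  have hsymm : HasFDerivAt Ψ.symm (ContinuousLinearMap.id ℂ E) (Ψ z₀) := by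
    have k1 := ((h5 _ hz₀).differentiableAt (by simp)).hasFDerivAt
    have k2 : HasFDerivAt Θ (ContinuousLinearMap.id ℂ E) (Ψ.symm (Ψ z₀)) := by
      rw [Ψ.left_inv h1]; exact hΘd
    have k3 := k2.comp _ k1
    have k4 : HasFDerivAt (Θ ∘ Ψ.symm) (ContinuousLinearMap.id ℂ E) (Ψ z₀) := by
      refine (hasFDerivAt_id _).congr_of_eventuallyEq ?_
      filter_upwards [Ψ.open_target.mem_nhds hz₀] with w hw
      rw [← h3]
      exact Ψ.right_inv hw
    have k5 := k3.unique k4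
    rw [ContinuousLinearMap.id_comp] at k5
    exact k5 ▸ k1
  have hline : HasDerivAt (fun s : ℂ => Ψ z₀ + s • b) b 0 := by
    simpa using ((hasDerivAt_id (0 : ℂ)).smul_const b).const_add (Ψ z₀)
  have hsymm' : HasFDerivAt Ψ.symm (ContinuousLinearMap.id ℂ E) (Ψ z₀ + (0 : ℂ) • b) := by
    rwa [zero_smul, add_zero]
  have hcurve := hsymm'.comp_hasDerivAt (0 : ℂ) hline
  have hc0 : (Ψ.symm ∘ fun s : ℂ => Ψ z₀ + s • b) 0 = z₀ := by
    simp [Ψ.left_inv h1]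
  have hKc : HasDerivAt (K ∘ (Ψ.symm ∘ fun s : ℂ => Ψ z₀ + s • b)) (fderiv ℂ K z₀ b) 0 := by
    have k1 : HasFDerivAt K (fderiv ℂ K z₀) ((Ψ.symm ∘ fun s : ℂ => Ψ z₀ + s • b) 0) := by
      rw [hc0]; exact hK.hasFDerivAt
    exact k1.comp_hasDerivAt (0 : ℂ) hcurve
  have hzero : (K ∘ (Ψ.symm ∘ fun s : ℂ => Ψ z₀ + s • b)) =ᶠ[𝓝 0] fun _ => 0 := by
    have k1 : ∀ᶠ s in 𝓝 (0 : ℂ), Ψ z₀ + s • b ∈ Ψ.target :=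
      hline.continuousAt.preimage_mem_nhds (by
        rw [zero_smul, add_zero]; exact Ψ.open_target.mem_nhds hz₀)
    have k2 := hcurve.continuousAt.eventually (hc0.symm ▸ hv)
    filter_upwards [k1, k2] with s hs hs2
    refine hs2 ?_
    rw [← hAΨ]
    simp only [Function.comp]
    rw [Ψ.right_inv hs, map_add, map_smul, hb, hAΨ, h0]
    simp
  exact hKc.unique ((hasDerivAt_const (0 : ℂ) (0 : ℂ)).congr_of_eventuallyEq hzero)

omit [FiniteDimensional ℂ E] in
theorem mfderiv_eq_fderiv_chart {V : Type*} [NormedAddCommGroup V] [NormedSpace ℂ V] {g : X → V}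
    {y : X} (hg : MDifferentiableAt 𝓘(ℂ, E) 𝓘(ℂ, V) g y) (b : E) :
    mfderiv 𝓘(ℂ, E) 𝓘(ℂ, V) g y b =
      fderiv ℂ (g ∘ (chartAt E y).symm) (chartAt E y y) b := by
  rw [hg.mfderiv]
  simp only [mfld_simps, fderivWithin_univ]
  rfl

theorem mfderiv_apply_eq_zero_of_vanishing [IsManifold 𝓘(ℂ, E) ω X] {g h : X → ℂ} {y : X}
    (hg : ContMDiffAt 𝓘(ℂ, E) 𝓘(ℂ, ℂ) ω g y) (hh : ContMDiffAt 𝓘(ℂ, E) 𝓘(ℂ, ℂ) ω h y)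
    (hne : mfderiv 𝓘(ℂ, E) 𝓘(ℂ, ℂ) g y ≠ 0) (h0 : g y = 0)
    (hv : ∀ᶠ y' in 𝓝 y, g y' = 0 → h y' = 0) {b : E}
    (hb : mfderiv 𝓘(ℂ, E) 𝓘(ℂ, ℂ) g y b = 0) : mfderiv 𝓘(ℂ, E) 𝓘(ℂ, ℂ) h y b = 0 := by
  set ψ := chartAt E y with hψ
  have hys : y ∈ ψ.source := mem_chart_source E y
  have hyt : ψ y ∈ ψ.target := ψ.map_source hys
  have hyy : ψ.symm (ψ y) = y := ψ.left_inv hys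
  have hcd : ∀ {k : X → ℂ}, ContMDiffAt 𝓘(ℂ, E) 𝓘(ℂ, ℂ) ω k y →
      ContDiffAt ℂ ω (k ∘ ψ.symm) (ψ y) := by
    intro k hk
    rw [← contMDiffAt_iff_contDiffAt]
    refine ContMDiffAt.comp (g := k) _ (by rwa [hyy])
      (contMDiffOn_chart_symm.contMDiffAt (ψ.open_target.mem_nhds hyt))
  have hgm := hg.mdifferentiableAt (by simp)
  have hhm := hh.mdifferentiableAt (by simp)
  refine (mfderiv_eq_fderiv_chart hhm b).trans ?_
  refine fderiv_apply_eq_zero_of_vanishing (G := g ∘ ψ.symm) (hcd hg)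
    ((hcd hh).differentiableAt (by simp)) ?_ ?_ ?_ ?_
  · intro hz
    refine hne (ContinuousLinearMap.ext fun a => ?_)
    exact (mfderiv_eq_fderiv_chart hgm a).trans (by rw [← hψ, hz]; rfl)
  · simp only [Function.comp, hyy, h0]
  · have hc : ContinuousAt ψ.symm (ψ y) := ψ.continuousAt_symm hyt
    exact hc.eventually (hyy.symm ▸ hv)
  · exact (mfderiv_eq_fderiv_chart hgm b).symm.trans hb

omit [FiniteDimensional ℂ E] in
theorem eventually_eq_of_hasMFDerivAt_zero [IsManifold 𝓘(ℂ, E) ω X] {V : Type*}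
    [NormedAddCommGroup V] [NormedSpace ℂ V] {F : X → V} {p : X}
    (h : ∀ᶠ q in 𝓝 p, HasMFDerivAt 𝓘(ℂ, E) 𝓘(ℂ, V) F q (0 : E →L[ℂ] V)) :
    ∀ᶠ q in 𝓝 p, F q = F p := by
  set ψ := chartAt E p with hψ
  have hps : p ∈ ψ.source := mem_chart_source E p
  have hpt : ψ p ∈ ψ.target := ψ.map_source hps
  have hpp : ψ.symm (ψ p) = p := ψ.left_inv hps
  have hc : ContinuousAt ψ.symm (ψ p) := ψ.continuousAt_symm hpt
  obtain ⟨ε, hε, hball⟩ := Metric.eventually_nhds_iff_ball.1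
    ((hc.eventually (hpp.symm ▸ h)).and (ψ.open_target.mem_nhds hpt))
  have hd : ∀ z ∈ Metric.ball (ψ p) ε, HasFDerivAt (F ∘ ψ.symm) (0 : E →L[ℂ] V) z := by
    intro z hz
    have h1 := (hball z hz).1
    have h2 := (mdifferentiableAt_chart_symm p (hball z hz).2).hasMFDerivAt
    have h3 := (HasMFDerivAt.comp (g := F) z h1 h2).hasFDerivAt
    refine h3.congr_fderiv ?_
    ext1 a; rfl
  filter_upwards [(ψ.continuousAt hps).preimage_mem_nhds (Metric.ball_mem_nhds _ hε),
    ψ.open_source.mem_nhds hps] with q hq hqs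
  have := (convex_ball (ψ p) ε).is_const_of_fderivWithin_eq_zero (𝕜 := ℂ) (f := F ∘ ψ.symm)
      (fun z hz => (hd z hz).differentiableAt.differentiableWithinAt)
      (fun z hz => by rw [fderivWithin_of_isOpen Metric.isOpen_ball hz, (hd z hz).fderiv])
      hq (Metric.mem_ball_self hε)
  simp only [Function.comp] at this
  rwa [ψ.left_inv hqs, hpp] at this

end LevelSets

/-! ### The characteristic foliation of a pulled-back hypersurface -/

section Characteristic

variable {E : Type*} [NormedAddCommGroup E] [NormedSpace ℂ E] [FiniteDimensional ℂ E]
  {X : Type*} [TopologicalSpace X] [ChartedSpace E X]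
  {B : Type*} [TopologicalSpace B] [ComplexSpace B] {n : ℕ} {t : B}
  {σ : X → E [⋀^Fin 2]→L[ℂ] ℂ} {f : X → B}

omit [FiniteDimensional ℂ E] in
theorem contMDiffAt_pullback (hf : IsLagrangianFibration σ f n) (e : SmoothChart B n t) {y : X}
    (hy : f y ∈ e.chart.source) {h : EuclideanSpace ℂ (Fin n) → ℂ}
    (hh : AnalyticAt ℂ h (e.chart (f y))) :
    ContMDiffAt 𝓘(ℂ, E) 𝓘(ℂ, ℂ) ω (fun y => h (e.chart (f y))) y :=
  ContMDiffAt.comp (g := h) (f := e.chart ∘ f) y hh.contDiffAt.contMDiffAt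
    (contMDiffAt_chart_comp hf e hy)

omit [FiniteDimensional ℂ E] in
theorem mfderiv_pullback (hf : IsLagrangianFibration σ f n) (e : SmoothChart B n t) {y : X}
    (hy : f y ∈ e.chart.source) {h : EuclideanSpace ℂ (Fin n) → ℂ}
    (hh : AnalyticAt ℂ h (e.chart (f y))) (b : E) :
    mfderiv 𝓘(ℂ, E) 𝓘(ℂ, ℂ) (fun y => h (e.chart (f y))) y b =
      fderiv ℂ h (e.chart (f y)) (fibDeriv E f e y b) := by
  have h1 := HasMFDerivAt.comp (g := h) (f := e.chart ∘ f) y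
    hh.differentiableAt.hasFDerivAt.hasMFDerivAt
    ((contMDiffAt_chart_comp hf e hy).mdifferentiableAt (by simp)).hasMFDerivAt
  exact DFunLike.congr_fun h1.mfderiv b

omit [FiniteDimensional ℂ E] in
theorem mfderiv_pullback_ne_zero (hf : IsLagrangianFibration σ f n) (e : SmoothChart B n t) {y : X}
    (hy : y ∈ submersiveLocus (E := E) f e) {h : EuclideanSpace ℂ (Fin n) → ℂ}
    (hh : AnalyticAt ℂ h (e.chart (f y))) (hne : fderiv ℂ h (e.chart (f y)) ≠ 0) :
    mfderiv 𝓘(ℂ, E) 𝓘(ℂ, ℂ) (fun y => h (e.chart (f y))) y ≠ 0 := by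
  obtain ⟨w, hw⟩ := DFunLike.ne_iff.1 hne
  obtain ⟨b, rfl⟩ := hy.2 w
  intro h0
  refine hw ?_
  rw [← mfderiv_pullback hf e hy.1 hh b]
  exact DFunLike.congr_fun h0 b

/-- The characteristic foliation of the preimage of a smooth hypersurface is spanned by the
Hamiltonian vector field of its equation. -/
theorem charFoliation_eq (hX : IsHyperkahler σ) (hf : IsLagrangianFibration σ f n)
    (hdim : Module.finrank ℂ E = 2 * n) (e : SmoothChart B n t) {y : X}
    (hy : y ∈ submersiveLocus (E := E) f e) {h : EuclideanSpace ℂ (Fin n) → ℂ}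
    (hh : AnalyticAt ℂ h (e.chart (f y))) (hne : fderiv ℂ h (e.chart (f y)) ≠ 0) {D : Set X}
    (hyD : y ∈ D) (hD : ∀ᶠ y' in 𝓝 y, y' ∈ D ↔ h (e.chart (f y')) = 0) :
    charFoliation σ D y =
      {a | ∃ c : ℂ, a = ham hX.symplectic f e y (c • fderiv ℂ h (e.chart (f y)))} := by
  have := hX.manifold
  set g : X → ℂ := fun y => h (e.chart (f y)) with hg
  set β := fderiv ℂ h (e.chart (f y)) with hβ
  have hgc := contMDiffAt_pullback (E := E) hf e hy.1 hh
  have hgne := mfderiv_pullback_ne_zero hf e hy hh hne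
  have hgd := mfderiv_pullback (E := E) hf e hy.1 hh
  have htan : ∀ b : E, b ∈ tangentOf (E := E) D y ↔ β (fibDeriv E f e y b) = 0 := by
    intro b
    rw [hβ, ← hgd b]
    constructor
    · intro hb
      exact hb g hgc (hD.mono fun y' h1 h2 => h1.1 h2)
    · intro hb k hk hkv
      refine mfderiv_apply_eq_zero_of_vanishing hgc hk hgne (hD.self_of_nhds.1 hyD) ?_ hb
      filter_upwards [hD, hkv] with y' h1 h2 h3 using h2 (h1.2 h3)
  ext a
  simp only [charFoliation, Set.mem_ofPred_eq]
  constructor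
  · rintro ⟨-, ha⟩
    obtain ⟨w, hw⟩ : ∃ w, β w = 1 := by
      obtain ⟨w, hw⟩ := DFunLike.ne_iff.1 hne
      exact ⟨(β w)⁻¹ • w, by rw [map_smul, smul_eq_mul]; exact inv_mul_cancel₀ hw⟩
    obtain ⟨b₁, rfl⟩ := hy.2 w
    -- As `β (df b₁) = 1`, the vector `b - β(df b) b₁` is tangent to `D` for every `b`. Pairing it
    -- with `a` gives `σ(a, b) = σ(a, b₁) β(df b)`, so `a` is `σ(a, b₁)` times the Hamiltonian
    -- vector of `β`.
    refine ⟨σ y ![a, b₁], eq_ham hX.symplectic e fun b => ?_⟩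
    have h1 := ha (b - β (fibDeriv E f e y b) • b₁) ((htan _).2 (by simp [hw]))
    rw [← toBilin_apply, map_sub, map_smul, sub_eq_zero, toBilin_apply, toBilin_apply] at h1
    rw [h1]
    simp [mul_comm]
  · rintro ⟨c, rfl⟩
    refine ⟨(htan _).2 ?_, fun b hb => ?_⟩
    · rw [fibDeriv_ham hX.symplectic e hX hf hdim hy, map_zero]
    · rw [form_ham]
      have := (htan b).1 hb
      simp [this]

end Characteristic

/-! ### Leaves as orbits -/

section Leaves

variable {E : Type*} [NormedAddCommGroup E] [NormedSpace ℂ E] [FiniteDimensional ℂ E]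
  {X : Type*} [TopologicalSpace X] [ChartedSpace E X]
  {B : Type*} [TopologicalSpace B] [ComplexSpace B] {n : ℕ} {t : B}
  {σ : X → E [⋀^Fin 2]→L[ℂ] ℂ} {f : X → B} {e : SmoothChart B n t}

omit [FiniteDimensional ℂ E] in
theorem mem_submersiveLocus (ht : IsSmoothFibre E f e) {y : X} (hy : f y = t) :
    y ∈ submersiveLocus (E := E) f e := ⟨hy ▸ e.mem_source, ht y hy⟩

omit [FiniteDimensional ℂ E] in
/-- Near the fibre over `t`, the preimage of a hypersurface that is smooth at `t` is cut out by a
submersive equation. -/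
theorem eventually_smooth_equation [IsManifold 𝓘(ℂ, E) ω X] (hf : IsLagrangianFibration σ f n)
    (ht : IsSmoothFibre E f e) {h : EuclideanSpace ℂ (Fin n) → ℂ}
    (hh : AnalyticAt ℂ h (e.chart t)) (hne : fderiv ℂ h (e.chart t) ≠ 0) {H : Set B}
    (hH : ∀ᶠ c in 𝓝 t, c ∈ H ↔ h (e.chart c) = 0) {y : X} (hy : f y = t) :
    ∀ᶠ y' in 𝓝 y, y' ∈ submersiveLocus (E := E) f e ∧ AnalyticAt ℂ h (e.chart (f y')) ∧
      fderiv ℂ h (e.chart (f y')) ≠ 0 ∧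
      ∀ᶠ y'' in 𝓝 y', y'' ∈ f ⁻¹' H ↔ h (e.chart (f y'')) = 0 := by
  have hfc : Tendsto f (𝓝 y) (𝓝 t) := hy ▸ hf.continuous.continuousAt
  have hec : Tendsto (fun y' => e.chart (f y')) (𝓝 y) (𝓝 (e.chart t)) :=
    (e.chart.continuousAt e.mem_source).tendsto.comp hfc
  have h1 := hec.eventually hh.eventually_analyticAt
  have h2 : ∀ᶠ z in 𝓝 (e.chart t), fderiv ℂ h z ≠ 0 := hh.fderiv.continuousAt.eventually_ne hne
  filter_upwards [submersiveLocus_mem_nhds hf e (mem_submersiveLocus ht hy), h1,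
    hec.eventually h2, (hfc.eventually hH).eventually_nhds] with y' k1 k2 k3 k4
    using ⟨k1, k2, k3, k4⟩

omit [FiniteDimensional ℂ E] in
theorem subset_regularLocus (hX : IsHyperkahler σ) (hf : IsLagrangianFibration σ f n)
    (ht : IsSmoothFibre E f e) {H : Set B} {α : Cotangent n} (hα : HasConormal e H α) :
    f ⁻¹' {t} ⊆ regularLocus E (f ⁻¹' H) := by
  have := hX.manifold
  obtain ⟨hα0, htH, h, hh, hd, hH⟩ := hα
  intro y hy
  have hy' : f y = t := hy
  obtain ⟨k1, k2, k3, k4⟩ :=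
    (eventually_smooth_equation hf ht hh (hd.symm ▸ hα0) hH hy').self_of_nhds
  refine ⟨?_, _, contMDiffAt_pullback hf e k1.1 k2, mfderiv_pullback_ne_zero hf e k1 k2 k3, k4⟩
  rw [mem_preimage, hy']
  exact htH

theorem charFoliation_fibre (hX : IsHyperkahler σ) (hf : IsLagrangianFibration σ f n)
    (hdim : Module.finrank ℂ E = 2 * n) (ht : IsSmoothFibre E f e) {H : Set B} {α : Cotangent n}
    (hα : HasConormal e H α) {y : X} (hy : f y = t) :
    charFoliation σ (f ⁻¹' H) y = {a | ∃ c : ℂ, a = ham hX.symplectic f e y (c • α)} := by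
  have := hX.manifold
  obtain ⟨hα0, htH, h, hh, hd, hH⟩ := hα
  obtain ⟨k1, k2, k3, k4⟩ :=
    (eventually_smooth_equation hf ht hh (hd.symm ▸ hα0) hH hy).self_of_nhds
  rw [charFoliation_eq hX hf hdim e k1 k2 k3 (by rw [mem_preimage, hy]; exact htH) k4, hy, hd]

/-- Integral submanifolds of the characteristic foliation that meet the fibre over `t` lie in it. -/
theorem fibre_of_isIntegral (hX : IsHyperkahler σ) (hf : IsLagrangianFibration σ f n)
    (hdim : Module.finrank ℂ E = 2 * n) (ht : IsSmoothFibre E f e) {H : Set B} {α : Cotangent n}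
    (hα : HasConormal e H α) {N : Type*} [TopologicalSpace N] [ChartedSpace ℂ N]
    [IsManifold 𝓘(ℂ, ℂ) ω N] [ConnectedSpace N] {j : N → X}
    (hj : ContMDiff 𝓘(ℂ, ℂ) 𝓘(ℂ, E) ω j)
    (hreg : ∀ p, j p ∈ regularLocus E (f ⁻¹' H))
    (htan : ∀ p, range (mfderiv 𝓘(ℂ, ℂ) 𝓘(ℂ, E) j p) = charFoliation σ (f ⁻¹' H) (j p))
    {p₀ : N} (hp₀ : f (j p₀) = t) (p : N) : f (j p) = t := by
  have := hX.manifold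
  have := hf.hausdorff
  obtain ⟨hα0, htH, h, hh, hd, hH⟩ := hα
  have hclosed : IsClosed {p | f (j p) = t} :=
    isClosed_eq (hf.continuous.comp hj.continuous) continuous_const
  have hopen : IsOpen {p | f (j p) = t} := by
    rw [isOpen_iff_mem_nhds]
    intro p hp
    have hgood := hj.continuous.continuousAt.eventually
      (eventually_smooth_equation hf ht hh (hd.symm ▸ hα0) hH hp)
    -- The points `j q` are not yet known to lie over `t`. The foliation is also tangent to the
    -- neighbouring fibres of `f`, so `f ∘ j` is locally constant.
    have hconst : ∀ᶠ q in 𝓝 p, (e.chart ∘ f ∘ j) q = (e.chart ∘ f ∘ j) p := by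
      refine eventually_eq_of_hasMFDerivAt_zero (E := ℂ) ?_
      filter_upwards [hgood] with q hq
      obtain ⟨k1, k2, k3, k4⟩ := hq
      have m1 := HasMFDerivAt.comp (g := e.chart ∘ f) (f := j) q
        ((contMDiffAt_chart_comp hf e k1.1).mdifferentiableAt (by simp)).hasMFDerivAt
        ((hj q).mdifferentiableAt (by simp)).hasMFDerivAt
      refine m1.congr_mfderiv (ContinuousLinearMap.ext fun v => ?_)
      have m2 : mfderiv 𝓘(ℂ, ℂ) 𝓘(ℂ, E) j q v ∈ charFoliation σ (f ⁻¹' H) (j q) := by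
        rw [← htan q]; exact mem_range_self v
      rw [charFoliation_eq hX hf hdim e k1 k2 k3 (hreg q).1 k4] at m2
      obtain ⟨c, hc⟩ := m2
      exact (congrArg (fibDeriv E f e (j q)) hc).trans
        (fibDeriv_ham hX.symplectic e hX hf hdim k1 _)
    filter_upwards [hconst, hgood] with q hq hq'
    have hp' : f (j p) = t := hp
    have : e.chart (f (j q)) = e.chart t := hq.trans (congrArg e.chart hp')
    exact e.chart.injOn hq'.1.1 e.mem_source this
  have := IsClopen.eq_univ ⟨hclosed, hopen⟩ ⟨p₀, hp₀⟩
  exact (this ▸ mem_univ p : p ∈ {p | f (j p) = t})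

variable {hX : IsHyperkahler σ} (a : FibreAction (E := E) hX.symplectic f e)

/-- In the time coordinate of a flow box the velocities of an integral submanifold are multiples of
`α`, so it moves only along `ℂα`. Hence the preimage under `j` of the orbit is open and closed in
the connected source. -/
theorem subset_orbit_of_isIntegral (hf : IsLagrangianFibration σ f n)
    (hdim : Module.finrank ℂ E = 2 * n) (ht : IsSmoothFibre E f e) {H : Set B} {α : Cotangent n}
    (hα : HasConormal e H α) {L : Set X} (hL : IsIntegralSubmanifold σ (f ⁻¹' H) L) {x : X}
    (hxL : x ∈ L) (hx : f x = t) : L ⊆ range fun c : ℂ => a.Φ (c • α) x := by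
  have := hX.manifold
  have := hX.hausdorff
  have hbox : ∀ y, f y = t → Nonempty (FlowBox (E := E) hX.symplectic f e y) := fun y hy =>
    nonempty_flowBox hX hf hdim e hy (mem_submersiveLocus ht hy)
  obtain ⟨N, _, _, j, hN, -, hNc, hj, -, rfl, hall⟩ := hL
  obtain ⟨p₀, rfl⟩ := hxL
  have hfib := fibre_of_isIntegral hX hf hdim ht hα hj (fun p => (hall p).1)
    (fun p => (hall p).2.2) hx
  obtain ⟨w, hw⟩ : ∃ w, α w = 1 := by
    obtain ⟨w, hw⟩ := DFunLike.ne_iff.1 hα.1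
    exact ⟨(α w)⁻¹ • w, by rw [map_smul, smul_eq_mul]; exact inv_mul_cancel₀ hw⟩
  -- The projection along `ℂα` onto the covectors vanishing on `w`, where `α w = 1`.
  set π : Cotangent n →L[ℂ] Cotangent n := ContinuousLinearMap.id ℂ _ -
    (ContinuousLinearMap.apply ℂ ℂ w).smulRight α with hπ
  have hπ_apply : ∀ s, π s = s - s w • α := fun s => rfl
  have key : ∀ p, ∀ᶠ q in 𝓝 p, ∃ c : ℂ, a.Φ (c • α) (j p) = j q := by
    intro p
    obtain ⟨b⟩ := hbox (j p) (hfib p)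
    have hU := hj.continuous.continuousAt.preimage_mem_nhds (b.isOpen_U.mem_nhds b.mem_U)
    have hconst : ∀ᶠ q in 𝓝 p, (π ∘ (b.u ∘ j)) q = (π ∘ (b.u ∘ j)) p := by
      refine eventually_eq_of_hasMFDerivAt_zero (E := ℂ) ?_
      filter_upwards [hU] with q hq
      have m1 := HasMFDerivAt.comp (g := b.u) (f := j) q
        ((b.u_smooth _ hq).mdifferentiableAt (by simp)).hasMFDerivAt
        ((hj q).mdifferentiableAt (by simp)).hasMFDerivAt
      have m2 := HasMFDerivAt.comp (g := π) (f := b.u ∘ j) q π.hasFDerivAt.hasMFDerivAt m1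
      refine m2.congr_mfderiv (ContinuousLinearMap.ext fun v => ?_)
      have m3 : mfderiv 𝓘(ℂ, ℂ) 𝓘(ℂ, E) j q v ∈ charFoliation σ (f ⁻¹' H) (j q) := by
        rw [← (hall q).2.2]; exact mem_range_self v
      rw [charFoliation_fibre hX hf hdim ht hα (hfib q)] at m3
      obtain ⟨c, hc⟩ := m3
      have m4 := (congrArg (mfderiv 𝓘(ℂ, E) 𝓘(ℂ, Cotangent n) b.u (j q)) hc).trans
        (b.mfderiv_u_ham hq (hfib q) _)
      refine (congrArg π m4).trans ?_
      rw [hπ_apply]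
      rw [show (c • α) w = c * α w from rfl, hw, mul_one, sub_self]
      rfl
    filter_upwards [hconst, hU] with q hq hqU
    refine ⟨b.u (j q) w, ?_⟩
    have m1 : π (b.u (j q)) = 0 := by
      have : π (b.u (j q)) = π (b.u (j p)) := hq
      rw [this, b.u_zero, map_zero]
    rw [hπ_apply, sub_eq_zero] at m1
    rw [← m1]
    exact (a.exists_eq_of_mem_box hbox (hfib p) b hqU (hfib q)).2
  have hopen : IsOpen {q | ∃ c : ℂ, a.Φ (c • α) (j p₀) = j q} := by
    rw [isOpen_iff_mem_nhds]
    rintro q ⟨c, hc⟩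
    filter_upwards [key q] with q' hq'
    obtain ⟨c', hc'⟩ := hq'
    exact ⟨c' + c, by
      rw [show (c' + c) • α = c' • α + c • α from add_smul c' c α, a.add _ _ _ hx, hc, hc']⟩
  have hclosed : IsClosed {q | ∃ c : ℂ, a.Φ (c • α) (j p₀) = j q} := by
    rw [← isOpen_compl_iff, isOpen_iff_mem_nhds]
    intro q hq
    filter_upwards [key q] with q' hq'
    rintro ⟨c, hc⟩
    obtain ⟨c', hc'⟩ := hq'
    refine hq ⟨-c' + c, ?_⟩
    rw [show (-c' + c) • α = -(c' • α) + c • α from by rw [← neg_smul c' α]; exact add_smul (-c') c α,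
      a.add _ _ _ hx, hc, ← hc', a.neg_add_cancel (hfib q)]
  have huniv := IsClopen.eq_univ ⟨hclosed, hopen⟩ ⟨p₀, 0, by rw [zero_smul ℂ α]; exact a.zero _⟩
  rintro _ ⟨q, rfl⟩
  exact (huniv ▸ mem_univ q : q ∈ {q | ∃ c : ℂ, a.Φ (c • α) (j p₀) = j q})

/-- Absence of nonzero periods on `ℂα` makes the parametrisation by `ℂ` injective; its velocity is
the Hamiltonian vector of `α`, which spans the foliation. -/
theorem isIntegral_orbit (hf : IsLagrangianFibration σ f n)
    (hdim : Module.finrank ℂ E = 2 * n) (ht : IsSmoothFibre E f e) {H : Set B} {α : Cotangent n}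
    (hα : HasConormal e H α) {x : X} (hx : f x = t)
    (hper : ∀ c : ℂ, c • α ∈ a.periods hx → c = 0) :
    IsIntegralSubmanifold σ (f ⁻¹' H) (range fun c : ℂ => a.Φ (c • α) x) := by
  set lin : ℂ →L[ℂ] Cotangent n := (ContinuousLinearMap.id ℂ ℂ).smulRight α with hlin
  have hder : ∀ c : ℂ, HasMFDerivAt 𝓘(ℂ, ℂ) 𝓘(ℂ, E) (fun c : ℂ => a.Φ (c • α) x) c
      (ham (E := E) hX.symplectic f e (a.Φ (c • α) x) ∘L lin) := fun c =>
    HasMFDerivAt.comp (g := fun s => a.Φ s x) (f := lin) c (a.isFlowAt x hx (lin c)).2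
      lin.hasFDerivAt.hasMFDerivAt
  have hder_apply : ∀ c v : ℂ, mfderiv 𝓘(ℂ, ℂ) 𝓘(ℂ, E) (fun c : ℂ => a.Φ (c • α) x) c v =
      ham (E := E) hX.symplectic f e (a.Φ (c • α) x) (v • α) := fun c v =>
    DFunLike.congr_fun (hder c).mfderiv v
  refine ⟨ℂ, inferInstance, inferInstance, fun c => a.Φ (c • α) x, inferInstance, inferInstance,
    inferInstance, ?_, ?_, rfl, fun c => ⟨?_, ?_, ?_⟩⟩
  · exact ContMDiff.comp (g := fun s => a.Φ s x) (f := lin) (a.smooth x hx)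
      lin.contDiff.contMDiff
  · intro c c' h
    have := (a.sub_mem_periods hx).2 h
    rw [← sub_smul c c' α] at this
    exact sub_eq_zero.1 (hper _ this)
  · exact subset_regularLocus hX hf ht hα (a.fibre hx _)
  · intro v v' h
    have h1 := (hder_apply c v).symm.trans (h.trans (hder_apply c v'))
    have h2 := ham_injective hX.symplectic e (ht _ (a.fibre hx (c • α))) h1
    exact smul_left_injective ℂ hα.1 h2
  · rw [charFoliation_fibre hX hf hdim ht hα (a.fibre hx _)]
    ext b
    constructor
    · rintro ⟨v, rfl⟩
      exact ⟨v, hder_apply c v⟩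
    · rintro ⟨v, rfl⟩
      exact ⟨v, hder_apply c v⟩

/-- Maximality holds because every integral submanifold through `x` is contained in the orbit; the
same containment gives uniqueness of the leaf. -/
theorem isLeaf_orbit (hf : IsLagrangianFibration σ f n)
    (hdim : Module.finrank ℂ E = 2 * n) (ht : IsSmoothFibre E f e) {H : Set B} {α : Cotangent n}
    (hα : HasConormal e H α) {x : X} (hx : f x = t)
    (hper : ∀ c : ℂ, c • α ∈ a.periods hx → c = 0) :
    IsLeaf σ (f ⁻¹' H) (range fun c : ℂ => a.Φ (c • α) x) := by
  refine ⟨isIntegral_orbit (hX := hX) a hf hdim ht hα hx hper, fun L hL hle => Subset.antisymm ?_ hle⟩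
  exact subset_orbit_of_isIntegral (hX := hX) a hf hdim ht hα hL
    (hle ⟨0, by simp only [zero_smul ℂ α, a.zero]⟩) hx

theorem eq_orbit_of_isLeaf (hf : IsLagrangianFibration σ f n)
    (hdim : Module.finrank ℂ E = 2 * n) (ht : IsSmoothFibre E f e) {H : Set B} {α : Cotangent n}
    (hα : HasConormal e H α) {x : X} (hx : f x = t)
    (hper : ∀ c : ℂ, c • α ∈ a.periods hx → c = 0) {L : Set X} (hL : IsLeaf σ (f ⁻¹' H) L)
    (hxL : x ∈ L) : L = range fun c : ℂ => a.Φ (c • α) x :=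
  (hL.2 _ (isIntegral_orbit (hX := hX) a hf hdim ht hα hx hper)
    (subset_orbit_of_isIntegral (hX := hX) a hf hdim ht hα hL.1 hxL hx)).symm

end Leaves

theorem IsIrrational.comap_symm {K K' : Type*} [AddCommGroup K] [Module ℂ K] [Module ℝ K]
    [IsScalarTower ℝ ℂ K] [AddCommGroup K'] [Module ℂ K'] [Module ℝ K'] [IsScalarTower ℝ ℂ K']
    {Γ : Submodule ℤ K} {α : K} (h : IsIrrational Γ (Submodule.span ℂ {α})) (ψ : K ≃ₗ[ℂ] K')
    {Γ' : Submodule ℤ K'} (hΓ' : ∀ v, v ∈ Γ' ↔ ψ.symm v ∈ Γ) :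
    IsIrrational Γ' (Submodule.span ℂ {ψ α}) := by
  intro W hW hle
  set ψ' : K ≃ₗ[ℝ] K' := ψ.restrictScalars ℝ with hψ'
  have hpre : (W.comap ψ'.toLinearMap : Set K) ∩ Γ = ψ'.symm.toLinearMap '' ((W : Set K') ∩ Γ') := by
    ext v
    constructor
    · rintro ⟨h1, h2⟩
      refine ⟨ψ v, ⟨h1, (hΓ' _).2 ?_⟩, ψ.symm_apply_apply v⟩
      rwa [ψ.symm_apply_apply]
    · rintro ⟨w, ⟨h1, h2⟩, rfl⟩
      refine ⟨?_, (hΓ' _).1 h2⟩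
      change ψ (ψ.symm w) ∈ W
      rwa [ψ.apply_symm_apply]
  have htop := h (W.comap ψ'.toLinearMap) (by
    rw [hpre, Submodule.span_image, hW]
    exact (Submodule.comap_equiv_eq_map_symm ψ' W).symm) (by
    intro v hv
    obtain ⟨c, rfl⟩ := Submodule.mem_span_singleton.1 hv
    refine hle ?_
    change ψ (c • α) ∈ Submodule.span ℂ {ψ α}
    rw [map_smul]
    exact Submodule.smul_mem _ _ (Submodule.mem_span_singleton_self _))
  rw [eq_top_iff]
  intro w _
  have : ψ.symm w ∈ W.comap ψ'.toLinearMap := htop ▸ Submodule.mem_top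
  have h2 : ψ (ψ.symm w) ∈ W := this
  rwa [ψ.apply_symm_apply] at h2

/-! ### The fibre as a torus and density of the leaf -/

section Torus

variable {E : Type*} [NormedAddCommGroup E] [NormedSpace ℂ E] [FiniteDimensional ℂ E]
  {X : Type*} [TopologicalSpace X] [ChartedSpace E X]
  {B : Type*} [TopologicalSpace B] [ComplexSpace B] {n : ℕ} {t : B}
  {σ : X → E [⋀^Fin 2]→L[ℂ] ℂ} {f : X → B} {e : SmoothChart B n t}

omit [FiniteDimensional ℂ E] in
theorem isCompact_fibre (hX : IsHyperkahler σ) (hf : IsLagrangianFibration σ f n) (t : B) :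
    IsCompact (f ⁻¹' {t}) := by
  have := hX.compact
  have := hf.hausdorff
  exact (isClosed_singleton.preimage hf.continuous).isCompact

/-- The isomorphism `T_t^* B ≅ T_x T` given by Hamiltonian vector fields. -/
noncomputable def hamEquiv (hX : IsHyperkahler σ) (hf : IsLagrangianFibration σ f n)
    (hdim : Module.finrank ℂ E = 2 * n) {x : X} (hx : x ∈ submersiveLocus (E := E) f e) :
    Cotangent n ≃ₗ[ℂ] fibreTangent E f e x :=
  (LinearEquiv.ofInjective (ham hX.symplectic f e x : Cotangent n →ₗ[ℂ] E)
    (ham_injective hX.symplectic e hx.2)).trans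
    (LinearEquiv.ofEq _ _ (range_ham hX.symplectic e hX hf hdim hx))

/-- The fibre over `t` as the quotient of its tangent space by the periods of the Hamiltonian
action. -/
noncomputable def torusFibre (hX : IsHyperkahler σ) (hf : IsLagrangianFibration σ f n)
    (hdim : Module.finrank ℂ E = 2 * n) (ht : IsSmoothFibre E f e)
    (a : FibreAction (E := E) hX.symplectic f e) {x : X} (hx : f x = t) :
    TorusFibre σ f e x :=
  let ψ := hamEquiv hX hf hdim (mem_submersiveLocus ht hx)
  let ψ' : fibreTangent E f e x →L[ℂ] Cotangent n :=
    LinearMap.toContinuousLinearMap ψ.symm.toLinearMap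
  have hT2 : T2Space X := hX.hausdorff
  have hbox : ∀ y, f y = t → Nonempty (FlowBox (E := E) hX.symplectic f e y) := fun _ hy =>
    nonempty_flowBox hX hf hdim e hy (mem_submersiveLocus ht hy)
  have hcomp := isCompact_fibre hX hf t
  have hder : ∀ v, HasMFDerivAt 𝓘(ℂ, fibreTangent E f e x) 𝓘(ℂ, E) (fun v => a.Φ (ψ' v) x) v
      (ham (E := E) hX.symplectic f e (a.Φ (ψ' v) x) ∘L ψ') := fun v =>
    HasMFDerivAt.comp (g := fun s => a.Φ s x) (f := ψ') v (a.isFlowAt x hx (ψ' v)).2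
      ψ'.hasFDerivAt.hasMFDerivAt
  { ofCotangent := ψ
    ofCotangent_spec := fun α b => form_ham hX.symplectic e x α b
    lattice := (a.periods hx).comap (ψ.symm.toLinearMap.restrictScalars ℤ)
    discrete := by
      have := a.discreteTopology_periods hbox hx
      refine DiscreteTopology.of_continuous_injective
        (f := fun v : (a.periods hx).comap (ψ.symm.toLinearMap.restrictScalars ℤ) =>
          (⟨ψ.symm v, v.2⟩ : a.periods hx)) ?_ ?_
      · exact (ψ'.continuous.comp continuous_subtype_val).subtype_mk _
      · intro v v' h
        exact Subtype.ext (ψ.symm.injective (congrArg Subtype.val h))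
    full := by
      have h := a.span_periods hcomp hbox (hf.connected_fibres t).isPreconnected hx
      set ψr : Cotangent n ≃ₗ[ℝ] fibreTangent E f e x := ψ.restrictScalars ℝ with hψr
      have himg : (((a.periods hx).comap (ψ.symm.toLinearMap.restrictScalars ℤ) :
          Submodule ℤ (fibreTangent E f e x)) : Set (fibreTangent E f e x)) =
          ψr.toLinearMap '' (a.periods hx : Set (Cotangent n)) := by
        ext v
        constructor
        · intro hv
          exact ⟨ψ.symm v, hv, ψ.apply_symm_apply v⟩
        · rintro ⟨s, hs, rfl⟩
          change ψ.symm (ψ s) ∈ a.periods hx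
          rwa [ψ.symm_apply_apply]
      rw [himg, Submodule.span_image, h, Submodule.map_top]
      exact ψr.range
    proj := fun v => a.Φ (ψ' v) x
    proj_hol := ContMDiff.comp (g := fun s => a.Φ s x) (f := ψ') (a.smooth x hx)
      ψ'.contDiff.contMDiff
    proj_immersion := by
      intro v w w' h
      have h1 := (DFunLike.congr_fun (hder v).mfderiv w).symm.trans
        (h.trans (DFunLike.congr_fun (hder v).mfderiv w'))
      exact ψ.symm.injective (ham_injective hX.symplectic e (ht _ (a.fibre hx (ψ' v))) h1)
    proj_range := by
      ext y
      constructor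
      · rintro ⟨v, rfl⟩
        exact a.fibre hx _
      · intro hy
        obtain ⟨s, rfl⟩ := a.transitive hbox (hf.connected_fibres t).isPreconnected hx hy
        exact ⟨ψ s, congrArg (fun s => a.Φ s x) (ψ.symm_apply_apply s)⟩
    proj_eq_iff := by
      intro v w
      rw [← a.sub_mem_periods hx, ← map_sub]
      rfl
    proj_zero := by
      rw [map_zero]
      exact a.zero x
    proj_deriv_zero := by
      have h1 := hder 0
      have h2 : ham (E := E) hX.symplectic f e (a.Φ (ψ' 0) x) ∘L ψ' =
          (fibreTangent E f e x).subtypeL := by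
        ext1 v
        rw [map_zero, a.zero x]
        exact congrArg Subtype.val (ψ.apply_symm_apply v)
      exact h1.congr_mfderiv h2 }

/-- The orbit map at `x` is continuous, maps onto the fibre, and sends the dense set `ℂα + periods`
into the orbit of `ℂα`, so this orbit is dense in the fibre. -/
theorem hasDenseIrrationalLeaf (hX : IsHyperkahler σ) (hf : IsLagrangianFibration σ f n)
    (hdim : Module.finrank ℂ E = 2 * n) (ht : IsSmoothFibre E f e)
    (a : FibreAction (E := E) hX.symplectic f e) {x : X} (hx : f x = t) {H : Set B}
    {α : Cotangent n} (hα : HasConormal e H α)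
    (hK : ∀ K ∈ exceptionalSubspaces (a.periods hx), α ∉ K) :
    HasDenseIrrationalLeaf σ f e H α x (torusFibre hX hf hdim ht a hx) := by
  have hT2 : T2Space X := hX.hausdorff
  have hbox : ∀ y, f y = t → Nonempty (FlowBox (E := E) hX.symplectic f e y) := fun _ hy =>
    nonempty_flowBox hX hf hdim e hy (mem_submersiveLocus ht hy)
  have hcomp := isCompact_fibre hX hf t
  have hper : ∀ c : ℂ, c • α ∈ a.periods hx → c = 0 := fun c hc =>
    smul_notMem_of_forall_notMem _ hK hc
  have hirr := isIrrational_of_forall_notMem _ hK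
  set ψ := hamEquiv hX hf hdim (mem_submersiveLocus ht hx) with hψ
  have hproj : ∀ s, (torusFibre hX hf hdim ht a hx).proj (ψ s) = a.Φ s x := fun s =>
    congrArg (fun s => a.Φ s x) (ψ.symm_apply_apply s)
  refine ⟨range fun c : ℂ => a.Φ (c • α) x, isLeaf_orbit (hX := hX) a hf hdim ht hα hx hper,
    ⟨0, by simp only [zero_smul ℂ α, a.zero]⟩,
    fun L hL hxL => eq_orbit_of_isLeaf (hX := hX) a hf hdim ht hα hx hper hL hxL,
    ?_, hirr.comap_symm ψ fun v => Iff.rfl, ?_, ?_⟩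
  · ext y
    constructor
    · rintro ⟨c, rfl⟩
      refine ⟨ψ (c • α), ?_, hproj _⟩
      rw [map_smul]
      exact Submodule.smul_mem _ _ (Submodule.mem_span_singleton_self _)
    · rintro ⟨v, hv, rfl⟩
      obtain ⟨c, rfl⟩ := Submodule.mem_span_singleton.1 hv
      refine ⟨c, (hproj (c • α)).symm.trans ?_⟩
      rw [map_smul]
      rfl
  · rintro _ ⟨c, rfl⟩
    exact a.fibre hx _
  · intro y hy
    obtain ⟨s, rfl⟩ := a.transitive hbox (hf.connected_fibres t).isPreconnected hx hy
    have := a.discreteTopology_periods hbox hx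
    have hd := dense_line_add_lattice (a.periods hx)
      (a.span_periods hcomp hbox (hf.connected_fibres t).isPreconnected hx) hirr
    have h1 := image_closure_subset_closure_image (a.smooth x hx).continuous
      (mem_image_of_mem (fun s => a.Φ s x) (hd s))
    refine closure_mono ?_ h1
    rintro _ ⟨_, ⟨c, g, hg, rfl⟩, rfl⟩
    refine ⟨c, ?_⟩
    change a.Φ (c • α) x = a.Φ (c • α + g) x
    rw [a.add _ _ _ hx, (a.mem_periods hx).1 hg]

end Torus

/-! ### Linear systems and conormal covectors -/

namespace LinearSystem

variable {B : Type*} [TopologicalSpace B] [ComplexSpace B] {n : ℕ} {t : B} {ι V : Type*}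
  [AddCommGroup V] [Module ℂ V]

theorem analyticAt_section (S : LinearSystem B ι V) (e : SmoothChart B n t) {i : ι}
    (hi : t ∈ S.U i) (v : V) : AnalyticAt ℂ (S.s v i ∘ e.chart.symm) (e.chart t) := by
  obtain ⟨G, hG, hGe⟩ := (e.holAt_iff t e.mem_source _).1 (S.s_hol v i t hi)
  refine hG.congr ?_
  have hsymm : Tendsto e.chart.symm (𝓝 (e.chart t)) (𝓝 t) := by
    have := e.chart.continuousAt_symm (e.chart.map_source e.mem_source)
    rwa [ContinuousAt, e.chart.left_inv e.mem_source] at this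
  filter_upwards [hsymm.eventually hGe,
    e.chart.open_target.mem_nhds (e.chart.map_source e.mem_source)] with z hz hzt
  simp only [Function.comp] at hz ⊢
  rw [hz, e.chart.right_inv hzt]

/-- The differentials at `t` of the sections vanishing at `t`. -/
noncomputable def differential (S : LinearSystem B ι V) (e : SmoothChart B n t) {i : ι}
    (hi : t ∈ S.U i) : S.through t →ₗ[ℂ] Cotangent n where
  toFun v := fderiv ℂ (S.s v i ∘ e.chart.symm) (e.chart t)
  map_add' v w := by
    have : S.s (v + w : S.through t) i ∘ e.chart.symm =
        S.s v i ∘ e.chart.symm + S.s w i ∘ e.chart.symm := by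
      funext z; simp
    rw [this, fderiv_add (S.analyticAt_section e hi v).differentiableAt
      (S.analyticAt_section e hi w).differentiableAt]
  map_smul' c v := by
    have : S.s (c • v : S.through t) i ∘ e.chart.symm = c • (S.s v i ∘ e.chart.symm) := by
      funext z; simp
    rw [this, fderiv_const_smul (S.analyticAt_section e hi v).differentiableAt]
    rfl

/-- Vanishing in one trivialisation forces vanishing in any other, so near `t` the zero locus has a
single local equation, whose differential at `t` is the conormal covector. -/
theorem hasConormal_zeroLocus (S : LinearSystem B ι V) (e : SmoothChart B n t) {i : ι}
    (hi : t ∈ S.U i) (v : S.through t) (hv : S.differential e hi v ≠ 0) :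
    HasConormal e (S.zeroLocus v) (S.differential e hi v) := by
  refine ⟨hv, ⟨i, hi, v.2 i hi⟩, S.s v i ∘ e.chart.symm, S.analyticAt_section e hi v, rfl, ?_⟩
  filter_upwards [(S.isOpen_U i).mem_nhds hi, e.chart.open_source.mem_nhds e.mem_source] with c hc hcs
  rw [Function.comp, e.chart.left_inv hcs]
  constructor
  · rintro ⟨k, hk, hz⟩
    rw [S.s_glue v i k c ⟨hc, hk⟩, hz, mul_zero]
  · intro h
    exact ⟨i, hc, h⟩

end LinearSystem

end CharFol

/-! ### The main theorem -/

open CharFol in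
theorem mainTheorem10
    {E : Type*} [NormedAddCommGroup E] [NormedSpace ℂ E] [FiniteDimensional ℂ E]
    {X : Type*} [TopologicalSpace X] [ChartedSpace E X]
    {B : Type*} [TopologicalSpace B] [ComplexSpace B]
    (n : ℕ) (hn : 1 < n) (hdim : Module.finrank ℂ E = 2 * n)
    (σ : X → E [⋀^Fin 2]→L[ℂ] ℂ) (hX : IsHyperkahler σ)
    (f : X → B) (hf : IsLagrangianFibration σ f n)
    (t : B) (e : SmoothChart B n t) (ht : IsSmoothFibre E f e) :
    ∃ T : ∀ x : X, f x = t → TorusFibre σ f e x,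
      -- hypersurfaces with very general tangent hyperplane at `t`
      ForVeryGeneral (fun q : ℙ ℂ (Cotangent n) =>
        ∀ H : Set B, HasConormal e H q.rep →
          f ⁻¹' {t} ⊆ regularLocus E (f ⁻¹' H) ∧
          ∀ (x : X) (hx : f x = t), HasDenseIrrationalLeaf σ f e H q.rep x (T x hx)) ∧
      -- very general members through `t` of a linear system
      ∀ (ι : Type*) (V : Type*) [AddCommGroup V] [Module ℂ V] [FiniteDimensional ℂ V]
        (S : LinearSystem B ι V), S.SeparatesTangents e →
        ForVeryGeneral (fun q : ℙ ℂ (S.through t) =>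
          ∃ α : Cotangent n, HasConormal e (S.zeroLocus q.rep) α ∧
            f ⁻¹' {t} ⊆ regularLocus E (f ⁻¹' S.zeroLocus q.rep) ∧
            ∀ (x : X) (hx : f x = t),
              HasDenseIrrationalLeaf σ f e (S.zeroLocus q.rep) α x (T x hx)) := by
  have hT2 : T2Space X := hX.hausdorff
  have hbox : ∀ y, f y = t → Nonempty (FlowBox (E := E) hX.symplectic f e y) := fun _ hy =>
    nonempty_flowBox hX hf hdim e hy (mem_submersiveLocus ht hy)
  have hcomp := isCompact_fibre hX hf t
  obtain ⟨a⟩ := nonempty_fibreAction hcomp hbox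
  obtain ⟨x₀, hx₀⟩ := hf.surjective t
  -- All points of the fibre have the same periods, so one countable family of exceptional subspaces
  -- serves every `x` simultaneously.
  have hper : ∀ x (hx : f x = t), a.periods hx₀ = a.periods hx := fun x hx =>
    a.periods_eq hx₀ hx (a.transitive hbox (hf.connected_fibres t).isPreconnected hx₀ hx)
  have := a.discreteTopology_periods hbox hx₀
  have hcount := countable_exceptionalSubspaces (a.periods hx₀)
  have hne := exceptionalSubspaces_nonempty (a.periods hx₀)
  have hproper := exceptionalSubspaces_ne_top (a.periods hx₀) (by rwa [finrank_cotangent])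
  have hleaf : ∀ (H : Set B) (α : Cotangent n), HasConormal e H α →
      (∀ K ∈ exceptionalSubspaces (a.periods hx₀), α ∉ K) → ∀ (x : X) (hx : f x = t),
      HasDenseIrrationalLeaf σ f e H α x (torusFibre hX hf hdim ht a hx) := fun H α hα hK x hx =>
    hasDenseIrrationalLeaf hX hf hdim ht a hx hα (hper x hx ▸ hK)
  refine ⟨fun x hx => torusFibre hX hf hdim ht a hx, ?_, ?_⟩
  · refine ForVeryGeneral.of_countable_submodules hcount hne hproper fun q hq H hH => ?_
    exact ⟨subset_regularLocus hX hf ht hH, hleaf H q.rep hH hq⟩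
  · intro ι V _ _ _ S hS
    obtain ⟨i, hi⟩ := S.cover t
    have hsurj : Function.Surjective (S.differential e hi) := fun α => by
      obtain ⟨v, hv, h⟩ := hS i hi α
      exact ⟨⟨v, hv⟩, h⟩
    -- The exceptional subspaces are pulled back to `V_t` along the differential at `t`; they remain
    -- proper because it is surjective.
    refine ForVeryGeneral.of_countable_submodules (hcount.image (Submodule.comap (S.differential e hi)))
      (hne.image _) ?_ fun q hq => ?_
    · rintro _ ⟨K, hK, rfl⟩ h
      refine hproper K hK (eq_top_iff.2 fun α _ => ?_)
      obtain ⟨v, rfl⟩ := hsurj α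
      have : v ∈ K.comap (S.differential e hi) := h ▸ Submodule.mem_top
      exact this
    · have hK : ∀ K ∈ exceptionalSubspaces (a.periods hx₀), S.differential e hi q.rep ∉ K :=
        fun K hK => hq _ ⟨K, hK, rfl⟩
      have hH := S.hasConormal_zeroLocus e hi q.rep (ne_zero_of_forall_notMem _ hK)
      exact ⟨_, hH, subset_regularLocus hX hf ht hH, hleaf _ _ hH hK⟩
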